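/- **Setting.** A supergeometry $(X,T^*_{X,-})$ is a complex manifold $X$ with a holomorphic vector bundle $T^*_{X,-}$ (identified with its locally free sheaf of sections). Put $\mathcal J^k_X=\bigoplus_{j\ge k}\wedge^jT^*_{X,-}$ and let $\xi^j:\wedge^\bullet T^*_{X,-}\to\wedge^jT^*_{X,-}$ be the projections. For $k\ge 2$ let $\mathcal G^{(k)}_X$ be the sheaf of groups of automorphisms $\alpha$ of the sheaf of $\mathbb C$-superalgebras $\wedge^\bullet T^*_{X,-}$ with $\alpha(s)-s\in\mathcal J^k_X$ for all $s$. An embedding of supergeometries $(Y,T^*_{Y,-})\subset(X,T^*_{X,-})$ is a closed holomorphic embedding $i:Y\to X$ with a surjection $i^*T^*_{X,-}\to T^*_{Y,-}$; it is *even* if this surjection is an isomorphism. Let $\mathcal I_0=\ker(\wedge^\bullet T^*_{X,-}\to i_*\wedge^\bullet T^*_{Y,-})$, let $\mathcal G^{(k)}_{Y;X}\subset\mathcal G^{(k)}_X$ be the subsheaf of automorphisms preserving $\mathcal I_0$, and put $\mathcal Q^{(k)}_X=\mathcal G^{(k)}_X/\mathcal G^{(k+1)}_X$, $\mathcal Q^{(k)}_{Y;X}=\mathcal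 G^{(k)}_{Y;X}/\mathcal G^{(k+1)}_{Y;X}$ (sheaves of abelian groups) and $\mathcal R^{(k)}=\mathcal Q^{(k)}_X/\mathcal Q^{(k)}_{Y;X}$. Elements of $\check H^1(X,\mathcal G^{(k)}_{Y;X})$ are the $(k-1)$-split embeddings, and the primary obstruction is the induced map $\omega:\check H^1(X,\mathcal G^{(k)}_{Y;X})\to H^1(X,\mathcal Q^{(k)}_{Y;X})$. Let $\delta:H^0(X,\mathcal R^{(k)})\to H^1(X,\mathcal Q^{(k)}_{Y;X})$ be the connecting map. Let $N^*_+=\mathcal I_Y$ be the ideal sheaf of $Y$, let $N^*_-=\ker(T^*_{X,-}\to i_*T^*_{Y,-})$, and put $N^*_{(\pm)^k}=N^*_+$ for $k$ even, $N^*_-$ for $k$ odd. An *ideal sheaf for an embedding* is a $\mathbb Z_2$-graded sheaf of ideals $\mathcal I=\mathcal I^+\oplus\mathcal I^-\subset\wedge^\bullet T^*_{X,-}$ with $\mathcal I^\pm\bmod\mathcal J_X^2=N^*_\pm$ and such that $\wedge^\bullet T^*_{X,-}/\mathcal I$ is locally isomorphic to $i_*\wedge^\bullet T^*_{Y,-}$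 as a sheaf of superalgebras. A *system of generators* $F$ of $\mathcal I$ consists of $\mathcal O_X$-linear morphisms $F^\pm:N^*_\pm\to\mathcal I^\pm$ that are the identity modulo $\mathcal J^2_X$ and whose images generate $\mathcal I$. Its *maximal splitting degree* $m_F\in\{2,3,\dots,\infty\}$ is the smallest $m\ge2$ with $\xi^m(F^+)\neq0$ or $\xi^m(F^-)\ne0$ ($\infty$ if there is none). Let $\mathscr S^{\ge k}$ be the set of pairs $(\mathcal I,F)$ with $m_F\ge k$; for such a pair let $h_F=\xi^k(F^{(\pm)^k})\in\mathrm{Hom}_{\mathcal O_X}(N^*_{(\pm)^k},\wedge^kT^*_{X,-})$, the leading component of $F$ if $m_F=k$, and $0$ if $m_F>k$. A global section $r$ of $\mathcal R^{(k)}$ is *induced* by $h\in\mathrm{Hom}_{\mathcal O_X}(N^*_{(\pm)^k},\wedge^kT^*_{X,-})$ if locally it is represented by some $\alpha\in\mathcal G^{(k)}_X$ such that $\xi^k(\alpha(n))-h(n)$ restricts to $0$ on $Y$ for all local sections $n$ of $N^*_{(\pm)^k}$. **Theorem.** Let $(Y,T^*_{Y,-})\subset(X,T^*_{X,-})$ be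 an even embedding of supergeometries and $k\ge2$. (a) Every $h\in\mathrm{Hom}_{\mathcal O_X}(N^*_{(\pm)^k},\wedge^kT^*_{X,-})$ induces at most one section of $\mathcal R^{(k)}$. If $k$ is even, every $h$ induces one; if $k$ is odd, $H^0(X,\mathcal R^{(k)})=0$. For all $k$, $h_F$ induces a section $\rho(h_F)$ for every $(\mathcal I,F)\in\mathscr S^{\ge k}$. Hence $\Theta=\delta\circ\rho:\mathrm{Hom}_{\mathcal O_X}(N^*_{(\pm)^k},\wedge^kT^*_{X,-})\to H^0(X,\mathcal R^{(k)})\to H^1(X,\mathcal Q^{(k)}_{Y;X})$ is well defined ($\rho=0$ for $k$ odd). (b) For $(\mathcal I,F)\in\mathscr S^{\ge k}$ there are an open cover $(U_x)$ of $X$ and $\alpha_x\in\mathcal G^{(k)}_X(U_x)$ with $\alpha_x(\mathcal I|_{U_x})=\mathcal I_0|_{U_x}$; the cocycle $(\alpha_x\alpha_y^{-1})$ has values in $\mathcal G^{(k)}_{Y;X}$, and its class $\Phi(\mathcal I,F)\in\check H^1(X,\mathcal G^{(k)}_{Y;X})$ does not depend on the choices. (c) For every $(\mathcal I,F)\in\mathscr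 S^{\ge k}$, $\ \Theta(h_F)=\omega(\Phi(\mathcal I,F))$ in $H^1(X,\mathcal Q^{(k)}_{Y;X})$. -/

import Mathlib

open CategoryTheory TopologicalSpace Opposite Limits
open scoped Manifold ContDiff Bundle

universe u

noncomputable section

/-! ### Non-abelian Čech cohomology in degree one -/

namespace Cech

variable {X : Type u} [TopologicalSpace X]

/-- A Čech 1-cocycle of a presheaf of groups on some open cover of `X`. The covers used are indexed
by the points of `X`, a point lying in the open set that carries its index; every open cover is
refined by such a cover, so they suffice for computing the limit over all covers. -/
structure Cocycle (G : (Opens X)ᵒᵖ ⥤ GrpCat.{u}) where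
  cover : X → Opens X
  mem_cover : ∀ x, x ∈ cover x
  cocycle : PresheafOfGroups.OneCocycle G cover

variable {G G' : (Opens X)ᵒᵖ ⥤ GrpCat.{u}}

/-- Restriction of a 1-cocycle to a finer cover. -/
def refine {U W : X → Opens X} (h : ∀ x, W x ≤ U x) (c : PresheafOfGroups.OneCocycle G U) :
    PresheafOfGroups.OneCocycle G W where
  ev i j _ a b := c.ev i j (a ≫ homOfLE (h i)) (b ≫ homOfLE (h j))
  ev_precomp i j T T' φ a b := by simp
  ev_trans i j k T a b d := c.ev_trans i j k _ _ _

theorem refine_isCohomologous {U W : X → Opens X} (h : ∀ x, W x ≤ U x)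
    {c c' : PresheafOfGroups.OneCocycle G U} (hc : c.IsCohomologous c') :
    (refine h c).IsCohomologous (refine h c') := by
  obtain ⟨α, hα⟩ := hc
  refine ⟨fun x => G.map (homOfLE (h x)).op (α x), fun i j T a b => ?_⟩
  have := hα i j (a ≫ homOfLE (h i)) (b ≫ homOfLE (h j))
  simpa [refine, op_comp] using this

/-- Two Čech cocycles, possibly on different covers, are equivalent when they become cohomologous
on a common refinement. -/
instance cocycleSetoid (G : (Opens X)ᵒᵖ ⥤ GrpCat.{u}) : Setoid (Cocycle G) where
  r c c' := ∃ (W : X → Opens X) (_ : ∀ x, x ∈ W x) (h : ∀ x, W x ≤ c.cover x)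
    (h' : ∀ x, W x ≤ c'.cover x), (refine h c.cocycle).IsCohomologous (refine h' c'.cocycle)
  iseqv := by
    refine ⟨fun c => ⟨c.cover, c.mem_cover, fun _ => le_rfl, fun _ => le_rfl, ?_⟩, ?_, ?_⟩
    · exact (PresheafOfGroups.OneCocycle.equivalence_isCohomologous _ _).refl _
    · rintro c c' ⟨W, hW, h, h', hc⟩
      exact ⟨W, hW, h', h, (PresheafOfGroups.OneCocycle.equivalence_isCohomologous _ _).symm hc⟩
    · rintro c c' c'' ⟨W, hW, h, h', hc⟩ ⟨W', hW', k, k', hc'⟩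
      refine ⟨fun x => W x ⊓ W' x, fun x => ⟨hW x, hW' x⟩, fun x => inf_le_left.trans (h x),
        fun x => inf_le_right.trans (k' x), ?_⟩
      have h1 := refine_isCohomologous (W := fun x => W x ⊓ W' x) (fun x => inf_le_left) hc
      have h2 := refine_isCohomologous (W := fun x => W x ⊓ W' x) (fun x => inf_le_right) hc'
      exact (PresheafOfGroups.OneCocycle.equivalence_isCohomologous _ _).trans h1 h2

/-- The Čech cohomology set `Ȟ¹(X, G)`: the limit over all open covers. -/
def H1 (G : (Opens X)ᵒᵖ ⥤ GrpCat.{u}) : Type u := Quotient (cocycleSetoid G)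

/-- The image of a cocycle under a morphism of presheaves of groups. -/
def Cocycle.map (η : G ⟶ G') (c : Cocycle G) : Cocycle G' where
  cover := c.cover
  mem_cover := c.mem_cover
  cocycle :=
    { ev := fun i j T a b => η.app (op T) (c.cocycle.ev i j a b)
      ev_precomp := fun i j T T' φ a b => by
        have := ConcreteCategory.congr_hom (η.naturality φ.op) (c.cocycle.ev i j a b)
        rw [ConcreteCategory.comp_apply, ConcreteCategory.comp_apply,
          c.cocycle.ev_precomp] at this
        exact this.symm
      ev_trans := fun i j k T a b d => by
        rw [← map_mul, c.cocycle.ev_trans] }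

/-- The map on `Ȟ¹` induced by a morphism of presheaves of groups. -/
def H1.map (η : G ⟶ G') : H1 G → H1 G' :=
  Quotient.map (Cocycle.map η) (by
    rintro c c' ⟨W, hW, h, h', α, hα⟩
    refine ⟨W, hW, h, h', fun x => η.app (op (W x)) (α x), fun i j T a b => ?_⟩
    have e := congrArg (η.app (op T)) (hα i j a b)
    have n1 := ConcreteCategory.congr_hom (η.naturality a.op) (α i)
    have n2 := ConcreteCategory.congr_hom (η.naturality b.op) (α j)
    simp only [map_mul] at e
    simp only [ConcreteCategory.comp_apply] at n1 n2
    rw [n1, n2] at e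
    exact e)

end Cech

/-- Abelian groups as (multiplicatively written) groups. -/
def abToGrp : AddCommGrpCat.{u} ⥤ GrpCat.{u} where
  obj A := GrpCat.of (Multiplicative A)
  map f := GrpCat.ofHom (AddMonoidHom.toMultiplicative f.hom)

/-! ### The connecting map of an exact sequence of abelian sheaves -/

namespace Cech

variable {X : Type u} [TopologicalSpace X]

/-- Sheaves of abelian groups on `X`. -/
abbrev AbSheaf (X : Type u) [TopologicalSpace X] :=
  Sheaf (Opens.grothendieckTopology X) AddCommGrpCat.{u}

/-- `Ȟ¹(X, A)` for a sheaf of abelian groups `A`. -/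
def AbH1 (A : AbSheaf X) : Type u := H1 (A.obj ⋙ abToGrp)

/-- Restriction of sections. -/
def sres (A : AbSheaf X) {U V : Opens X} (h : V ≤ U) (s : A.obj.obj (op U)) : A.obj.obj (op V) :=
  A.obj.map (homOfLE h).op s

variable {A B : AbSheaf X} (ι : A ⟶ B)

/-- The Čech cocycle `c` represents the image of the global section `r` of `B / A` under the
connecting map: on the cover of `c`, the section `r` lifts to sections `b x` of `B`, and
`c x y = b y - b x` on overlaps. -/
def IsConnecting (r : (cokernel ι).obj.obj (op ⊤)) (c : Cocycle (A.obj ⋙ abToGrp)) : Prop :=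
  ∃ b : ∀ x, B.obj.obj (op (c.cover x)),
    (∀ x, (cokernel.π ι).hom.app _ (b x) = sres (cokernel ι) le_top r) ∧
    ∀ x y (T : Opens X) (h : T ⟶ c.cover x) (h' : T ⟶ c.cover y),
      ι.hom.app (op T) (Multiplicative.toAdd (c.cocycle.ev x y h h')) =
        B.obj.map h'.op (b y) - B.obj.map h.op (b x)

theorem injective_app [Mono ι] (U : Opens X) : Function.Injective (ι.hom.app (op U)) := by
  have : Mono (((sheafToPresheaf _ _) ⋙ (evaluation _ _).obj (op U)).map ι) := inferInstance
  exact (AddCommGrpCat.mono_iff_injective _).1 this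

theorem π_comp_ι (U : Opens X) (a : A.obj.obj (op U)) :
    (cokernel.π ι).hom.app (op U) (ι.hom.app (op U) a) = 0 := by
  have h := cokernel.condition ι
  exact congrArg (fun f => (((sheafToPresheaf (Opens.grothendieckTopology X) AddCommGrpCat.{u}) ⋙
    (evaluation _ _).obj (op U)).map f) a) h

theorem exists_of_π_eq_zero [Mono ι] (U : Opens X) (b : B.obj.obj (op U))
    (hb : (cokernel.π ι).hom.app (op U) b = 0) : ∃ a, ι.hom.app (op U) a = b := by
  let F := (sheafToPresheaf (Opens.grothendieckTopology X) AddCommGrpCat.{u}) ⋙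
    (evaluation _ _).obj (op U)
  let S : ShortComplex (AbSheaf X) := ShortComplex.mk ι (cokernel.π ι) (cokernel.condition ι)
  have hS : S.Exact := ShortComplex.exact_cokernel ι
  have : Mono S.f := ‹Mono ι›
  have := (hS.map_of_mono_of_preservesKernel F inferInstance inferInstance)
  rw [ShortComplex.ab_exact_iff] at this
  exact this b hb

theorem exists_local_lift (r : (cokernel ι).obj.obj (op ⊤)) (x : X) :
    ∃ (U : Opens X) (_ : x ∈ U) (b : B.obj.obj (op U)),
      (cokernel.π ι).hom.app _ b = sres (cokernel ι) le_top r := by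
  have : Sheaf.IsLocallySurjective (cokernel.π ι) :=
    (Sheaf.isLocallySurjective_iff_epi' _ (cokernel.π ι)).2 inferInstance
  have h := Presheaf.imageSieve_mem (Opens.grothendieckTopology X) (cokernel.π ι).hom (U := op ⊤) r
  obtain ⟨V, f, ⟨b, hb⟩, hx⟩ := h x trivial
  exact ⟨V, hx, b, hb⟩

theorem exists_isConnecting [Mono ι] (r : (cokernel ι).obj.obj (op ⊤)) :
    ∃ c, IsConnecting ι r c := by
  choose U hU b hb using exists_local_lift ι r
  have key : ∀ x y (T : Opens X) (h : T ⟶ U x) (h' : T ⟶ U y),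
      ∃ a, ι.hom.app (op T) a = B.obj.map h'.op (b y) - B.obj.map h.op (b x) := by
    intro x y T h h'
    apply exists_of_π_eq_zero
    have n (z : X) (k : T ⟶ U z) : (cokernel.π ι).hom.app (op T) (B.obj.map k.op (b z)) =
        sres (cokernel ι) le_top r := by
      have := ConcreteCategory.congr_hom ((cokernel.π ι).hom.naturality k.op) (b z)
      rw [ConcreteCategory.comp_apply, ConcreteCategory.comp_apply, hb z] at this
      rw [this]
      simp only [sres, ← ConcreteCategory.comp_apply, ← Functor.map_comp]
      rfl
    rw [map_sub, n, n, sub_self]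
  choose a ha using key
  refine ⟨⟨U, hU, ⟨⟨fun x y T h h' => Multiplicative.ofAdd (a x y T h h'), ?_⟩, ?_⟩⟩, b, hb,
    fun x y T h h' => ha x y T h h'⟩
  · intro x y T T' φ h h'
    apply injective_app ι T
    have := ConcreteCategory.congr_hom (ι.hom.naturality φ.op) (a x y T' h h')
    rw [ConcreteCategory.comp_apply, ConcreteCategory.comp_apply, ha, map_sub] at this
    refine this.trans ((ha x y T (φ ≫ h) (φ ≫ h')).trans ?_).symm
    simp only [op_comp, Functor.map_comp, ConcreteCategory.comp_apply]
  · intro x y z T h h' h''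
    apply injective_app ι T
    refine (map_add (ι.hom.app (op T)).hom (a x y T h h') (a y z T h' h'')).trans ?_
    refine (congrArg₂ (· + ·) (ha x y T h h') (ha y z T h' h'')).trans ?_
    refine Eq.trans ?_ (ha x z T h h'').symm
    abel

theorem IsConnecting.equiv [Mono ι] {r : (cokernel ι).obj.obj (op ⊤)}
    {c c' : Cocycle (A.obj ⋙ abToGrp)} (hc : IsConnecting ι r c) (hc' : IsConnecting ι r c') :
    c ≈ c' := by
  obtain ⟨b, hb, hcb⟩ := hc
  obtain ⟨b', hb', hcb'⟩ := hc'
  have key : ∀ x, ∃ e, ι.hom.app (op (c.cover x ⊓ c'.cover x)) e =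
      sres B inf_le_left (b x) - sres B inf_le_right (b' x) := by
    intro x
    apply exists_of_π_eq_zero
    have n1 := ConcreteCategory.congr_hom ((cokernel.π ι).hom.naturality
      (homOfLE (inf_le_left : c.cover x ⊓ c'.cover x ≤ _)).op) (b x)
    have n2 := ConcreteCategory.congr_hom ((cokernel.π ι).hom.naturality
      (homOfLE (inf_le_right : c.cover x ⊓ c'.cover x ≤ _)).op) (b' x)
    rw [ConcreteCategory.comp_apply, ConcreteCategory.comp_apply, hb x] at n1
    rw [ConcreteCategory.comp_apply, ConcreteCategory.comp_apply, hb' x] at n2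
    rw [map_sub]
    simp only [sres]
    rw [n1, n2]
    simp only [sres, ← ConcreteCategory.comp_apply, ← Functor.map_comp]
    exact sub_self _
  choose e he using key
  refine ⟨fun x => c.cover x ⊓ c'.cover x, fun x => ⟨c.mem_cover x, c'.mem_cover x⟩,
    fun x => inf_le_left, fun x => inf_le_right, fun x => Multiplicative.ofAdd (e x), ?_⟩
  intro x y T h h'
  apply injective_app ι T
  have m (z : X) (k : T ⟶ c.cover z ⊓ c'.cover z) : ι.hom.app (op T) (A.obj.map k.op (e z)) =
      B.obj.map (k ≫ homOfLE inf_le_left).op (b z) -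
        B.obj.map (k ≫ homOfLE inf_le_right).op (b' z) := by
    have := ConcreteCategory.congr_hom (ι.hom.naturality k.op) (e z)
    rw [ConcreteCategory.comp_apply, ConcreteCategory.comp_apply, he, map_sub] at this
    rw [this]
    simp only [sres, op_comp, Functor.map_comp, ConcreteCategory.comp_apply]
  have e1 := hcb x y T (h ≫ homOfLE inf_le_left) (h' ≫ homOfLE inf_le_left)
  have e2 := hcb' x y T (h ≫ homOfLE inf_le_right) (h' ≫ homOfLE inf_le_right)
  refine (map_add (ι.hom.app (op T)).hom (A.obj.map h.op (e x)) _).trans ?_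
  refine Eq.trans ?_ (map_add (ι.hom.app (op T)).hom _ (A.obj.map h'.op (e y))).symm
  refine (congrArg₂ (· + ·) (m x h) e1).trans ?_
  refine Eq.trans ?_ (congrArg₂ (· + ·) e2 (m y h')).symm
  abel

/-- The connecting map `H⁰(X, B / A) → Ȟ¹(X, A)` of a monomorphism `A → B` of sheaves of abelian
groups. -/
def connecting [Mono ι] (r : (cokernel ι).obj.obj (op ⊤)) : AbH1 A :=
  Quotient.mk _ (exists_isConnecting ι r).choose

theorem connecting_eq [Mono ι] {r : (cokernel ι).obj.obj (op ⊤)}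
    {c : Cocycle (A.obj ⋙ abToGrp)} (hc : IsConnecting ι r c) :
    connecting ι r = Quotient.mk _ c :=
  Quotient.sound ((exists_isConnecting ι r).choose_spec.equiv ι hc)

end Cech

/-! ### Quotient sheaves of presheaves of groups -/

/-- A presheaf of subgroups of a presheaf of groups. -/
structure SubPresheaf {X : Type u} [TopologicalSpace X] (P : (Opens X)ᵒᵖ ⥤ GrpCat.{u}) where
  carrier : ∀ U, Subgroup (P.obj U)
  map_mem : ∀ {U V} (f : U ⟶ V) {g}, g ∈ carrier U → P.map f g ∈ carrier V

namespace SubPresheaf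

variable {X : Type u} [TopologicalSpace X] {P : (Opens X)ᵒᵖ ⥤ GrpCat.{u}}

/-- The restriction maps of a presheaf of subgroups. -/
def resHom (A : SubPresheaf P) {U V : (Opens X)ᵒᵖ} (f : U ⟶ V) : A.carrier U →* A.carrier V :=
  ((P.map f).hom.comp (A.carrier U).subtype).codRestrict _ fun g => A.map_mem f g.2

/-- A presheaf of subgroups as a presheaf of groups. -/
def presheaf (A : SubPresheaf P) : (Opens X)ᵒᵖ ⥤ GrpCat.{u} where
  obj U := GrpCat.of (A.carrier U)
  map f := GrpCat.ofHom (A.resHom f)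
  map_id U := by
    ext g
    change P.map (𝟙 U) g.1 = g.1
    simp
  map_comp f g := by
    ext a
    change P.map (f ≫ g) a.1 = P.map g (P.map f a.1)
    simp

/-- The condition that `B` contains the commutators of `A`; if moreover `B ≤ A` then `B` is normal
in `A` and the quotient is abelian. -/
def CommLE (A B : SubPresheaf P) : Prop :=
  ∀ U, ∀ a ∈ A.carrier U, ∀ b ∈ A.carrier U, a * b * a⁻¹ * b⁻¹ ∈ B.carrier U

variable {A B A' B' : SubPresheaf P}

theorem CommLE.normal (h : CommLE A B) (U : (Opens X)ᵒᵖ) :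
    ((B.carrier U).subgroupOf (A.carrier U)).Normal :=
  ⟨fun n hn g => by
    have h1 := h U g.1 g.2 n.1 n.2
    have h2 := (B.carrier U).mul_mem h1 hn
    have e : g.1 * n.1 * g.1⁻¹ * n.1⁻¹ * n.1 = g.1 * n.1 * g.1⁻¹ := by group
    have hn' : n.1 ∈ B.carrier U := hn
    have h3 := (B.carrier U).mul_mem h1 hn'
    rw [e] at h3
    exact h3⟩

/-- The quotient of the sections over `U`, as an abelian group. -/
@[reducible]
def quotCommGroup (h : CommLE A B) (U : (Opens X)ᵒᵖ) :
    CommGroup (A.carrier U ⧸ (B.carrier U).subgroupOf (A.carrier U)) :=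
  have := h.normal U
  { QuotientGroup.Quotient.group ((B.carrier U).subgroupOf (A.carrier U)) with
    mul_comm := by
      intro a b
      induction a using QuotientGroup.induction_on with
      | H a =>
      induction b using QuotientGroup.induction_on with
      | H b =>
      refine QuotientGroup.eq.2 ?_
      have := h U (b.1⁻¹) (inv_mem b.2) (a.1⁻¹) (inv_mem a.2)
      have e : b.1⁻¹ * a.1⁻¹ * b.1⁻¹⁻¹ * a.1⁻¹⁻¹ = (a.1 * b.1)⁻¹ * (b.1 * a.1) := by group
      rw [e] at this
      exact this }

/-- The group `A(U) / B(U)`, written additively. -/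
def quotObj (h : CommLE A B) (U : (Opens X)ᵒᵖ) : AddCommGrpCat.{u} :=
  letI := quotCommGroup h U
  AddCommGrpCat.of (Additive (A.carrier U ⧸ (B.carrier U).subgroupOf (A.carrier U)))

/-- The projection `A(U) → A(U) / B(U)`. -/
def quotMk (h : CommLE A B) (U : (Opens X)ᵒᵖ) (a : A.carrier U) : quotObj h U :=
  Additive.ofMul (QuotientGroup.mk a)

/-- The homomorphism of quotients induced by a homomorphism of groups. -/
def quotMap (h : CommLE A B) (h' : CommLE A' B') {U V : (Opens X)ᵒᵖ} (f : A.carrier U →* A'.carrier V)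
    (hf : ∀ a : A.carrier U, a.1 ∈ B.carrier U → (f a).1 ∈ B'.carrier V) : quotObj h U ⟶ quotObj h' V :=
  have := h.normal U
  have := h'.normal V
  letI := quotCommGroup h U
  letI := quotCommGroup h' V
  AddCommGrpCat.ofHom (MonoidHom.toAdditive
    (QuotientGroup.map ((B.carrier U).subgroupOf (A.carrier U))
      ((B'.carrier V).subgroupOf (A'.carrier V)) f hf))

@[simp]
theorem quotMap_mk (h : CommLE A B) (h' : CommLE A' B') {U V : (Opens X)ᵒᵖ} (f : A.carrier U →* A'.carrier V)
    (hf : ∀ a : A.carrier U, a.1 ∈ B.carrier U → (f a).1 ∈ B'.carrier V) (a : A.carrier U) :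
    quotMap h h' f hf (quotMk h U a) = quotMk h' V (f a) := rfl

theorem quotMk_surjective (h : CommLE A B) (U : (Opens X)ᵒᵖ) : Function.Surjective (quotMk h U) :=
  fun q => QuotientGroup.mk_surjective q

theorem quotMk_mul (h : CommLE A B) (U : (Opens X)ᵒᵖ) (a b : A.carrier U) :
    quotMk h U (a * b) = quotMk h U a + quotMk h U b := rfl

theorem quotMk_eq_iff (h : CommLE A B) (U : (Opens X)ᵒᵖ) (a b : A.carrier U) :
    quotMk h U a = quotMk h U b ↔ a.1⁻¹ * b.1 ∈ B.carrier U := QuotientGroup.eq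

theorem quot_hom_ext (h : CommLE A B) {U} {M : AddCommGrpCat.{u}} {f g : quotObj h U ⟶ M}
    (e : ∀ a, f (quotMk h U a) = g (quotMk h U a)) : f = g := by
  ext q
  obtain ⟨a, rfl⟩ := quotMk_surjective h U q
  exact e a

/-- The presheaf `U ↦ A(U) / B(U)`. -/
def quotPresheaf (h : CommLE A B) : (Opens X)ᵒᵖ ⥤ AddCommGrpCat.{u} where
  obj U := quotObj h U
  map f := quotMap h h (A.resHom f) fun _ ha => B.map_mem f ha
  map_id U := quot_hom_ext h fun a => by
    refine congrArg (quotMk h U) (Subtype.ext ?_)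
    change P.map (𝟙 U) a.1 = a.1
    simp
  map_comp {U V W} f g := quot_hom_ext h fun a => by
    refine congrArg (quotMk h W) (Subtype.ext ?_)
    change P.map (f ≫ g) a.1 = P.map g (P.map f a.1)
    simp

/-- The quotient sheaf `A / B`. -/
def quotSheaf (h : CommLE A B) : Cech.AbSheaf X :=
  (presheafToSheaf _ _).obj (quotPresheaf h)

/-- The class in `(A / B)(U)` of a section of `A`. -/
def toQuotSheaf (h : CommLE A B) (U : Opens X) (a : A.carrier (op U)) :
    (quotSheaf h).obj.obj (op U) :=
  (toSheafify (Opens.grothendieckTopology X) (quotPresheaf h)).app (op U) (quotMk h (op U) a)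

/-- The projection `A → A / B`, as a morphism of presheaves of groups. -/
def projQuotSheaf (h : CommLE A B) : A.presheaf ⟶ (quotSheaf h).obj ⋙ abToGrp where
  app U := GrpCat.ofHom
    { toFun := fun a => Multiplicative.ofAdd (toQuotSheaf h U.unop a)
      map_one' := map_zero
        ((toSheafify (Opens.grothendieckTopology X) (quotPresheaf h)).app U).hom
      map_mul' := fun a b => map_add
        ((toSheafify (Opens.grothendieckTopology X) (quotPresheaf h)).app U).hom (quotMk h U a) (quotMk h U b) }
  naturality U V f := by
    ext a
    exact ConcreteCategory.congr_hom
      ((toSheafify (Opens.grothendieckTopology X) (quotPresheaf h)).naturality f) (quotMk h U a)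

/-- The morphism of quotient presheaves induced by inclusions `A ≤ A'`, `B ≤ B'`. -/
def quotPresheafHom (h : CommLE A B) (h' : CommLE A' B')
    (hA : ∀ U, A.carrier U ≤ A'.carrier U) (hB : ∀ U, B.carrier U ≤ B'.carrier U) :
    quotPresheaf h ⟶ quotPresheaf h' where
  app U := quotMap h h' (Subgroup.inclusion (hA U)) fun _ ha => hB U ha
  naturality _ _ _ := quot_hom_ext h fun _ => rfl

/-- The morphism of quotient sheaves induced by inclusions `A ≤ A'`, `B ≤ B'`. -/
def quotSheafHom (h : CommLE A B) (h' : CommLE A' B')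
    (hA : ∀ U, A.carrier U ≤ A'.carrier U) (hB : ∀ U, B.carrier U ≤ B'.carrier U) :
    quotSheaf h ⟶ quotSheaf h' :=
  (presheafToSheaf _ _).map (quotPresheafHom h h' hA hB)

theorem mono_quotSheafHom (h : CommLE A B) (h' : CommLE A' B')
    (hA : ∀ U, A.carrier U ≤ A'.carrier U) (hB : ∀ U, B.carrier U ≤ B'.carrier U)
    (hAB : ∀ U, A.carrier U ⊓ B'.carrier U ≤ B.carrier U) :
    Mono (quotSheafHom h h' hA hB) := by
  have : ∀ U, Mono ((quotPresheafHom h h' hA hB).app U) := by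
    intro U
    rw [AddCommGrpCat.mono_iff_injective]
    intro p q hpq
    obtain ⟨a, rfl⟩ := quotMk_surjective h U p
    obtain ⟨b, rfl⟩ := quotMk_surjective h U q
    refine (quotMk_eq_iff h U a b).2 (hAB U ⟨(a⁻¹ * b).2, ?_⟩)
    exact (quotMk_eq_iff h' U _ _).1 hpq
  have : Mono (quotPresheafHom h h' hA hB) := NatTrans.mono_of_mono_app _
  exact inferInstanceAs (Mono ((presheafToSheaf _ _).map _))

end SubPresheaf

/-! ### Supergeometries -/

/-- A supergeometry: a complex manifold `Base` with a holomorphic vector bundle `Odd` of finite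
rank, the odd conormal bundle. -/
structure Supergeometry where
  Model : Type u
  [normedAddCommGroup_model : NormedAddCommGroup Model]
  [normedSpace_model : NormedSpace ℂ Model]
  [finiteDimensional_model : FiniteDimensional ℂ Model]
  Fiber : Type u
  [normedAddCommGroup_fiber : NormedAddCommGroup Fiber]
  [normedSpace_fiber : NormedSpace ℂ Fiber]
  [finiteDimensional_fiber : FiniteDimensional ℂ Fiber]
  Base : Type u
  [topologicalSpace : TopologicalSpace Base]
  [t2Space : T2Space Base]
  [secondCountableTopology : SecondCountableTopology Base]
  [chartedSpace : ChartedSpace Model Base]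
  [isManifold : IsManifold 𝓘(ℂ, Model) ω Base]
  Odd : Base → Type u
  [addCommGroup_odd : ∀ x, AddCommGroup (Odd x)]
  [module_odd : ∀ x, Module ℂ (Odd x)]
  [topologicalSpace_odd : ∀ x, TopologicalSpace (Odd x)]
  [topologicalSpace_total : TopologicalSpace (Bundle.TotalSpace Fiber Odd)]
  [fiberBundle : FiberBundle Fiber Odd]
  [vectorBundle : VectorBundle ℂ Fiber Odd]
  [contMDiffVectorBundle : ContMDiffVectorBundle ω Fiber Odd 𝓘(ℂ, Model)]

attribute [instance] Supergeometry.normedAddCommGroup_model Supergeometry.normedSpace_model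
  Supergeometry.finiteDimensional_model Supergeometry.normedAddCommGroup_fiber
  Supergeometry.normedSpace_fiber Supergeometry.finiteDimensional_fiber
  Supergeometry.topologicalSpace Supergeometry.t2Space Supergeometry.secondCountableTopology
  Supergeometry.chartedSpace Supergeometry.isManifold Supergeometry.addCommGroup_odd
  Supergeometry.module_odd Supergeometry.topologicalSpace_odd Supergeometry.topologicalSpace_total
  Supergeometry.fiberBundle Supergeometry.vectorBundle Supergeometry.contMDiffVectorBundle

/-- The projection `ξ^j` of an exterior algebra onto its component of degree `j`. -/
def extProj {M : Type*} [AddCommGroup M] [Module ℂ M] (j : ℕ) :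
    ExteriorAlgebra ℂ M →ₗ[ℂ] ExteriorAlgebra ℂ M :=
  GradedAlgebra.proj (fun i : ℕ => ⋀[ℂ]^i M) j

section extProj

variable {M : Type*} [AddCommGroup M] [Module ℂ M]

theorem extProj_mul (n : ℕ) (a b : ExteriorAlgebra ℂ M) :
    extProj n (a * b) = ∑ p ∈ Finset.HasAntidiagonal.antidiagonal n, extProj p.1 a * extProj p.2 b := by
  simp only [extProj, GradedAlgebra.proj_apply, DirectSum.decompose_mul]
  exact DirectSum.coe_mul_apply_eq_sum_antidiagonal (fun i : ℕ => ⋀[ℂ]^i M) _ _ n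

theorem extProj_of_mem {n : ℕ} {a : ExteriorAlgebra ℂ M} (h : a ∈ ⋀[ℂ]^n M) (j : ℕ) :
    extProj j a = if j = n then a else 0 := by
  simp only [extProj, GradedAlgebra.proj_apply]
  split_ifs with e
  · subst e
    exact DirectSum.decompose_of_mem_same _ h
  · exact DirectSum.decompose_of_mem_ne _ h (Ne.symm e)

theorem algebraMap_mem_degree_zero (c : ℂ) :
    algebraMap ℂ (ExteriorAlgebra ℂ M) c ∈ ⋀[ℂ]^0 M :=
  SetLike.algebraMap_mem_graded (fun i : ℕ => ⋀[ℂ]^i M) c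

theorem ι_mem_degree_one (v : M) : ExteriorAlgebra.ι ℂ v ∈ ⋀[ℂ]^1 M := by
  simpa only [pow_one] using LinearMap.mem_range_self _ v

theorem extProj_mem (j : ℕ) (a : ExteriorAlgebra ℂ M) : extProj j a ∈ ⋀[ℂ]^j M :=
  SetLike.coe_mem _

end extProj

namespace Supergeometry

variable (X : Supergeometry.{u})

/-- `f` is holomorphic on `U`. -/
def IsHolomorphicOn (U : Opens X.Base) (f : X.Base → ℂ) : Prop :=
  ContMDiffOn 𝓘(ℂ, X.Model) 𝓘(ℂ, ℂ) ω f U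

/-- `σ` is a holomorphic section over `U` of the odd conormal bundle. -/
def IsHolomorphicSectionOn (U : Opens X.Base) (σ : ∀ x, X.Odd x) : Prop :=
  ContMDiffOn 𝓘(ℂ, X.Model) (𝓘(ℂ, X.Model).prod 𝓘(ℂ, X.Fiber)) ω
    (fun x => Bundle.TotalSpace.mk' X.Fiber x (σ x)) U

/-- Holomorphic functions and holomorphic sections of the odd conormal bundle over `U`, as fields
of elements of the exterior algebras of the fibres. -/
def generators (U : Opens X.Base) : Set (∀ x : U, ExteriorAlgebra ℂ (X.Odd x)) :=
  {s | ∃ f, X.IsHolomorphicOn U f ∧ ∀ x, s x = algebraMap ℂ _ (f x)} ∪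
    {s | ∃ σ, X.IsHolomorphicSectionOn U σ ∧ ∀ x, s x = ExteriorAlgebra.ι ℂ (σ x)}

/-- Restriction of fields of elements of the exterior algebras. -/
def fieldRes {U V : Opens X.Base} (h : V ≤ U) :
    (∀ x : U, ExteriorAlgebra ℂ (X.Odd x)) →ₐ[ℂ] (∀ x : V, ExteriorAlgebra ℂ (X.Odd x)) where
  toFun s x := s ⟨x, h x.2⟩
  map_one' := rfl
  map_mul' _ _ := rfl
  map_zero' := rfl
  map_add' _ _ := rfl
  commutes' _ := rfl

theorem fieldRes_generators {U V : Opens X.Base} (h : V ≤ U) {s} (hs : s ∈ X.generators U) :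
    X.fieldRes h s ∈ X.generators V := by
  rcases hs with ⟨f, hf, e⟩ | ⟨f, hf, e⟩
  · exact Or.inl ⟨f, hf.mono h, fun x => e _⟩
  · exact Or.inr ⟨f, hf.mono h, fun x => e _⟩

theorem fieldRes_adjoin {U V : Opens X.Base} (h : V ≤ U) {s}
    (hs : s ∈ Algebra.adjoin ℂ (X.generators U)) :
    X.fieldRes h s ∈ Algebra.adjoin ℂ (X.generators V) := by
  have : Algebra.adjoin ℂ (X.generators U) ≤
      (Algebra.adjoin ℂ (X.generators V)).comap (X.fieldRes h) :=
    Algebra.adjoin_le fun t ht => Algebra.subset_adjoin (X.fieldRes_generators h ht)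
  exact this hs

/-- The sections over `U` of the sheaf of exterior algebras `⋀^• T^*_{X,-}`: the fields of elements
of the exterior algebras of the fibres that locally are polynomials in holomorphic functions and
holomorphic sections of the bundle. -/
def sec (U : Opens X.Base) : Subalgebra ℂ (∀ x : U, ExteriorAlgebra ℂ (X.Odd x)) where
  carrier := {s | ∀ x : U, ∃ (V : Opens X.Base) (_ : x.1 ∈ V) (h : V ≤ U),
    X.fieldRes h s ∈ Algebra.adjoin ℂ (X.generators V)}
  mul_mem' := by
    intro a b ha hb x
    obtain ⟨V, hx, h, hV⟩ := ha x
    obtain ⟨V', hx', h', hV'⟩ := hb x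
    refine ⟨V ⊓ V', ⟨hx, hx'⟩, inf_le_left.trans h, ?_⟩
    rw [map_mul]
    exact mul_mem (X.fieldRes_adjoin inf_le_left hV) (X.fieldRes_adjoin inf_le_right hV')
  add_mem' := by
    intro a b ha hb x
    obtain ⟨V, hx, h, hV⟩ := ha x
    obtain ⟨V', hx', h', hV'⟩ := hb x
    refine ⟨V ⊓ V', ⟨hx, hx'⟩, inf_le_left.trans h, ?_⟩
    rw [map_add]
    exact add_mem (X.fieldRes_adjoin inf_le_left hV) (X.fieldRes_adjoin inf_le_right hV')
  algebraMap_mem' c x := ⟨U, x.2, le_rfl, Subalgebra.algebraMap_mem _ c⟩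

variable {X}

/-- Restriction of sections. -/
def res {U V : Opens X.Base} (h : V ≤ U) : X.sec U →ₐ[ℂ] X.sec V :=
  ((X.fieldRes h).comp (X.sec U).val).codRestrict _ fun s x => by
    obtain ⟨W, hx, hW, hs⟩ := s.2 ⟨x, h x.2⟩
    exact ⟨W ⊓ V, ⟨hx, x.2⟩, inf_le_right, X.fieldRes_adjoin inf_le_left hs⟩

@[simp]
theorem res_apply {U V : Opens X.Base} (h : V ≤ U) (s : X.sec U) (x : V) :
    (res h s).1 x = s.1 ⟨x, h x.2⟩ := rfl

/-- `s` is homogeneous of degree `j`. For `j = 0` these are the holomorphic functions, for `j = 1`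
the holomorphic sections of the odd conormal bundle. -/
def IsHomogeneous (j : ℕ) {U : Opens X.Base} (s : X.sec U) : Prop :=
  ∀ x : U, s.1 x ∈ ⋀[ℂ]^j (X.Odd x)

/-- `s` has parity `p` (`p = 0` even, `p = 1` odd). -/
def HasParity (p : Fin 2) {U : Opens X.Base} (s : X.sec U) : Prop :=
  ∀ x, ∀ j : ℕ, j % 2 ≠ p.val → extProj j (s.1 x) = 0

variable (X) in
/-- Sections over `U` of the power `𝒥^k = ⨁_{j ≥ k} ⋀^j T^*_{X,-}` of the fermionic ideal. -/
def ferm (k : ℕ) (U : Opens X.Base) : Submodule ℂ (X.sec U) where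
  carrier := {s | ∀ x, ∀ j < k, extProj j (s.1 x) = 0}
  zero_mem' x j _ := map_zero _
  add_mem' {a b} ha hb x j hj := by
    change extProj j (a.1 x + b.1 x) = 0
    rw [map_add, ha x j hj, hb x j hj, add_zero]
  smul_mem' c a ha x j hj := by
    change extProj j (c • a.1 x) = 0
    rw [map_smul, ha x j hj, smul_zero]

theorem ferm_mul_mem {a b : ℕ} {U : Opens X.Base} {s t : X.sec U} (hs : s ∈ X.ferm a U)
    (ht : t ∈ X.ferm b U) : s * t ∈ X.ferm (a + b) U := by
  intro x j hj
  change extProj j (s.1 x * t.1 x) = 0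
  rw [extProj_mul]
  refine Finset.sum_eq_zero fun p hp => ?_
  have := Finset.HasAntidiagonal.mem_antidiagonal.1 hp
  by_cases h : p.1 < a
  · rw [hs x _ h, zero_mul]
  · rw [ht x p.2 (by omega), mul_zero]

theorem ferm_anti {a b : ℕ} (h : a ≤ b) {U : Opens X.Base} {s : X.sec U} (hs : s ∈ X.ferm b U) :
    s ∈ X.ferm a U := fun x j hj => hs x j (by omega)

theorem res_ferm {k : ℕ} {U V : Opens X.Base} (h : V ≤ U) {s : X.sec U} (hs : s ∈ X.ferm k U) :
    res h s ∈ X.ferm k V := fun x j hj => hs ⟨x, h x.2⟩ j hj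

theorem extProj_adjoin {U : Opens X.Base} {s : ∀ x : U, ExteriorAlgebra ℂ (X.Odd x)}
    (hs : s ∈ Algebra.adjoin ℂ (X.generators U)) (j : ℕ) :
    (fun x => extProj j (s x)) ∈ Algebra.adjoin ℂ (X.generators U) := by
  induction hs using Algebra.adjoin_induction generalizing j with
  | mem s hs =>
    rcases id hs with ⟨f, hf, e⟩ | ⟨f, hf, e⟩
    · have h : (fun x => extProj j (s x)) = if j = 0 then s else 0 := by
        funext x
        rw [e, extProj_of_mem (algebraMap_mem_degree_zero _)]
        split_ifs <;> simp [e]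
      rw [h]
      split_ifs
      · exact Algebra.subset_adjoin hs
      · exact zero_mem _
    · have h : (fun x => extProj j (s x)) = if j = 1 then s else 0 := by
        funext x
        rw [e, extProj_of_mem (ι_mem_degree_one _)]
        split_ifs <;> simp [e]
      rw [h]
      split_ifs
      · exact Algebra.subset_adjoin hs
      · exact zero_mem _
  | algebraMap c =>
    have h : (fun x : U => extProj j (algebraMap ℂ (∀ x : U, ExteriorAlgebra ℂ (X.Odd x)) c x)) =
        if j = 0 then algebraMap ℂ _ c else 0 := by
      funext x
      rw [Pi.algebraMap_apply, extProj_of_mem (algebraMap_mem_degree_zero _)]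
      split_ifs <;> simp
    rw [h]
    split_ifs
    · exact Subalgebra.algebraMap_mem _ c
    · exact zero_mem _
  | add s t _ _ hs ht =>
    have h : (fun x => extProj j ((s + t) x)) =
        (fun x => extProj j (s x)) + fun x => extProj j (t x) := by
      funext x
      exact map_add _ _ _
    rw [h]
    exact add_mem (hs j) (ht j)
  | mul s t _ _ hs ht =>
    have h : (fun x => extProj j ((s * t) x)) =
        ∑ p ∈ Finset.HasAntidiagonal.antidiagonal j,
          (fun x => extProj p.1 (s x)) * fun x => extProj p.2 (t x) := by
      funext x
      rw [Finset.sum_apply]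
      exact extProj_mul _ _ _
    rw [h]
    exact sum_mem fun p _ => mul_mem (hs _) (ht _)

/-- The projection `ξ^j : ⋀^• T^*_{X,-} → ⋀^j T^*_{X,-}` on sections. -/
def proj (j : ℕ) {U : Opens X.Base} (s : X.sec U) : X.sec U :=
  ⟨fun x => extProj j (s.1 x), fun x => by
    obtain ⟨V, hx, h, hs⟩ := s.2 x
    exact ⟨V, hx, h, extProj_adjoin hs j⟩⟩

/-! ### Automorphisms of the sheaf of exterior algebras -/

variable (X) in
/-- An automorphism over `U` of the sheaf of superalgebras `⋀^• T^*_{X,-}`: automorphisms of the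
algebras of sections over all open subsets of `U` that preserve the parity and commute with the
restriction maps. -/
@[ext]
structure SuperAut (U : Opens X.Base) where
  app : ∀ V, V ≤ U → X.sec V ≃ₐ[ℂ] X.sec V
  app_res : ∀ V V' (hV : V ≤ U) (h : V' ≤ V) (s : X.sec V),
    app V' (h.trans hV) (res h s) = res h (app V hV s)
  parity : ∀ V hV p (s : X.sec V), HasParity p (app V hV s) ↔ HasParity p s

namespace SuperAut

instance (U : Opens X.Base) : Group (SuperAut X U) where
  one := ⟨fun _ _ => AlgEquiv.refl, fun _ _ _ _ _ => rfl, fun _ _ _ _ => Iff.rfl⟩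
  mul a b := ⟨fun V hV => (b.app V hV).trans (a.app V hV),
    fun V V' hV h s => by
      change a.app V' _ (b.app V' _ (res h s)) = res h (a.app V hV (b.app V hV s))
      rw [b.app_res V V' hV h, a.app_res V V' hV h],
    fun V hV p s => (a.parity V hV p _).trans (b.parity V hV p s)⟩
  inv a := ⟨fun V hV => (a.app V hV).symm,
    fun V V' hV h s => by
      rw [AlgEquiv.symm_apply_eq, a.app_res V V' hV h, AlgEquiv.apply_symm_apply],
    fun V hV p s => by
      rw [← a.parity V hV p, AlgEquiv.apply_symm_apply]⟩
  mul_assoc _ _ _ := rfl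
  one_mul _ := rfl
  mul_one _ := rfl
  inv_mul_cancel a := by
    ext V hV s
    exact congrArg (fun t : X.sec V => t.1 _) ((a.app V hV).symm_apply_apply s)

@[simp]
theorem one_app {U V : Opens X.Base} (hV : V ≤ U) (s : X.sec V) :
    (1 : SuperAut X U).app V hV s = s := rfl

@[simp]
theorem mul_app {U V : Opens X.Base} (a b : SuperAut X U) (hV : V ≤ U) (s : X.sec V) :
    (a * b).app V hV s = a.app V hV (b.app V hV s) := rfl

@[simp]
theorem inv_app {U V : Opens X.Base} (a : SuperAut X U) (hV : V ≤ U) (s : X.sec V) :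
    (a⁻¹).app V hV s = (a.app V hV).symm s := rfl

/-- Restriction of automorphisms. -/
def restrict {U V : Opens X.Base} (h : V ≤ U) : SuperAut X U →* SuperAut X V where
  toFun a := ⟨fun W hW => a.app W (hW.trans h), fun W W' _ k s => a.app_res W W' _ k s,
    fun W _ p s => a.parity W _ p s⟩
  map_one' := rfl
  map_mul' _ _ := rfl

end SuperAut

variable (X) in
/-- The sheaf of groups `𝒜ut ⋀^• T^*_{X,-}`. -/
def autPresheaf : (Opens X.Base)ᵒᵖ ⥤ GrpCat.{u} where
  obj U := GrpCat.of (SuperAut X U.unop)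
  map f := GrpCat.ofHom (SuperAut.restrict f.unop.le)

variable (X) in
/-- The automorphisms `α` over `U` of the sheaf of superalgebras `⋀^• T^*_{X,-}` with
`α(s) - s ∈ 𝒥^k` for all sections `s`. -/
def greenSubgroup (k : ℕ) (U : Opens X.Base) : Subgroup (SuperAut X U) where
  carrier := {a | ∀ V hV (s : X.sec V), a.app V hV s - s ∈ X.ferm k V}
  one_mem' := fun V hV s => by simp
  mul_mem' := fun {a b} ha hb V hV s => by
    have := add_mem (ha V hV (b.app V hV s)) (hb V hV s)
    rwa [sub_add_sub_cancel] at this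
  inv_mem' := fun {a} ha V hV s => by
    have h := ha V hV ((a.app V hV).symm s)
    rw [AlgEquiv.apply_symm_apply] at h
    have := neg_mem h
    rwa [neg_sub] at this

variable (X) in
/-- Green's sheaf of groups `𝒢^{(k)}_{T^*_{X,-}}`. -/
def green (k : ℕ) : SubPresheaf X.autPresheaf where
  carrier U := X.greenSubgroup k U.unop
  map_mem {_ _} f a (ha : a ∈ X.greenSubgroup k _) := fun V hV s =>
    ha V (hV.trans f.unop.le) s

theorem green_anti {k l : ℕ} (h : k ≤ l) {U : Opens X.Base} :
    X.greenSubgroup l U ≤ X.greenSubgroup k U :=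
  fun _ ha V hV s => ferm_anti h (ha V hV s)

/-- The part of an element of the local polynomial algebra that an automorphism in `𝒢^{(2)}` moves
lies in higher degree. -/
theorem green_adjoin {U V : Opens X.Base} (hV : V ≤ U) {a : SuperAut X U}
    (ha : a ∈ X.greenSubgroup 2 U) {s : ∀ x : V, ExteriorAlgebra ℂ (X.Odd x)}
    (hs : s ∈ Algebra.adjoin ℂ (X.generators V)) :
    ∃ (N : ℕ) (u : ℕ → X.sec V), (∀ j x, (u j).1 x = extProj j (s x)) ∧
      (∀ j, a.app V hV (u j) - u j ∈ X.ferm (j + 1) V) ∧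
      s = ∑ j ∈ Finset.range N, (u j).1 := by
  have hsec : ∀ {t : ∀ x : V, ExteriorAlgebra ℂ (X.Odd x)},
      t ∈ Algebra.adjoin ℂ (X.generators V) → t ∈ X.sec V :=
    fun {t} ht x => ⟨V, x.2, le_rfl, ht⟩
  have hom : ∀ {t : ∀ x : V, ExteriorAlgebra ℂ (X.Odd x)} (ht : t ∈ X.sec V) (n : ℕ),
      n < 2 → (∀ x : V, t x ∈ ⋀[ℂ]^n (X.Odd x)) →
      ∃ (N : ℕ) (u : ℕ → X.sec V), (∀ j x, (u j).1 x = extProj j (t x)) ∧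
      (∀ j, a.app V hV (u j) - u j ∈ X.ferm (j + 1) V) ∧
      t = ∑ j ∈ Finset.range N, (u j).1 := by
    intro t ht n hn h
    refine ⟨n + 1, fun j => if j = n then ⟨t, ht⟩ else 0, fun j x => ?_, fun j => ?_, ?_⟩
    · rw [extProj_of_mem (h x)]
      dsimp only
      split_ifs <;> rfl
    · dsimp only
      split_ifs with e
      · exact ferm_anti (by omega) (ha V hV _)
      · rw [map_zero, sub_zero]
        exact zero_mem _
    · rw [Finset.sum_eq_single n]
      · simp
      · intro b _ hb
        simp [hb]
      · simp
  have fermu : ∀ {t : ∀ x : V, ExteriorAlgebra ℂ (X.Odd x)} {u : ℕ → X.sec V},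
      (∀ j x, (u j).1 x = extProj j (t x)) → ∀ j, u j ∈ X.ferm j V := by
    intro t u hu j x i hi
    rw [hu, extProj_of_mem (extProj_mem j (t x)), if_neg (by omega)]
  induction hs using Algebra.adjoin_induction with
  | mem s hs =>
    have hm := hsec (Algebra.subset_adjoin hs)
    rcases hs with ⟨f, hf, e⟩ | ⟨f, hf, e⟩
    · exact hom hm 0 (by omega) fun x => e x ▸ algebraMap_mem_degree_zero _
    · exact hom hm 1 (by omega) fun x => e x ▸ ι_mem_degree_one _
  | algebraMap c =>
    exact hom (hsec (Subalgebra.algebraMap_mem _ c)) 0 (by omega)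
      fun x => algebraMap_mem_degree_zero _
  | add s t _ _ hs ht =>
    obtain ⟨N, u, hu, hu', hu''⟩ := hs
    obtain ⟨M, v, hv, hv', hv''⟩ := ht
    have hz : ∀ {t : ∀ x : V, ExteriorAlgebra ℂ (X.Odd x)} {u : ℕ → X.sec V} {N : ℕ},
        (∀ j x, (u j).1 x = extProj j (t x)) → t = ∑ j ∈ Finset.range N, (u j).1 →
        ∀ K, N ≤ K → t = ∑ j ∈ Finset.range K, (u j).1 := by
      intro t u N hu ht K hK
      rw [ht]
      refine Finset.sum_subset (Finset.range_mono hK) fun j _ hj => ?_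
      funext x
      rw [hu, ht, Finset.sum_apply, map_sum]
      refine Finset.sum_eq_zero fun i hi => ?_
      rw [hu, extProj_of_mem (extProj_mem i _), if_neg]
      rintro rfl
      exact hj hi
    refine ⟨max N M, fun j => u j + v j, fun j x => ?_, fun j => ?_, ?_⟩
    · change (u j).1 x + (v j).1 x = _
      rw [hu, hv]
      exact (map_add _ _ _).symm
    · rw [map_add, add_sub_add_comm]
      exact add_mem (hu' j) (hv' j)
    · conv_lhs => rw [hz hu hu'' _ (le_max_left N M), hz hv hv'' _ (le_max_right N M)]
      rw [← Finset.sum_add_distrib]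
      rfl
  | mul s t hs0 ht0 hs ht =>
    obtain ⟨N, u, hu, hu', hu''⟩ := hs
    obtain ⟨M, v, hv, hv', hv''⟩ := ht
    let w : ℕ → X.sec V := fun j =>
      ∑ p ∈ Finset.HasAntidiagonal.antidiagonal j, u p.1 * v p.2
    have hw : ∀ j x, (w j).1 x = extProj j ((s * t) x) := by
      intro j x
      change ((X.sec V).val (w j)) x = extProj j (s x * t x)
      rw [extProj_mul, map_sum, Finset.sum_apply]
      refine Finset.sum_congr rfl fun p _ => ?_
      change (u p.1).1 x * (v p.2).1 x = _
      rw [hu, hv]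
    refine ⟨N + M, w, hw, fun j => ?_, ?_⟩
    · rw [map_sum, ← Finset.sum_sub_distrib]
      refine sum_mem fun p hp => ?_
      have hp := Finset.HasAntidiagonal.mem_antidiagonal.1 hp
      have e : a.app V hV (u p.1 * v p.2) - u p.1 * v p.2 =
          (a.app V hV (u p.1) - u p.1) * (a.app V hV (v p.2)) +
            u p.1 * (a.app V hV (v p.2) - v p.2) := by
        rw [map_mul, sub_mul, mul_sub, sub_add_sub_cancel]
      have hv2 : a.app V hV (v p.2) ∈ X.ferm p.2 V := by
        have := add_mem (ferm_anti (Nat.le_succ _) (hv' p.2)) (fermu hv p.2)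
        rwa [sub_add_cancel] at this
      rw [e]
      refine add_mem ?_ ?_
      · exact ferm_anti (by omega) (ferm_mul_mem (hu' p.1) hv2)
      · exact ferm_anti (by omega) (ferm_mul_mem (fermu hu p.1) (hv' p.2))
    · funext x
      have hx : ∀ i, i ≥ N → (u i).1 x = 0 := by
        intro i hi
        rw [hu, hu'', Finset.sum_apply, map_sum]
        refine Finset.sum_eq_zero fun l hl => ?_
        have := Finset.mem_range.1 hl
        rw [hu, extProj_of_mem (extProj_mem l _), if_neg (by omega)]
      have hy : ∀ i, i ≥ M → (v i).1 x = 0 := by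
        intro i hi
        rw [hv, hv'', Finset.sum_apply, map_sum]
        refine Finset.sum_eq_zero fun l hl => ?_
        have := Finset.mem_range.1 hl
        rw [hv, extProj_of_mem (extProj_mem l _), if_neg (by omega)]
      classical
      have e := DirectSum.sum_support_decompose (fun i : ℕ => ⋀[ℂ]^i (X.Odd x)) ((s * t) x)
      rw [Finset.sum_apply, ← e]
      refine Finset.sum_subset_zero_on_sdiff ?_ ?_ ?_
      · intro j hj
        by_contra hj'
        have hj' : N + M ≤ j := by simpa using hj'
        refine DFinsupp.mem_support_iff.1 hj (Subtype.ext ?_)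
        change extProj j ((s * t) x) = 0
        rw [← hw]
        change ((X.sec V).val (w j)) x = 0
        rw [map_sum, Finset.sum_apply]
        refine Finset.sum_eq_zero fun p hp => ?_
        have hp := Finset.HasAntidiagonal.mem_antidiagonal.1 hp
        change (u p.1).1 x * (v p.2).1 x = 0
        by_cases h : N ≤ p.1
        · rw [hx _ h, zero_mul]
        · rw [hy _ (by omega), mul_zero]
      · intro j hj
        have hj := (Finset.mem_sdiff.1 hj).2
        rw [hw]
        by_contra h
        refine hj (DFinsupp.mem_support_iff.2 fun h0 => h ?_)
        change ((DirectSum.decompose (fun i : ℕ => ⋀[ℂ]^i (X.Odd x)) ((s * t) x)) j :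
          ExteriorAlgebra ℂ (X.Odd x)) = 0
        rw [h0]
        rfl
      · intro j _
        exact (hw j x).symm

theorem green_ferm {m : ℕ} {U V : Opens X.Base} (hV : V ≤ U) {a : SuperAut X U}
    (ha : a ∈ X.greenSubgroup 2 U) {s : X.sec V} (hs : s ∈ X.ferm m V) :
    a.app V hV s - s ∈ X.ferm (m + 1) V := by
  intro x
  obtain ⟨W, hx, hW, h⟩ := s.2 x
  obtain ⟨N, u, hu, hu', hu''⟩ := green_adjoin (hW.trans hV) ha h
  have e : res hW s = ∑ j ∈ Finset.range N, u j := by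
    apply Subtype.ext
    change X.fieldRes hW s.1 = (X.sec W).val _
    rw [map_sum]
    exact hu''
  have hz : ∀ j < m, u j = 0 := fun j hj => by
    apply Subtype.ext
    funext y
    rw [hu]
    exact hs ⟨y, hW y.2⟩ j hj
  have key : res hW (a.app V hV s - s) ∈ X.ferm (m + 1) W := by
    rw [map_sub, ← a.app_res V W hV hW, e, map_sum, ← Finset.sum_sub_distrib]
    refine sum_mem fun j _ => ?_
    by_cases hj : j < m
    · rw [hz j hj, map_zero, sub_zero]
      exact zero_mem _
    · exact ferm_anti (by omega) (hu' j)
  exact key ⟨x, hx⟩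

/-- The commutators of `𝒢^{(k)}` lie in `𝒢^{(k+1)}` for `k ≥ 2`; so `𝒢^{(k+1)}` is normal in
`𝒢^{(k)}` with abelian quotient. -/
theorem green_commLE {k : ℕ} (hk : 2 ≤ k) : SubPresheaf.CommLE (X.green k) (X.green (k + 1)) := by
  intro U a ha b hb V hV s
  change SuperAut X U.unop at a b
  change a ∈ X.greenSubgroup k U.unop at ha
  change b ∈ X.greenSubgroup k U.unop at hb
  change (a * b * a⁻¹ * b⁻¹).app V hV s - s ∈ _
  obtain ⟨t, rfl⟩ : ∃ t, (b * a).app V hV t = s := ⟨_, ((b * a).app V hV).apply_symm_apply s⟩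
  have e1 : (a * b * a⁻¹ * b⁻¹).app V hV ((b * a).app V hV t) =
      a.app V hV (b.app V hV t) := by
    change ((a * b * a⁻¹ * b⁻¹) * (b * a)).app V hV t = (a * b).app V hV t
    congr 2
    group
  rw [e1, SuperAut.mul_app]
  have h1 := green_ferm hV (green_anti hk ha) (hb V hV t)
  have h2 := green_ferm hV (green_anti hk hb) (ha V hV t)
  have := sub_mem h1 h2
  simp only [map_sub] at this
  convert this using 1
  abel

/-! ### Embeddings of supergeometries -/

/-- An embedding of supergeometries: a holomorphic embedding of `Y` onto a closed submanifold of
`X`, with a surjection `T^*_{X,-} → i_* T^*_{Y,-}`, given fibrewise by surjections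
`T^*_{X,-}|_{i(y)} → T^*_{Y,-}|_y` that take holomorphic sections to holomorphic sections. -/
structure Embedding (Y X : Supergeometry.{u}) where
  toFun : Y.Base → X.Base
  isSmoothEmbedding : Manifold.IsSmoothEmbedding 𝓘(ℂ, Y.Model) 𝓘(ℂ, X.Model) ω toFun
  isClosed_range : IsClosed (Set.range toFun)
  odd : ∀ y, X.Odd (toFun y) →ₗ[ℂ] Y.Odd y
  odd_surjective : ∀ y, Function.Surjective (odd y)
  odd_holomorphic : ∀ (U : Opens X.Base) (σ : ∀ x, X.Odd x), X.IsHolomorphicSectionOn U σ →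
    Y.IsHolomorphicSectionOn (U.comap ⟨toFun, isSmoothEmbedding.isEmbedding.continuous⟩)
      fun y => odd y (σ (toFun y))

namespace Embedding

variable {Y X : Supergeometry.{u}} (f : Embedding Y X)

/-- The embedding is even if the surjection `i^* T^*_{X,-} → T^*_{Y,-}` is an isomorphism. -/
def IsEven : Prop := ∀ y, Function.Bijective (f.odd y)

/-- The intersection with `Y` of an open subset of `X`. -/
def preim (U : Opens X.Base) : Opens Y.Base :=
  U.comap ⟨f.toFun, f.isSmoothEmbedding.isEmbedding.continuous⟩

theorem preim_mono {U V : Opens X.Base} (h : V ≤ U) : f.preim V ≤ f.preim U := fun _ hy => h hy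

/-- The pullback to `Y` of a section of the sheaf of exterior algebras, at the point `y`. -/
def pull {U : Opens X.Base} (y : f.preim U) :
    X.sec U →ₐ[ℂ] ExteriorAlgebra ℂ (Y.Odd y) :=
  (ExteriorAlgebra.map (f.odd y)).comp
    ((Pi.evalAlgHom ℂ (fun x : U => ExteriorAlgebra ℂ (X.Odd x)) ⟨f.toFun y, y.2⟩).comp
      (X.sec U).val)

/-- The ideal sheaf `ℐ_{T^*_{Y,-}; T^*_{X,-}}`, the kernel of
`⋀^• T^*_{X,-} → i_* ⋀^• T^*_{Y,-}`, which defines the embedding of split models. -/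
def splitIdeal (U : Opens X.Base) : Ideal (X.sec U) where
  carrier := {s | ∀ y : f.preim U, f.pull y s = 0}
  zero_mem' _ := map_zero _
  add_mem' ha hb y := by rw [map_add, ha y, hb y, add_zero]
  smul_mem' c s hs y := by rw [smul_eq_mul, map_mul, hs y, mul_zero]

theorem res_splitIdeal {U V : Opens X.Base} (h : V ≤ U) {s : X.sec U} (hs : s ∈ f.splitIdeal U) :
    res h s ∈ f.splitIdeal V := fun y => hs ⟨y, h y.2⟩

/-- The automorphisms over `U` that preserve `ℐ_{T^*_{Y,-}; T^*_{X,-}}`. -/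
def autSubgroup (U : Opens X.Base) : Subgroup (SuperAut X U) where
  carrier := {a | ∀ V hV (s : X.sec V), a.app V hV s ∈ f.splitIdeal V ↔ s ∈ f.splitIdeal V}
  one_mem' _ _ _ := Iff.rfl
  mul_mem' ha hb V hV s := (ha V hV _).trans (hb V hV s)
  inv_mem' {a} ha V hV s := by
    rw [← ha V hV, SuperAut.inv_app, AlgEquiv.apply_symm_apply]

/-- The sheaf of groups `𝒢^{(k)}_{T^*_{Y,-}; T^*_{X,-}}`, the intersection of `𝒢^{(k)}_{T^*_{X,-}}`
with the automorphisms preserving `ℐ_{T^*_{Y,-}; T^*_{X,-}}`. -/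
def green (k : ℕ) : SubPresheaf X.autPresheaf where
  carrier U := X.greenSubgroup k U.unop ⊓ f.autSubgroup U.unop
  map_mem {_ _} g a (ha : a ∈ X.greenSubgroup k _ ⊓ f.autSubgroup _) :=
    ⟨fun V hV s => ha.1 V (hV.trans g.unop.le) s, fun V hV s => ha.2 V (hV.trans g.unop.le) s⟩

theorem green_commLE {k : ℕ} (hk : 2 ≤ k) : SubPresheaf.CommLE (f.green k) (f.green (k + 1)) :=
  fun U a ha b hb => ⟨Supergeometry.green_commLE hk U a ha.1 b hb.1,
    let G := f.autSubgroup U.unop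
    G.mul_mem (G.mul_mem (G.mul_mem ha.2 hb.2) (G.inv_mem ha.2)) (G.inv_mem hb.2)⟩

/-- The obstruction sheaf `𝒬^{(k)}_{T^*_{Y,-}; T^*_{X,-}}` of the embedding. -/
def obstructionSheaf {k : ℕ} (hk : 2 ≤ k) : Cech.AbSheaf X.Base :=
  SubPresheaf.quotSheaf (f.green_commLE hk)

/-- The inclusion `𝒬^{(k)}_{T^*_{Y,-}; T^*_{X,-}} → 𝒬^{(k)}_{T^*_{X,-}} =
𝒢^{(k)}_{T^*_{X,-}} / 𝒢^{(k+1)}_{T^*_{X,-}}`. -/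
def obstructionIncl {k : ℕ} (hk : 2 ≤ k) :
    f.obstructionSheaf hk ⟶ SubPresheaf.quotSheaf (Supergeometry.green_commLE (X := X) hk) :=
  SubPresheaf.quotSheafHom (f.green_commLE hk) (Supergeometry.green_commLE hk)
    (fun _ => inf_le_left) (fun _ => inf_le_left)

instance {k : ℕ} (hk : 2 ≤ k) : Mono (f.obstructionIncl hk) :=
  SubPresheaf.mono_quotSheafHom _ _ _ _ fun _ _ ha => ⟨ha.2, ha.1.2⟩

/-- The sheaf `ℛ^{(k)} = 𝒬^{(k)}_{T^*_{X,-}} / 𝒬^{(k)}_{T^*_{Y,-}; T^*_{X,-}}`. -/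
def normalSheaf {k : ℕ} (hk : 2 ≤ k) : Cech.AbSheaf X.Base := cokernel (f.obstructionIncl hk)

/-- The section of `ℛ^{(k)}` represented by an automorphism in `𝒢^{(k)}_{T^*_{X,-}}(U)`. -/
def toNormalSheaf {k : ℕ} (hk : 2 ≤ k) (U : Opens X.Base) (a : X.greenSubgroup k U) :
    (f.normalSheaf hk).obj.obj (op U) :=
  (cokernel.π (f.obstructionIncl hk)).hom.app (op U)
    (SubPresheaf.toQuotSheaf (Supergeometry.green_commLE hk) U a)

/-- The primary obstruction `ω : Ȟ¹(X, 𝒢^{(k)}_{T^*_{Y,-}; T^*_{X,-}}) →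
H¹(X, 𝒬^{(k)}_{T^*_{Y,-}; T^*_{X,-}})` of `(k-1)`-split embeddings. -/
def primaryObstruction {k : ℕ} (hk : 2 ≤ k) :
    Cech.H1 (f.green k).presheaf → Cech.AbH1 (f.obstructionSheaf hk) :=
  Cech.H1.map (SubPresheaf.projQuotSheaf (f.green_commLE hk))

/-! ### Ideal sheaves and their generators -/

/-- The sheaf `N^*_{Y/X,±}`: the ideal `ℐ_Y` of holomorphic functions vanishing on `Y` for `p = 0`,
the kernel `K` of `T^*_{X,-} → i_* T^*_{Y,-}` for `p = 1`. -/
def conormal (p : Fin 2) (U : Opens X.Base) : Submodule ℂ (X.sec U) where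
  carrier := {s | IsHomogeneous p.val s ∧ s ∈ f.splitIdeal U}
  zero_mem' := ⟨fun _ => Submodule.zero_mem _, Ideal.zero_mem _⟩
  add_mem' ha hb := ⟨fun x => Submodule.add_mem _ (ha.1 x) (hb.1 x), Ideal.add_mem _ ha.2 hb.2⟩
  smul_mem' c s hs := ⟨fun x => Submodule.smul_mem _ c (hs.1 x), fun y => by
    rw [map_smul, hs.2 y, smul_zero]⟩

/-- The restriction maps of `N^*_{Y/X,±}`. -/
def conormalRes (p : Fin 2) {U V : Opens X.Base} (h : V ≤ U) (n : f.conormal p U) :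
    f.conormal p V :=
  ⟨res h n.1, fun x => n.2.1 ⟨x, h x.2⟩, f.res_splitIdeal h n.2.2⟩

/-- Multiplication of sections of `N^*_{Y/X,±}` by holomorphic functions. -/
def conormalMul (p : Fin 2) {U : Opens X.Base} (a : X.sec U) (ha : IsHomogeneous 0 a)
    (n : f.conormal p U) : f.conormal p U :=
  ⟨a * n.1, fun x => by
    have := SetLike.mul_mem_graded (A := fun i : ℕ => ⋀[ℂ]^i (X.Odd x)) (ha x) (n.2.1 x)
    rwa [zero_add] at this, Ideal.mul_mem_left _ a n.2.2⟩

/-- A morphism of sheaves of `𝒪_X`-modules `N^*_{Y/X,±} → ⋀^• T^*_{X,-}`. -/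
structure ConormalHom (p : Fin 2) where
  app : ∀ V, f.conormal p V →+ X.sec V
  app_res : ∀ {U V : Opens X.Base} (h : V ≤ U) (n : f.conormal p U),
    app V (f.conormalRes p h n) = res h (app U n)
  app_mul : ∀ {V : Opens X.Base} (a : X.sec V) (ha : IsHomogeneous 0 a) (n : f.conormal p V),
    app V (f.conormalMul p a ha n) = a * app V n

/-- `ξ^m(F) = 0`. -/
def ConormalHom.ProjEqZero {f : Embedding Y X} {p : Fin 2} (F : f.ConormalHom p) (m : ℕ) : Prop :=
  ∀ V n, proj m (F.app V n) = 0

/-- The maximal splitting degree `m_F` of `F : N^*_{Y/X,±} → ⋀^• T^*_{X,-}`: the largest `m` such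
that `ξ^{m'}(F) = 0` for all `2 ≤ m' < m`. It is the degree of the first non-zero component of `F`
in degrees at least two, and `∞` if there is none. -/
def ConormalHom.maxSplittingDegree {f : Embedding Y X} {p : Fin 2} (F : f.ConormalHom p) : ℕ∞ :=
  sSup {m : ℕ∞ | ∀ m' : ℕ, 2 ≤ m' → (m' : ℕ∞) < m → F.ProjEqZero m'}

/-- An ideal sheaf for an embedding of supermanifolds over `f`, in the split model of `X`. (Left
ideals of a supercommutative algebra that are `ℤ₂`-graded are two-sided.) -/
structure IdealSheaf where
  ideal : ∀ U, Ideal (X.sec U)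
  res_mem : ∀ {U V : Opens X.Base} (h : V ≤ U) {s : X.sec U}, s ∈ ideal U → res h s ∈ ideal V
  local_mem : ∀ {U : Opens X.Base} (s : X.sec U),
    (∀ x ∈ U, ∃ (V : Opens X.Base) (_ : x ∈ V) (h : V ≤ U), res h s ∈ ideal V) → s ∈ ideal U
  /-- The ideal sheaf is `ℤ₂`-graded. -/
  graded : ∀ {U : Opens X.Base} {s : X.sec U}, s ∈ ideal U →
    ∃ s₀ ∈ ideal U, ∃ s₁ ∈ ideal U, HasParity 0 s₀ ∧ HasParity 1 s₁ ∧ s = s₀ + s₁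
  /-- Modulo `𝒥²`, its even and odd parts are contained in `ℐ_Y` and in `K`. -/
  reduction_mem : ∀ {U : Opens X.Base} (p : Fin 2) {s : X.sec U}, s ∈ ideal U → HasParity p s →
    proj p.val s ∈ f.conormal p U
  /-- Modulo `𝒥²`, its even and odd parts contain `ℐ_Y` and `K`. -/
  reduction_surj : ∀ {U : Opens X.Base} (p : Fin 2), ∀ n ∈ f.conormal p U, ∀ x ∈ U,
    ∃ (V : Opens X.Base) (_ : x ∈ V) (h : V ≤ U), ∃ s ∈ ideal V,
      HasParity p s ∧ s - res h n ∈ X.ferm 2 V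
  /-- The quotient of `⋀^• T^*_{X,-}` by the ideal sheaf is locally isomorphic to
  `i_* ⋀^• T^*_{Y,-}` as a sheaf of superalgebras: over a neighbourhood of every point, the ideal
  sheaf is the kernel of an epimorphism of sheaves onto the latter. -/
  locally_iso : ∀ x : X.Base, ∃ (U : Opens X.Base) (_ : x ∈ U)
    (ψ : ∀ V, V ≤ U → X.sec V →ₐ[ℂ] Y.sec (f.preim V)),
    (∀ V V' (hV : V ≤ U) (h : V' ≤ V) (s : X.sec V),
      ψ V' (h.trans hV) (res h s) = res (f.preim_mono h) (ψ V hV s)) ∧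
    (∀ V hV p (s : X.sec V), HasParity p s → HasParity p (ψ V hV s)) ∧
    (∀ V hV (s : X.sec V), ψ V hV s = 0 ↔ s ∈ ideal V) ∧
    (∀ V (hV : V ≤ U) (t : Y.sec (f.preim V)), ∀ x' ∈ V,
      ∃ (V' : Opens X.Base) (_ : x' ∈ V') (h : V' ≤ V) (s : X.sec V'),
        ψ V' (h.trans hV) s = res (f.preim_mono h) t)

/-- A system of generators of an ideal sheaf for an embedding: morphisms of `𝒪_X`-modules
`F^± : N^*_{Y/X,±} → ℐ^±` that are the identity modulo `𝒥²` and whose images generate `ℐ`. -/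
structure Generators (I : f.IdealSheaf) where
  hom : ∀ p, f.ConormalHom p
  mem : ∀ p V n, (hom p).app V n ∈ I.ideal V
  parity : ∀ p V n, HasParity p ((hom p).app V n)
  sub_mem : ∀ p V n, (hom p).app V n - n.1 ∈ X.ferm 2 V
  generate : ∀ {U : Opens X.Base} {s : X.sec U}, s ∈ I.ideal U → ∀ x ∈ U,
    ∃ (V : Opens X.Base) (_ : x ∈ V) (h : V ≤ U),
      res h s ∈ Ideal.span {t | ∃ p n, t = (hom p).app V n}

/-- The maximal splitting degree `m_F = min {m_{F^+}, m_{F^-}}` of a system of generators. -/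
def Generators.maxSplittingDegree {f : Embedding Y X} {I : f.IdealSheaf} (F : f.Generators I) :
    ℕ∞ :=
  min (F.hom 0).maxSplittingDegree (F.hom 1).maxSplittingDegree

/-- The set `𝒮^{≥ k}` of the pairs `(ℐ, F)` of an ideal sheaf for an embedding over `f` and a
system of generators with `m_F ≥ k`. -/
structure GeneratedIdeal (k : ℕ) where
  ideal : f.IdealSheaf
  gens : f.Generators ideal
  le_maxSplittingDegree : k ≤ gens.maxSplittingDegree

/-- The parity of `k`, for the index `(±)^k`. -/
def par (k : ℕ) : Fin 2 := Fin.ofNat 2 k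

/-- The group `Hom_{𝒪_X}(N^*_{Y/X,(±)^k}, ⋀^k T^*_{X,-})`. -/
def LeadingHom (k : ℕ) : Type u :=
  {h : f.ConormalHom (par k) // ∀ V n, IsHomogeneous k (h.app V n)}

/-- The component `ξ^k(F^{(±)^k})` of a system of generators. -/
def GeneratedIdeal.leading {f : Embedding Y X} {k : ℕ} (S : f.GeneratedIdeal k) :
    f.LeadingHom k :=
  ⟨{ app := fun V =>
      { toFun := fun n => proj k ((S.gens.hom (par k)).app V n)
        map_zero' := by
          rw [map_zero]
          exact Subtype.ext (funext fun x => map_zero _)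
        map_add' := fun a b => by
          rw [map_add]
          exact Subtype.ext (funext fun x => map_add _ _ _) }
     app_res := fun h n => by
      change proj k ((S.gens.hom (par k)).app _ _) = res h (proj k _)
      rw [(S.gens.hom (par k)).app_res]
      rfl
     app_mul := fun {V} a ha n => by
      change proj k ((S.gens.hom (par k)).app _ _) = a * proj k _
      rw [(S.gens.hom (par k)).app_mul]
      refine Subtype.ext (funext fun x => ?_)
      have := DirectSum.coe_decompose_mul_add_of_left_mem (fun i : ℕ => ⋀[ℂ]^i (X.Odd x))
        (j := k) (b := ((S.gens.hom (par k)).app V n).1 x) (ha x)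
      rw [zero_add] at this
      exact this },
    fun V n x => extProj_mem k _⟩

/-- The global section `r` of `ℛ^{(k)}` is induced by `h : N^*_{Y/X,(±)^k} → ⋀^k T^*_{X,-}`:
locally, `r` is represented by an automorphism `α` in `𝒢^{(k)}_{T^*_{X,-}}` such that `ξ^k ∘ α` and
`h` have the same restriction to `Y` on all sections of `N^*_{Y/X,(±)^k}`. For even `k`, say, this
means that the derivation `ξ^k ∘ α : 𝒪_X → ⋀^k T^*_{X,-}` and `h` induce the same homomorphism
`ℐ_Y / ℐ_Y² → ⋀^k T^*_{X,-}|_Y` on the conormal bundle. -/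
def Induces {k : ℕ} (hk : 2 ≤ k) (h : f.LeadingHom k) (r : (f.normalSheaf hk).obj.obj (op ⊤)) :
    Prop :=
  ∀ x : X.Base, ∃ (U : Opens X.Base) (_ : x ∈ U) (a : X.greenSubgroup k U),
    Cech.sres (f.normalSheaf hk) le_top r = f.toNormalSheaf hk U a ∧
    ∀ V (hV : V ≤ U) (n : f.conormal (par k) V),
      proj k (a.1.app V hV n.1) - h.1.app V n ∈ f.splitIdeal V

/-- The class `z` in `Ȟ¹(X, 𝒢^{(k)}_{T^*_{Y,-}; T^*_{X,-}})` is the `(k-1)`-split embedding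
associated to `(ℐ, F)`: it is the class of the cocycle `α_x α_y⁻¹` for local automorphisms
`α_x` in `𝒢^{(k)}_{T^*_{X,-}}` that take the ideal sheaf generated by `F` to
`ℐ_{T^*_{Y,-}; T^*_{X,-}}`. -/
def IsAssociated {k : ℕ} (S : f.GeneratedIdeal k) (z : Cech.H1 (f.green k).presheaf) : Prop :=
  ∃ (c : Cech.Cocycle (f.green k).presheaf)
    (a : ∀ x, X.greenSubgroup k (c.cover x)),
    (∀ x V (hV : V ≤ c.cover x) (s : X.sec V),
      (a x).1.app V hV s ∈ f.splitIdeal V ↔ s ∈ S.ideal.ideal V) ∧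
    (∀ x y (T : Opens X.Base) (h : T ⟶ c.cover x) (h' : T ⟶ c.cover y),
      (c.cocycle.ev x y h h').1 =
        SuperAut.restrict h.le (a x).1 * (SuperAut.restrict h'.le (a y).1)⁻¹) ∧
    z = Quotient.mk _ c

end Embedding

end Supergeometry

end

/-!
The normal sheaf `ℛ^{(k)}` measures what automorphisms in `𝒢^{(k)}` do in degree `k` to the
functions vanishing on `Y`. The proof makes this precise locally and then glues.

For an automorphism `α ∈ 𝒢^{(k)}`, parity forces `α - 1` to raise degrees by the even number
`e = k` or `e = k - 1`, and the components of `α` that raise degrees by exactly `e` form a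
derivation (`SuperAut.lead`) whose exponential agrees with `α` modulo `𝒢^{(k+1)}`
(`exp_lead_inv_mul_mem`). This derivation preserves the ideal `ℐ₀` of the split embedding as soon
as it takes functions vanishing on `Y` to sections vanishing on `Y`: expand sections in a local
frame of the odd conormal bundle. Then `α` represents zero in `ℛ^{(k)}` (`toNormalSheaf_eq_zero`).
For odd `k` the condition is void, because the leading derivation is zero on functions, and so
`ℛ^{(k)} = 0`. For even `k`, the section of `ℛ^{(k)}` represented by `α` is determined by the
leading component of `α` along `Y` (`HasLeading.toNormalSheaf_eq`). So a homomorphism `h` induces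
at most one section, and it induces one once there are local automorphisms with leading component
`h` (`exists_induces`). For even `k` these are the exponentials of the vector fields `∑ h(y_i)
∂_i`, where the `y_i` are coordinates that vanish on `Y` (`exists_hasLeading`); Hadamard's lemma
says that the `y_i` generate `ℐ₀`.

Generators `F` of an ideal sheaf `ℐ` with splitting degree at least `k` move the coordinates `y_i`
by terms in `𝒥^k`. A product of exponentials of vector fields normal to `Y` is an automorphism
`β ∈ 𝒢^{(k)}` with `β(y_i) = F(y_i)` (`exists_app_coord_eq`), hence `β(ℐ₀) ⊆ ℐ`. Equality is the
only place where the local form of the quotient by `ℐ` is needed: an epimorphism of superalgebras onto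
`i_* ⋀^• T^*_{Y,-}` that kills `ℐ₀` and has the same reduction has no larger kernel
(`LocalEpi.mem_splitIdeal_of_app_eq_zero`), since a larger kernel would contain a section of top
degree that does not vanish on `Y`, whereas the section of top degree on `Y` has a preimage of top
degree. So `α = β⁻¹` takes `ℐ` to `ℐ₀` (`GeneratedIdeal.exists_straightening`).

The sections `α⁻¹(n)` and `F(n)` differ by a section of `ℐ ∩ 𝒥^k`, whose leading component lies in
`ℐ₀`; so `α⁻¹` has the leading component of `F` along `Y` (`GeneratedIdeal.hasLeading_inv`).
Therefore the classes of the `α_x⁻¹` in `𝒬^{(k)}_X` lift the section induced by this component,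
and their differences on overlaps are the classes of `α_x α_y⁻¹`. This identifies the value of the
connecting map with the primary obstruction (`connecting_eq_primaryObstruction`).
-/

noncomputable section

/-! ### Exterior algebras -/

section ExteriorAlgebra

variable {M N : Type*} [AddCommGroup M] [Module ℂ M] [AddCommGroup N] [Module ℂ N]

theorem eq_of_extProj_eq {a b : ExteriorAlgebra ℂ M} (h : ∀ j, extProj j a = extProj j b) :
    a = b := by
  classical
  rw [← DirectSum.sum_support_decompose (fun i : ℕ => ⋀[ℂ]^i M) a,
    ← DirectSum.sum_support_decompose (fun i : ℕ => ⋀[ℂ]^i M) b]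
  have e : DirectSum.decompose (fun i : ℕ => ⋀[ℂ]^i M) a =
      DirectSum.decompose (fun i : ℕ => ⋀[ℂ]^i M) b :=
    DFinsupp.ext fun j => Subtype.ext (h j)
  rw [e]

theorem extProj_extProj (i j : ℕ) (a : ExteriorAlgebra ℂ M) :
    extProj i (extProj j a) = if i = j then extProj j a else 0 :=
  extProj_of_mem (extProj_mem j a) i

theorem extProj_same {n : ℕ} {a : ExteriorAlgebra ℂ M} (h : a ∈ ⋀[ℂ]^n M) : extProj n a = a := by
  rw [extProj_of_mem h, if_pos rfl]

theorem sum_range_extProj {n : ℕ} {a : ExteriorAlgebra ℂ M} (h : ∀ j, n ≤ j → extProj j a = 0) :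
    ∑ j ∈ Finset.range n, extProj j a = a := by
  refine eq_of_extProj_eq fun i => ?_
  rw [map_sum]
  simp only [extProj_extProj]
  rw [Finset.sum_ite_eq]
  split_ifs with hi
  · rfl
  · exact (h i (by simpa using hi)).symm

theorem mul_mem_extPow {p q : ℕ} {a b : ExteriorAlgebra ℂ M} (ha : a ∈ ⋀[ℂ]^p M)
    (hb : b ∈ ⋀[ℂ]^q M) : a * b ∈ ⋀[ℂ]^(p + q) M :=
  SetLike.mul_mem_graded (A := fun i : ℕ => ⋀[ℂ]^i M) ha hb

theorem extProj_mul_of_mem_left {p : ℕ} {a : ExteriorAlgebra ℂ M} (ha : a ∈ ⋀[ℂ]^p M)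
    (b : ExteriorAlgebra ℂ M) (n : ℕ) : extProj (p + n) (a * b) = a * extProj n b := by
  rw [extProj_mul, Finset.sum_eq_single (p, n)]
  · rw [extProj_same ha]
  · rintro ⟨i, j⟩ hij hne
    rw [extProj_of_mem ha, if_neg, zero_mul]
    rintro rfl
    have := Finset.HasAntidiagonal.mem_antidiagonal.1 hij
    exact hne (Prod.ext rfl (by simpa using this))
  · intro h
    exact absurd (Finset.HasAntidiagonal.mem_antidiagonal.2 (rfl : (p, n).1 + (p, n).2 = _)) h

theorem extProj_map (f : M →ₗ[ℂ] N) (j : ℕ) (a : ExteriorAlgebra ℂ M) :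
    extProj j (ExteriorAlgebra.map f a) = ExteriorAlgebra.map f (extProj j a) := by
  have key : ∀ n, ∀ b ∈ ⋀[ℂ]^n M, ExteriorAlgebra.map f b ∈ ⋀[ℂ]^n N := by
    intro n b hb
    have : (⋀[ℂ]^n M).map (ExteriorAlgebra.map f).toLinearMap ≤ ⋀[ℂ]^n N := by
      rw [Submodule.map_pow]
      refine pow_le_pow_left' ?_ n
      rw [ExteriorAlgebra.ι_range_map_map]
      rintro _ ⟨x, -, rfl⟩
      exact ⟨x, rfl⟩
    exact this ⟨b, hb, rfl⟩
  classical
  conv_lhs => rw [← DirectSum.sum_support_decompose (fun i : ℕ => ⋀[ℂ]^i M) a]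
  conv_rhs => rw [← DirectSum.sum_support_decompose (fun i : ℕ => ⋀[ℂ]^i M) a]
  simp only [map_sum]
  refine Finset.sum_congr rfl fun i _ => ?_
  rw [extProj_of_mem (key i _ (SetLike.coe_mem _)), extProj_of_mem (SetLike.coe_mem _)]
  split_ifs <;> simp

/-- Elements of even degree are central: a product of two vectors commutes with every vector. -/
theorem commute_of_mem_even {n : ℕ} (hn : Even n) {a : ExteriorAlgebra ℂ M} (ha : a ∈ ⋀[ℂ]^n M)
    (b : ExteriorAlgebra ℂ M) : a * b = b * a := by
  obtain ⟨r, rfl⟩ := hn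
  let Z : Subalgebra ℂ (ExteriorAlgebra ℂ M) := Subalgebra.center ℂ _
  let R := LinearMap.range (ExteriorAlgebra.ι ℂ : M →ₗ[ℂ] ExteriorAlgebra ℂ M)
  have h2 : R * R ≤ Subalgebra.toSubmodule Z := by
    rw [Submodule.mul_le]
    rintro _ ⟨u, rfl⟩ _ ⟨v, rfl⟩
    refine (Subalgebra.mem_center_iff (R := ℂ)).2 fun c => ?_
    have sw : ∀ x y : M, ExteriorAlgebra.ι ℂ x * ExteriorAlgebra.ι ℂ y =
        -(ExteriorAlgebra.ι ℂ y * ExteriorAlgebra.ι ℂ x) := fun x y =>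
      eq_neg_of_add_eq_zero_left (ExteriorAlgebra.ι_add_mul_swap x y)
    induction c using ExteriorAlgebra.induction with
    | algebraMap r => exact Algebra.commutes r _
    | ι w =>
      rw [← mul_assoc, sw w u, neg_mul, mul_assoc, sw w v, mul_neg, neg_neg, mul_assoc]
    | mul x y hx hy => rw [mul_assoc, hy, ← mul_assoc, hx, mul_assoc]
    | add x y hx hy => rw [add_mul, hx, hy, mul_add]
  have h : ∀ r, R ^ (r + r) ≤ Subalgebra.toSubmodule Z := by
    intro r
    induction r with
    | zero =>
      rw [pow_zero, Submodule.one_le]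
      exact one_mem Z
    | succ r ih =>
      rw [show r + 1 + (r + 1) = (r + r) + 1 + 1 by ring, pow_succ, pow_succ, mul_assoc,
        Submodule.mul_le]
      exact fun x hx y hy => Z.mul_mem (ih hx) (h2 hy)
  exact ((Subalgebra.mem_center_iff (R := ℂ)).1 (h r ha) b).symm

variable [FiniteDimensional ℂ M]

theorem extProj_eq_zero_of_finrank_lt {j : ℕ} (h : Module.finrank ℂ M < j)
    (a : ExteriorAlgebra ℂ M) : extProj j a = 0 := by
  have h0 : Module.finrank ℂ (⋀[ℂ]^j M) = 0 := by
    rw [exteriorPower.finrank_eq, Nat.choose_eq_zero_of_lt h]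
  have := Module.finrank_zero_iff.1 h0
  have e : (⟨extProj j a, extProj_mem j a⟩ : ⋀[ℂ]^j M) = 0 := Subsingleton.elim _ _
  exact congrArg Subtype.val e

variable (M) in
/-- A basis of the exterior algebra that consists of homogeneous elements. -/
def extBasis : Module.Basis (Finset (Fin (Module.finrank ℂ M))) ℂ (ExteriorAlgebra ℂ M) :=
  (Module.finBasis ℂ M).ExteriorAlgebra

theorem extBasis_mem (s : Finset (Fin (Module.finrank ℂ M))) :
    extBasis M s ∈ ⋀[ℂ]^s.card M := by
  rw [extBasis, ExteriorAlgebra.basis_apply]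
  exact SetLike.coe_mem (exteriorPower.ιMulti_family ℂ s.card _ _)

/-- The top degree of the exterior algebra is one-dimensional. -/
theorem extProj_finrank_eq (a : ExteriorAlgebra ℂ M) :
    extProj (Module.finrank ℂ M) a = (extBasis M).coord Finset.univ a • extBasis M Finset.univ := by
  conv_lhs => rw [← (extBasis M).sum_repr a]
  rw [map_sum, Finset.sum_eq_single Finset.univ]
  · rw [map_smul, Module.Basis.coord_apply, extProj_same]
    simpa using extBasis_mem (M := M) Finset.univ
  · intro s _ hs
    rw [map_smul, extProj_of_mem (extBasis_mem s), if_neg, smul_zero]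
    intro h
    exact hs (Finset.card_eq_iff_eq_univ s |>.1 (by simpa using h.symm))
  · simp

/-- The wedge product is a perfect pairing into the top degree: an element with a non-zero
component of degree `j` has a multiple whose component in the top degree is non-zero. -/
theorem exists_mul_top_ne_zero {j : ℕ} {a : ExteriorAlgebra ℂ M} (ha : extProj j a ≠ 0) :
    ∃ (i : ℕ) (v : ExteriorAlgebra ℂ M), v ∈ ⋀[ℂ]^i M ∧ i + j = Module.finrank ℂ M ∧
      extProj j a * v ≠ 0 := by
  obtain ⟨s, hs⟩ : ∃ s, (extBasis M).repr (extProj j a) s ≠ 0 := by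
    by_contra! h
    exact ha ((extBasis M).repr.map_eq_zero_iff.1 (Finsupp.ext h))
  have hcard : ∀ t, (extBasis M).repr (extProj j a) t ≠ 0 → t.card = j := by
    intro t ht
    by_contra hne
    apply ht
    have e1 : (extBasis M).repr (extProj j (extProj j a)) t =
        (extBasis M).repr (extProj j a) t := by rw [extProj_extProj, if_pos rfl]
    rw [← e1]
    conv_lhs => rw [← (extBasis M).sum_repr (extProj j a)]
    rw [map_sum, map_sum, Finsupp.finsetSum_apply]
    refine Finset.sum_eq_zero fun r _ => ?_
    rw [map_smul, extProj_of_mem (extBasis_mem r)]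
    split_ifs with hr
    · rw [map_smul, Module.Basis.repr_self, Finsupp.smul_apply, Finsupp.single_apply,
        if_neg (by rintro rfl; exact hne hr.symm), smul_zero]
    · simp
  have mulz : ∀ t u : Finset (Fin (Module.finrank ℂ M)), ¬ Disjoint t u →
      extBasis M t * extBasis M u = 0 := fun t u h =>
    ExteriorAlgebra.basis_mul_of_not_disjoint _ (Set.powersetCard.ofCard (n := t.card) rfl)
      (Set.powersetCard.ofCard (n := u.card) rfl) h
  have hsc : Disjoint s sᶜ := disjoint_compl_right
  refine ⟨sᶜ.card, extBasis M sᶜ, extBasis_mem _, ?_, ?_⟩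
  · have := Finset.card_add_card_compl s
    rw [hcard s hs, Fintype.card_fin] at this
    omega
  · conv_lhs => rw [← (extBasis M).sum_repr (extProj j a)]
    rw [Finset.sum_mul, Finset.sum_eq_single s]
    · rw [smul_mul_assoc]
      refine smul_ne_zero hs ?_
      have := ExteriorAlgebra.basis_mul_of_disjoint (Module.finBasis ℂ M)
        (Set.powersetCard.ofCard (n := s.card) rfl)
        (Set.powersetCard.ofCard (n := sᶜ.card) rfl) hsc
      change extBasis M s * extBasis M sᶜ = _ at this
      rw [this, Units.smul_def]
      rw [← Int.cast_smul_eq_zsmul ℂ]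
      exact smul_ne_zero (by exact_mod_cast Units.ne_zero _) ((extBasis M).ne_zero _)
    · intro t _ ht
      by_cases h0 : (extBasis M).repr (extProj j a) t = 0
      · rw [h0, zero_smul, zero_mul]
      · rw [smul_mul_assoc, mulz, smul_zero]
        intro hd
        refine ht (Finset.eq_of_subset_of_card_le ?_ ?_)
        · exact le_compl_compl.trans' (by simpa using hd.le_compl_right) |>.trans (by simp)
        · rw [hcard t h0, hcard s hs]
    · simp

end ExteriorAlgebra

/-! ### Sections and their restrictions -/

namespace Supergeometry

variable {X : Supergeometry.{u}}

section Rank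

variable (X) in
/-- The rank of the odd conormal bundle. -/
def rank : ℕ := Module.finrank ℂ X.Fiber

/-- The identification of the fibre at `x` with the model fibre. -/
def fiberEquiv (x : X.Base) : X.Odd x ≃ₗ[ℂ] X.Fiber :=
  (trivializationAt X.Fiber X.Odd x).linearEquivAt ℂ x
    (FiberBundle.mem_baseSet_trivializationAt' x)

instance (x : X.Base) : FiniteDimensional ℂ (X.Odd x) :=
  LinearEquiv.finiteDimensional (fiberEquiv x).symm

theorem finrank_odd (x : X.Base) : Module.finrank ℂ (X.Odd x) = X.rank :=
  LinearEquiv.finrank_eq (fiberEquiv x)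

end Rank

variable {U V W : Opens X.Base}

theorem sec_ext {s t : X.sec U} (h : ∀ x, s.1 x = t.1 x) : s = t := Subtype.ext (funext h)

theorem coe_sum {ι : Type*} (I : Finset ι) (s : ι → X.sec U) (x : U) :
    (∑ i ∈ I, s i).1 x = ∑ i ∈ I, (s i).1 x := by
  change ((X.sec U).val (∑ i ∈ I, s i)) x = _
  rw [map_sum, Finset.sum_apply]
  rfl

/-! ### Components of sections -/

/-- The projection onto the component of degree `j`, as a linear map. -/
def projLin (j : ℕ) : X.sec U →ₗ[ℂ] X.sec U where
  toFun := proj j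
  map_add' s t := sec_ext fun x => map_add (extProj j) (s.1 x) (t.1 x)
  map_smul' c s := sec_ext fun x => map_smul (extProj j) c (s.1 x)

theorem projLin_apply (j : ℕ) (s : X.sec U) : projLin j s = proj j s := rfl

theorem proj_add (j : ℕ) (s t : X.sec U) : proj j (s + t) = proj j s + proj j t :=
  map_add (projLin j) s t

theorem proj_sub (j : ℕ) (s t : X.sec U) : proj j (s - t) = proj j s - proj j t :=
  map_sub (projLin j) s t

theorem proj_zero (j : ℕ) : proj j (0 : X.sec U) = 0 := map_zero (projLin j)

theorem proj_sum {ι : Type*} (I : Finset ι) (j : ℕ) (s : ι → X.sec U) :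
    proj j (∑ i ∈ I, s i) = ∑ i ∈ I, proj j (s i) := map_sum (projLin j) s I

theorem proj_res (j : ℕ) (h : V ≤ U) (s : X.sec U) : proj j (res h s) = res h (proj j s) := rfl

theorem proj_mul (n : ℕ) (s t : X.sec U) :
    proj n (s * t) = ∑ p ∈ Finset.HasAntidiagonal.antidiagonal n, proj p.1 s * proj p.2 t := by
  refine sec_ext fun x => ?_
  rw [coe_sum]
  exact extProj_mul n (s.1 x) (t.1 x)

theorem isHomogeneous_proj (j : ℕ) (s : X.sec U) : IsHomogeneous j (proj j s) :=
  fun x => extProj_mem j (s.1 x)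

theorem IsHomogeneous.proj_eq {n : ℕ} {s : X.sec U} (h : IsHomogeneous n s) (j : ℕ) :
    proj j s = if j = n then s else 0 := by
  refine sec_ext fun x => ?_
  have := extProj_of_mem (h x) j
  split_ifs with e
  · rwa [if_pos e] at this
  · rwa [if_neg e] at this

theorem IsHomogeneous.proj_same {n : ℕ} {s : X.sec U} (h : IsHomogeneous n s) : proj n s = s := by
  rw [h.proj_eq, if_pos rfl]

theorem proj_proj (i j : ℕ) (s : X.sec U) : proj i (proj j s) = if i = j then proj j s else 0 :=
  (isHomogeneous_proj j s).proj_eq i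

theorem proj_eq_zero_of_rank_lt {j : ℕ} (h : X.rank < j) (s : X.sec U) : proj j s = 0 :=
  sec_ext fun x => extProj_eq_zero_of_finrank_lt (by rwa [finrank_odd]) (s.1 x)

theorem sum_proj (s : X.sec U) : ∑ j ∈ Finset.range (X.rank + 1), proj j s = s := by
  refine sec_ext fun x => ?_
  rw [coe_sum]
  exact sum_range_extProj fun j hj =>
    extProj_eq_zero_of_finrank_lt (by rw [finrank_odd]; omega) (s.1 x)

theorem sec_eq_of_proj {s t : X.sec U} (h : ∀ j, proj j s = proj j t) : s = t := by
  rw [← sum_proj s, ← sum_proj t]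
  simp only [h]

namespace IsHomogeneous

variable {m n : ℕ} {s t : X.sec U}

protected theorem zero : IsHomogeneous n (0 : X.sec U) := fun _ => Submodule.zero_mem _

protected theorem sum {ι : Type*} {I : Finset ι} {f : ι → X.sec U}
    (h : ∀ i ∈ I, IsHomogeneous n (f i)) : IsHomogeneous n (∑ i ∈ I, f i) := fun x => by
  rw [coe_sum]
  exact Submodule.sum_mem _ fun i hi => h i hi x

protected theorem mul (hs : IsHomogeneous m s) (ht : IsHomogeneous n t) :
    IsHomogeneous (m + n) (s * t) := fun x => mul_mem_extPow (hs x) (ht x)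

protected theorem res (h : V ≤ U) (hs : IsHomogeneous n s) : IsHomogeneous n (res h s) :=
  fun x => hs ⟨x, h x.2⟩

theorem mem_ferm (hs : IsHomogeneous n s) : s ∈ X.ferm n U := fun x j hj => by
  rw [extProj_of_mem (hs x), if_neg (by omega)]

/-- Sections of even degree are central. -/
theorem commute (hn : Even n) (hs : IsHomogeneous n s) (t : X.sec U) : s * t = t * s :=
  sec_ext fun x => commute_of_mem_even hn (hs x) (t.1 x)

theorem proj_mul (hs : IsHomogeneous m s) (t : X.sec U) (n : ℕ) :
    proj (m + n) (s * t) = s * proj n t :=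
  sec_ext fun x => extProj_mul_of_mem_left (hs x) (t.1 x) n

end IsHomogeneous

theorem mem_ferm_iff {k : ℕ} {s : X.sec U} : s ∈ X.ferm k U ↔ ∀ j < k, proj j s = 0 :=
  ⟨fun h j hj => sec_ext fun x => h x j hj,
    fun h x j hj => congrFun (congrArg Subtype.val (h j hj)) x⟩

theorem mem_ferm_zero (s : X.sec U) : s ∈ X.ferm 0 U := fun _ _ hj => absurd hj (Nat.not_lt_zero _)

theorem mem_ferm_local {k : ℕ} {s : X.sec U}
    (h : ∀ x ∈ U, ∃ (V : Opens X.Base) (_ : x ∈ V) (hV : V ≤ U), res hV s ∈ X.ferm k V) :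
    s ∈ X.ferm k U := by
  intro x
  obtain ⟨V, hx, hV, e⟩ := h x x.2
  exact e ⟨x, hx⟩

theorem eq_zero_of_mem_ferm {k : ℕ} (hk : X.rank < k) {s : X.sec U} (hs : s ∈ X.ferm k U) :
    s = 0 := by
  refine sec_eq_of_proj fun j => ?_
  rw [proj_zero]
  by_cases hj : j < k
  · exact mem_ferm_iff.1 hs j hj
  · exact proj_eq_zero_of_rank_lt (by omega) s

theorem hasParity_iff {p : Fin 2} {s : X.sec U} :
    HasParity p s ↔ ∀ j : ℕ, j % 2 ≠ p.val → proj j s = 0 :=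
  ⟨fun h j hj => sec_ext fun x => h x j hj,
    fun h x j hj => congrFun (congrArg Subtype.val (h j hj)) x⟩

theorem IsHomogeneous.hasParity {n : ℕ} {p : Fin 2} {s : X.sec U} (hs : IsHomogeneous n s)
    (h : n % 2 = p.val) : HasParity p s := by
  refine hasParity_iff.2 fun j hj => ?_
  rw [hs.proj_eq, if_neg]
  rintro rfl
  exact hj h

theorem HasParity.add {p : Fin 2} {s t : X.sec U} (hs : HasParity p s) (ht : HasParity p t) :
    HasParity p (s + t) := by
  rw [hasParity_iff] at *
  intro j hj
  rw [proj_add, hs j hj, ht j hj, add_zero]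

theorem HasParity.sub {p : Fin 2} {s t : X.sec U} (hs : HasParity p s) (ht : HasParity p t) :
    HasParity p (s - t) := by
  rw [hasParity_iff] at *
  intro j hj
  rw [proj_sub, hs j hj, ht j hj, sub_zero]

theorem HasParity.sum {ι : Type*} {I : Finset ι} {p : Fin 2} {s : ι → X.sec U}
    (h : ∀ i ∈ I, HasParity p (s i)) : HasParity p (∑ i ∈ I, s i) := by
  refine hasParity_iff.2 fun j hj => ?_
  rw [proj_sum]
  exact Finset.sum_eq_zero fun i hi => hasParity_iff.1 (h i hi) j hj

theorem HasParity.res {p : Fin 2} {s : X.sec U} (h : V ≤ U) (hs : HasParity p s) :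
    HasParity p (res h s) := fun x => hs ⟨x, h x.2⟩

/-- A section of parity `p` in `𝒥^k` lies in `𝒥^{k+1}` if `k` does not have parity `p`. -/
theorem HasParity.mem_ferm_succ {p : Fin 2} {k : ℕ} {s : X.sec U} (hp : HasParity p s)
    (hs : s ∈ X.ferm k U) (hk : k % 2 ≠ p.val) : s ∈ X.ferm (k + 1) U := by
  refine mem_ferm_iff.2 fun j hj => ?_
  rcases Nat.lt_succ_iff_lt_or_eq.1 hj with h | rfl
  · exact mem_ferm_iff.1 hs j h
  · exact hasParity_iff.1 hp _ hk

/-! ### Holomorphic functions and local generation -/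

/-- A holomorphic function as a section of degree zero. -/
def ofHol (g : X.Base → ℂ) (hg : X.IsHolomorphicOn U g) : X.sec U :=
  ⟨fun x => algebraMap ℂ _ (g x), fun x =>
    ⟨U, x.2, le_rfl, Algebra.subset_adjoin (Or.inl ⟨g, hg, fun _ => rfl⟩)⟩⟩

@[simp]
theorem ofHol_apply (g : X.Base → ℂ) (hg : X.IsHolomorphicOn U g) (x : U) :
    (ofHol g hg).1 x = algebraMap ℂ _ (g x) := rfl

/-- A holomorphic section of the odd conormal bundle as a section of degree one. -/
def ofOdd (σ : ∀ x, X.Odd x) (hσ : X.IsHolomorphicSectionOn U σ) : X.sec U :=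
  ⟨fun x => ExteriorAlgebra.ι ℂ (σ x), fun x =>
    ⟨U, x.2, le_rfl, Algebra.subset_adjoin (Or.inr ⟨σ, hσ, fun _ => rfl⟩)⟩⟩

theorem isHomogeneous_ofHol (g : X.Base → ℂ) (hg : X.IsHolomorphicOn U g) :
    IsHomogeneous 0 (ofHol g hg) := fun _ => algebraMap_mem_degree_zero _

theorem isHomogeneous_ofOdd (σ : ∀ x, X.Odd x) (hσ : X.IsHolomorphicSectionOn U σ) :
    IsHomogeneous 1 (ofOdd σ hσ) := fun _ => ι_mem_degree_one _

/-- Every section is locally a polynomial in holomorphic functions and holomorphic sections of the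
odd conormal bundle. -/
theorem exists_nbhd_of_subalgebra (s : X.sec U) (x : X.Base) (hx : x ∈ U)
    (A : ∀ V : Opens X.Base, V ≤ U → Subalgebra ℂ (X.sec V))
    (hf : ∀ V hV g (hg : X.IsHolomorphicOn V g), ofHol g hg ∈ A V hV)
    (hσ : ∀ V hV σ (hσ : X.IsHolomorphicSectionOn V σ), ofOdd σ hσ ∈ A V hV) :
    ∃ (V : Opens X.Base) (_ : x ∈ V) (hV : V ≤ U), res hV s ∈ A V hV := by
  obtain ⟨V, hxV, hV, h⟩ := s.2 ⟨x, hx⟩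
  refine ⟨V, hxV, hV, ?_⟩
  have : Algebra.adjoin ℂ (X.generators V) ≤ (A V hV).map (X.sec V).val := by
    refine Algebra.adjoin_le ?_
    rintro t (⟨g, hg, e⟩ | ⟨σ, hs, e⟩)
    · exact ⟨ofHol g hg, hf V hV g hg, (funext e).symm⟩
    · exact ⟨ofOdd σ hs, hσ V hV σ hs, (funext e).symm⟩
  obtain ⟨t, ht, e⟩ := this h
  rwa [show res hV s = t from Subtype.ext e.symm]

end Supergeometry

namespace Supergeometry

variable {X : Supergeometry.{u}} {U V W : Opens X.Base}

theorem IsHomogeneous.proj_mul_right {n : ℕ} {t : X.sec U} (ht : IsHomogeneous n t) (s : X.sec U)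
    (m : ℕ) : proj (m + n) (s * t) = proj m s * t := by
  rw [Supergeometry.proj_mul, Finset.sum_eq_single (m, n)]
  · rw [ht.proj_same]
  · rintro ⟨i, j⟩ hij hne
    have h := Finset.HasAntidiagonal.mem_antidiagonal.1 hij
    rw [ht.proj_eq, if_neg, mul_zero]
    rintro rfl
    exact hne (Prod.ext (by simpa using h) rfl)
  · intro h
    exact absurd (Finset.HasAntidiagonal.mem_antidiagonal.2 (rfl : (m, n).1 + (m, n).2 = _)) h

/-! ### Even derivations and their exponentials -/

variable (X) in
/-- A derivation over `U` of the sheaf of superalgebras `⋀^• T^*_{X,-}` that raises the degree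
by `e`. There are no signs in the Leibniz rule, since only even `e` are used. -/
@[ext]
structure GradedDerivation (U : Opens X.Base) (e : ℕ) where
  app : ∀ V, V ≤ U → X.sec V →ₗ[ℂ] X.sec V
  app_res : ∀ V V' (hV : V ≤ U) (h : V' ≤ V) (s : X.sec V),
    app V' (h.trans hV) (res h s) = res h (app V hV s)
  leibniz : ∀ V hV (s t : X.sec V), app V hV (s * t) = s * app V hV t + app V hV s * t
  homogeneous : ∀ V hV j (s : X.sec V), IsHomogeneous j s → IsHomogeneous (j + e) (app V hV s)

namespace GradedDerivation

variable {e : ℕ}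

instance : Neg (GradedDerivation X U e) where
  neg D :=
    { app := fun V hV => -D.app V hV
      app_res := fun V V' hV h s => by
        rw [LinearMap.neg_apply, LinearMap.neg_apply, D.app_res V V' hV h, map_neg]
      leibniz := fun V hV s t => by
        have h1 : s * (-D.app V hV) t = -(s * D.app V hV t) := mul_neg s (D.app V hV t)
        have h2 : (-D.app V hV) s * t = -(D.app V hV s * t) := neg_mul (D.app V hV s) t
        rw [h1, h2, LinearMap.neg_apply, D.leibniz]
        exact neg_add _ _
      homogeneous := fun V hV j s hs x => Submodule.neg_mem _ (D.homogeneous V hV j s hs x) }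

theorem neg_app (D : GradedDerivation X U e) (hV : V ≤ U) : (-D).app V hV = -D.app V hV := rfl

theorem neg_neg (D : GradedDerivation X U e) : -(-D) = D := by
  ext1
  funext V hV
  exact _root_.neg_neg (D.app V hV)

theorem app_mem_ferm (D : GradedDerivation X U e) (hV : V ≤ U) {j : ℕ} {s : X.sec V}
    (hs : s ∈ X.ferm j V) : D.app V hV s ∈ X.ferm (j + e) V := by
  rw [← sum_proj s, map_sum]
  refine sum_mem fun i _ => ?_
  by_cases h : i < j
  · rw [mem_ferm_iff.1 hs i h, map_zero]
    exact zero_mem _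
  · exact ferm_anti (by omega) (D.homogeneous V hV i _ (isHomogeneous_proj i s)).mem_ferm

theorem pow_mem_ferm (D : GradedDerivation X U e) (hV : V ≤ U) {j : ℕ} {s : X.sec V}
    (hs : s ∈ X.ferm j V) (i : ℕ) : (D.app V hV ^ i) s ∈ X.ferm (j + i * e) V := by
  induction i with
  | zero => simpa using hs
  | succ i ih =>
    rw [pow_succ', Module.End.mul_apply, Nat.succ_mul, ← add_assoc]
    exact D.app_mem_ferm hV ih

theorem pow_eq_zero (D : GradedDerivation X U e) (he : 0 < e) (hV : V ≤ U) {i : ℕ}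
    (hi : X.rank < i) : D.app V hV ^ i = 0 := by
  ext1 s
  have := D.pow_mem_ferm hV (mem_ferm_zero s) i
  rw [eq_zero_of_mem_ferm _ this, LinearMap.zero_apply]
  have : i * 1 ≤ i * e := Nat.mul_le_mul_left i he
  omega

theorem pow_res (D : GradedDerivation X U e) (hV : V ≤ U) (h : W ≤ V) (i : ℕ) (s : X.sec V) :
    (D.app W (h.trans hV) ^ i) (res h s) = res h ((D.app V hV ^ i) s) := by
  induction i with
  | zero => rfl
  | succ i ih =>
    rw [pow_succ', pow_succ', Module.End.mul_apply, Module.End.mul_apply, ih, D.app_res V W hV h]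

theorem app_hasParity (D : GradedDerivation X U e) (he : Even e) (hV : V ≤ U) {p : Fin 2}
    {s : X.sec V} (hs : HasParity p s) : HasParity p (D.app V hV s) := by
  rw [← sum_proj s, map_sum]
  refine HasParity.sum fun i _ => ?_
  by_cases h : i % 2 = p.val
  · exact (D.homogeneous V hV i _ (isHomogeneous_proj i s)).hasParity (by
      rw [Nat.add_mod, Nat.even_iff.1 he]; omega)
  · rw [hasParity_iff.1 hs i h, map_zero]
    exact IsHomogeneous.zero.hasParity (n := p.val) (by omega)

/-- The exponential series of an even derivation that raises the degree. The degrees are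
bounded by the rank, so the powers beyond it vanish; two more terms are kept in order that the
constant and the linear term are present for every rank. -/
def expLin (D : GradedDerivation X U e) (V : Opens X.Base) (hV : V ≤ U) : X.sec V →ₗ[ℂ] X.sec V :=
  ∑ i ∈ Finset.range (X.rank + 2), ((i.factorial : ℂ)⁻¹) • D.app V hV ^ i

theorem expLin_apply (D : GradedDerivation X U e) (hV : V ≤ U) (s : X.sec V) :
    D.expLin V hV s =
      ∑ i ∈ Finset.range (X.rank + 2), ((i.factorial : ℂ)⁻¹) • (D.app V hV ^ i) s := by
  simp [expLin]

/-- Vector spaces over `ℂ` as vector spaces over `ℚ`, the scalars of `IsNilpotent.exp`. -/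
@[reducible]
def ratModule (A : Type*) [AddCommGroup A] [Module ℂ A] : Module ℚ A :=
  Module.compHom A (algebraMap ℚ ℂ)

theorem expLin_eq_exp (D : GradedDerivation X U e) (he : 0 < e) (hV : V ≤ U) :
    letI := ratModule (X.sec V)
    D.expLin V hV = IsNilpotent.exp (D.app V hV) := by
  let := ratModule (X.sec V)
  rw [IsNilpotent.exp_eq_sum (D.pow_eq_zero he hV (i := X.rank + 2) (by omega))]
  refine Finset.sum_congr rfl fun i _ => ?_
  ext1 s
  change ((i.factorial : ℂ)⁻¹) • (D.app V hV ^ i) s =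
    (algebraMap ℚ ℂ ((i.factorial : ℚ)⁻¹)) • (D.app V hV ^ i) s
  simp

theorem expLin_neg_apply (D : GradedDerivation X U e) (he : 0 < e) (hV : V ≤ U) (s : X.sec V) :
    (-D).expLin V hV (D.expLin V hV s) = s := by
  let := ratModule (X.sec V)
  have h : IsNilpotent (D.app V hV) := ⟨X.rank + 2, D.pow_eq_zero he hV (by omega)⟩
  rw [expLin_eq_exp _ he, expLin_eq_exp _ he, neg_app, ← Module.End.mul_apply,
    IsNilpotent.exp_neg_mul_exp_self h, Module.End.one_apply]

theorem expLin_mul (D : GradedDerivation X U e) (he : 0 < e) (hV : V ≤ U) (s t : X.sec V) :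
    D.expLin V hV (s * t) = D.expLin V hV s * D.expLin V hV t := by
  let := ratModule (X.sec V)
  have h : IsNilpotent (D.app V hV) := ⟨X.rank + 2, D.pow_eq_zero he hV (by omega)⟩
  rw [expLin_eq_exp _ he]
  exact Module.End.exp_mul_of_derivation ℂ _ _ (D.leibniz V hV) h s t

/-- A submodule that is stable under the derivation is stable under the exponential. -/
theorem expLin_mem (D : GradedDerivation X U e) (hV : V ≤ U) (S : Submodule ℂ (X.sec V))
    (hS : ∀ s ∈ S, D.app V hV s ∈ S) {s : X.sec V} (hs : s ∈ S) : D.expLin V hV s ∈ S := by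
  rw [expLin_apply]
  refine sum_mem fun i hi => S.smul_mem _ ?_
  clear hi
  induction i with
  | zero => exact hs
  | succ i ih =>
    rw [pow_succ', Module.End.mul_apply]
    exact hS _ ih

theorem expLin_sub_sub_mem (D : GradedDerivation X U e) (hV : V ≤ U) {j : ℕ} {s : X.sec V}
    (hs : s ∈ X.ferm j V) :
    D.expLin V hV s - s - D.app V hV s ∈ X.ferm (j + 2 * e) V := by
  rw [expLin_apply, Finset.sum_range_succ', Finset.sum_range_succ']
  have : ∀ a b c : X.sec V, a + b + c - c - b = a := fun a b c => by
    rw [add_sub_cancel_right, add_sub_cancel_right]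
  simp only [zero_add, Nat.factorial_zero, Nat.factorial_one, Nat.cast_one, inv_one, one_smul,
    pow_zero, pow_one, Module.End.one_apply, this]
  refine sum_mem fun i _ => (X.ferm _ V).smul_mem _ (ferm_anti ?_ (D.pow_mem_ferm hV hs _))
  have : 2 * e ≤ (i + 1 + 1) * e := Nat.mul_le_mul_right e (by omega)
  omega

theorem expLin_sub_mem (D : GradedDerivation X U e) (hV : V ≤ U) {j : ℕ} {s : X.sec V}
    (hs : s ∈ X.ferm j V) : D.expLin V hV s - s ∈ X.ferm (j + e) V := by
  have h := add_mem (ferm_anti (by omega) (D.expLin_sub_sub_mem hV hs)) (D.app_mem_ferm hV hs)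
  rwa [sub_add_cancel] at h

theorem app_one (D : GradedDerivation X U e) (hV : V ≤ U) : D.app V hV 1 = 0 := by
  have := D.leibniz V hV 1 1
  rw [mul_one, one_mul, mul_one] at this
  exact left_eq_add.1 this

theorem expLin_one (D : GradedDerivation X U e) (hV : V ≤ U) : D.expLin V hV 1 = 1 := by
  rw [expLin_apply, Finset.sum_range_succ', Finset.sum_eq_zero]
  · simp
  · intro i _
    rw [pow_succ, Module.End.mul_apply, D.app_one, map_zero, smul_zero]

theorem expLin_hasParity (D : GradedDerivation X U e) (he : Even e) (hV : V ≤ U) {p : Fin 2}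
    {s : X.sec V} (hs : HasParity p s) : HasParity p (D.expLin V hV s) :=
  D.expLin_mem hV
    { carrier := {t | HasParity p t}
      add_mem' := HasParity.add
      zero_mem' := IsHomogeneous.zero.hasParity (n := p.val) (by omega)
      smul_mem' := fun c t ht x j hj => by
        change extProj j (c • t.1 x) = 0
        rw [map_smul, ht x j hj, smul_zero] }
    (fun _ ht => D.app_hasParity he hV ht) hs

/-- The exponential of an even derivation that raises the degree. -/
def exp (D : GradedDerivation X U e) (he : 0 < e) (he2 : Even e) : SuperAut X U where
  app V hV :=
    { toFun := D.expLin V hV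
      invFun := (-D).expLin V hV
      left_inv := D.expLin_neg_apply he hV
      right_inv := fun s => by
        have := (-D).expLin_neg_apply he hV s
        rwa [D.neg_neg] at this
      map_mul' := D.expLin_mul he hV
      map_add' := map_add _
      commutes' := fun c => by
        rw [Algebra.algebraMap_eq_smul_one, map_smul, expLin_one] }
  app_res V V' hV h s := by
    change D.expLin V' _ (res h s) = res h (D.expLin V hV s)
    rw [expLin_apply, expLin_apply, map_sum]
    refine Finset.sum_congr rfl fun i _ => ?_
    rw [map_smul, D.pow_res hV h]
  parity V hV p s := by
    refine ⟨fun h => ?_, fun h => D.expLin_hasParity he2 hV h⟩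
    have := (-D).expLin_hasParity he2 hV h
    change HasParity p ((-D).expLin V hV (D.expLin V hV s)) at this
    rwa [D.expLin_neg_apply he hV] at this

theorem exp_app (D : GradedDerivation X U e) (he : 0 < e) (he2 : Even e) (hV : V ≤ U)
    (s : X.sec V) : (D.exp he he2).app V hV s = D.expLin V hV s := rfl

end GradedDerivation

/-! ### The leading derivation of an automorphism -/

/-- An automorphism `α` moves every section into a degree higher by at least `e`. -/
def SuperAut.RaisesDegree (a : SuperAut X U) (e : ℕ) : Prop :=
  ∀ V hV j (s : X.sec V), s ∈ X.ferm j V → a.app V hV s - s ∈ X.ferm (j + e) V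

/-- An automorphism raises the degree by `e` on products if it does so on the factors, and sections
are locally polynomials in sections of degree zero and one. -/
theorem SuperAut.raisesDegree_of_generators {a : SuperAut X U} {e : ℕ}
    (h0 : ∀ V hV (s : X.sec V), IsHomogeneous 0 s → a.app V hV s - s ∈ X.ferm e V)
    (h1 : ∀ V hV (s : X.sec V), IsHomogeneous 1 s → a.app V hV s - s ∈ X.ferm (1 + e) V) :
    a.RaisesDegree e := by
  let A : ∀ V : Opens X.Base, V ≤ U → Subalgebra ℂ (X.sec V) := fun V hV =>
    { carrier := {s | ∀ j, a.app V hV (proj j s) - proj j s ∈ X.ferm (j + e) V}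
      mul_mem' := by
        intro s t hs ht n
        rw [proj_mul, map_sum, ← Finset.sum_sub_distrib]
        refine sum_mem fun p hp => ?_
        have hp := Finset.HasAntidiagonal.mem_antidiagonal.1 hp
        have ht2 : a.app V hV (proj p.2 t) ∈ X.ferm p.2 V := by
          have := add_mem (ferm_anti (by omega) (ht p.2)) (isHomogeneous_proj p.2 t).mem_ferm
          rwa [sub_add_cancel] at this
        rw [map_mul, show ∀ x y z w : X.sec V, x * y - z * w = (x - z) * y + z * (y - w) from
          fun x y z w => by rw [sub_mul, mul_sub, sub_add_sub_cancel]]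
        exact add_mem (ferm_anti (by omega) (ferm_mul_mem (hs p.1) ht2))
          (ferm_anti (by omega) (ferm_mul_mem (isHomogeneous_proj p.1 s).mem_ferm (ht p.2)))
      add_mem' := by
        intro s t hs ht j
        rw [proj_add, map_add, add_sub_add_comm]
        exact add_mem (hs j) (ht j)
      algebraMap_mem' := by
        intro c j
        have hc : IsHomogeneous 0 (algebraMap ℂ (X.sec V) c) := fun x =>
          algebraMap_mem_degree_zero c
        rw [hc.proj_eq]
        split_ifs
        · rw [AlgEquiv.commutes, sub_self]
          exact zero_mem _
        · rw [map_zero, sub_zero]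
          exact zero_mem _ }
  have hom : ∀ V hV n (s : X.sec V), IsHomogeneous n s → a.app V hV s - s ∈ X.ferm (n + e) V →
      s ∈ A V hV := by
    intro V hV n s hs h j
    rw [hs.proj_eq]
    split_ifs with hj
    · rwa [hj]
    · rw [map_zero, sub_zero]
      exact zero_mem _
  intro V hV j s hs
  refine mem_ferm_local fun x hx => ?_
  obtain ⟨W, hxW, hW, h⟩ := exists_nbhd_of_subalgebra s x hx (fun W hW => A W (hW.trans hV))
    (fun W hW g hg => hom W (hW.trans hV) 0 _ (isHomogeneous_ofHol g hg) (by
      rw [zero_add]; exact h0 W (hW.trans hV) _ (isHomogeneous_ofHol g hg)))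
    (fun W hW σ hσ => hom W (hW.trans hV) 1 _ (isHomogeneous_ofOdd σ hσ)
      (h1 W (hW.trans hV) _ (isHomogeneous_ofOdd σ hσ)))
  refine ⟨W, hxW, hW, ?_⟩
  have key : a.app W (hW.trans hV) (res hW s) - res hW s ∈ X.ferm (j + e) W := by
    rw [← sum_proj (res hW s), map_sum, ← Finset.sum_sub_distrib]
    refine sum_mem fun i _ => ?_
    by_cases hi : i < j
    · rw [mem_ferm_iff.1 (res_ferm hW hs) i hi, map_zero, sub_zero]
      exact zero_mem _
    · exact ferm_anti (by omega) (h i)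
  rwa [a.app_res V W hV hW, ← map_sub] at key

/-- The largest even number `≤ k`: the degree of the leading derivation of an automorphism in
`𝒢^{(k)}`. -/
def evenPart (k : ℕ) : ℕ := 2 * (k / 2)

theorem even_evenPart (k : ℕ) : Even (evenPart k) := ⟨k / 2, by rw [evenPart]; ring⟩

theorem evenPart_pos {k : ℕ} (hk : 2 ≤ k) : 0 < evenPart k := by rw [evenPart]; omega

/-- Automorphisms preserve the parity, so those in `𝒢^{(k)}` move functions by terms of even degree
and odd sections by terms of odd degree. -/
theorem greenSubgroup_raisesDegree {k : ℕ} {a : SuperAut X U} (ha : a ∈ X.greenSubgroup k U) :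
    a.RaisesDegree (evenPart k) := by
  refine SuperAut.raisesDegree_of_generators
    (fun V hV s hs => ferm_anti (by rw [evenPart]; omega) (ha V hV s)) fun V hV s hs => ?_
  rcases Nat.even_or_odd k with h | h
  · have hp : HasParity 1 s := hs.hasParity rfl
    have := (((a.parity V hV 1 s).2 hp).sub hp).mem_ferm_succ (ha V hV s) (by
      rw [Nat.even_iff.1 h]; decide)
    exact ferm_anti (by rw [evenPart]; omega) this
  · have := Nat.odd_iff.1 h
    exact ferm_anti (by rw [evenPart]; omega) (ha V hV s)

/-- For odd `k`, the automorphisms in `𝒢^{(k)}` move functions by terms of degree `> k`. -/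
theorem greenSubgroup_sub_mem_of_odd {k : ℕ} (hk : _root_.Odd k) {a : SuperAut X U}
    (ha : a ∈ X.greenSubgroup k U) (hV : V ≤ U) {s : X.sec V} (hs : IsHomogeneous 0 s) :
    a.app V hV s - s ∈ X.ferm (k + 1) V := by
  have hp : HasParity 0 s := hs.hasParity rfl
  exact (((a.parity V hV 0 s).2 hp).sub hp).mem_ferm_succ (ha V hV s) (by
    rw [Nat.odd_iff.1 hk]; decide)

namespace SuperAut

variable {e : ℕ}

/-- The linear map whose component on sections of degree `j` is `ξ^{j+e} ∘ α`. -/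
def leadLin (a : SuperAut X U) (e : ℕ) (V : Opens X.Base) (hV : V ≤ U) : X.sec V →ₗ[ℂ] X.sec V :=
  ∑ j ∈ Finset.range (X.rank + 1), projLin (j + e) ∘ₗ (a.app V hV).toLinearMap ∘ₗ projLin j

theorem leadLin_apply (a : SuperAut X U) (hV : V ≤ U) (s : X.sec V) :
    a.leadLin e V hV s =
      ∑ j ∈ Finset.range (X.rank + 1), proj (j + e) (a.app V hV (proj j s)) := by
  simp [leadLin, projLin_apply]

theorem leadLin_of_isHomogeneous (a : SuperAut X U) (hV : V ≤ U) {n : ℕ} {s : X.sec V}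
    (hs : IsHomogeneous n s) : a.leadLin e V hV s = proj (n + e) (a.app V hV s) := by
  rw [leadLin_apply]
  by_cases hn : n ≤ X.rank
  · rw [Finset.sum_eq_single n]
    · rw [hs.proj_same]
    · intro j _ hj
      rw [hs.proj_eq, if_neg hj, map_zero, proj_zero]
    · intro h
      exact absurd (Finset.mem_range.2 (by omega)) h
  · have : s = 0 := by rw [← hs.proj_same, proj_eq_zero_of_rank_lt (by omega)]
    subst this
    simp [proj_zero]

/-- The leading derivation `⨁_j ξ^{j+e} ∘ α ∘ ξ^j` of an automorphism `α` that raises the degree by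
`e`. -/
def lead (a : SuperAut X U) (he : 0 < e) (ha : a.RaisesDegree e) : GradedDerivation X U e where
  app := a.leadLin e
  app_res V V' hV h s := by
    rw [leadLin_apply, leadLin_apply, map_sum]
    refine Finset.sum_congr rfl fun j _ => ?_
    rw [proj_res, a.app_res V V' hV h, proj_res]
  homogeneous V hV j s hs := by
    rw [leadLin_of_isHomogeneous a hV hs]
    exact isHomogeneous_proj _ _
  leibniz V hV s t := by
    have key : ∀ (p q : ℕ) (s t : X.sec V), IsHomogeneous p s → IsHomogeneous q t →
        a.leadLin e V hV (s * t) = s * a.leadLin e V hV t + a.leadLin e V hV s * t := by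
      intro p q s t hs ht
      rw [leadLin_of_isHomogeneous a hV (hs.mul ht), leadLin_of_isHomogeneous a hV hs,
        leadLin_of_isHomogeneous a hV ht, map_mul]
      obtain ⟨b, hb⟩ : ∃ b, b = a.app V hV s - s := ⟨_, rfl⟩
      obtain ⟨c, hc⟩ : ∃ c, c = a.app V hV t - t := ⟨_, rfl⟩
      have hbm := hb ▸ ha V hV p s hs.mem_ferm
      have hcm := hc ▸ ha V hV q t ht.mem_ferm
      rw [sub_eq_iff_eq_add.1 hb.symm, sub_eq_iff_eq_add.1 hc.symm]
      have e1 : proj (p + q + e) (b * c) = 0 :=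
        mem_ferm_iff.1 (ferm_mul_mem hbm hcm) _ (by omega)
      have e2 : proj (p + q + e) (s * t) = 0 := by
        rw [(hs.mul ht).proj_eq, if_neg (by omega)]
      have e3 : proj (p + q + e) (s * c) = s * proj (q + e) c := by
        rw [add_assoc, hs.proj_mul]
      have e4 : proj (p + q + e) (b * t) = proj (p + e) b * t := by
        rw [add_right_comm, ht.proj_mul_right]
      rw [add_mul, mul_add, mul_add, proj_add, proj_add, proj_add, e1, e2, e3, e4, proj_add,
        proj_add, hs.proj_eq, ht.proj_eq, if_neg (by omega), if_neg (by omega)]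
      simp only [add_zero, zero_add]
      exact add_comm _ _
    conv_lhs => rw [← sum_proj s, ← sum_proj t]
    conv_rhs => rw [← sum_proj s, ← sum_proj t]
    simp only [Finset.sum_mul_sum, map_sum, ← Finset.sum_add_distrib]
    exact Finset.sum_congr rfl fun i _ => Finset.sum_congr rfl fun j _ =>
      key i j _ _ (isHomogeneous_proj i s) (isHomogeneous_proj j t)

theorem lead_app (a : SuperAut X U) (he : 0 < e) (ha : a.RaisesDegree e) (hV : V ≤ U) {n : ℕ}
    {s : X.sec V} (hs : IsHomogeneous n s) :
    (a.lead he ha).app V hV s = proj (n + e) (a.app V hV s) := leadLin_of_isHomogeneous a hV hs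

end SuperAut

end Supergeometry

/-! ### Hadamard's lemma -/

section Hadamard

open Filter Topology MeasureTheory

variable {Z G : Type*} [NormedAddCommGroup Z] [NormedSpace ℂ Z] [NormedAddCommGroup G]
  [NormedSpace ℂ G] [CompleteSpace G]

/-- Averaging an analytic function over the images of its argument under a continuous family of
linear maps gives an analytic function: its power series is obtained by averaging the terms. -/
theorem AnalyticAt.average {f : Z → G} {z₀ : Z} (hf : AnalyticAt ℂ f z₀) (A : ℝ → Z →L[ℂ] Z)
    (hA : Continuous A) :
    AnalyticAt ℂ (fun z => ∫ t in (0 : ℝ)..1, f (z₀ + A t (z - z₀))) z₀ := by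
  obtain ⟨q, r, hq⟩ := hf
  obtain ⟨C, hC⟩ : ∃ C, ∀ t ∈ Set.Icc (0 : ℝ) 1, ‖A t‖ ≤ C :=
    isCompact_Icc.exists_bound_of_continuousOn hA.continuousOn
  obtain ⟨ρ, hρ0, hρr⟩ : ∃ ρ : NNReal, 0 < ρ ∧ (ρ : ENNReal) < r :=
    ENNReal.lt_iff_exists_nnreal_btwn.1 hq.r_pos |>.imp fun ρ h => ⟨by exact_mod_cast h.1, h.2⟩
  have hsum : Summable fun n => ‖q n‖ * (ρ : ℝ) ^ n :=
    q.summable_norm_mul_pow (hρr.trans_le hq.r_le)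
  let K : ℝ := max C 1
  have hK : 0 < K := lt_of_lt_of_le one_pos (le_max_right _ _)
  have hAK : ∀ t ∈ Set.uIoc (0 : ℝ) 1, ‖A t‖ ≤ K := by
    intro t ht
    rw [Set.uIoc_of_le zero_le_one] at ht
    exact (hC t ⟨ht.1.le, ht.2⟩).trans (le_max_left _ _)
  let Q : ∀ n, ℝ → ContinuousMultilinearMap ℂ (fun _ : Fin n => Z) G := fun n t =>
    (q n).compContinuousLinearMap fun _ => A t
  have hQ : ∀ n, Continuous (Q n) := by
    intro n
    have h1 := (ContinuousMultilinearMap.compContinuousLinearMapContinuousMultilinear ℂ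
      (fun _ : Fin n => Z) (fun _ : Fin n => Z) G).cont
    have h2 : Continuous fun t : ℝ => fun _ : Fin n => A t := by fun_prop
    exact ((ContinuousLinearMap.apply ℂ _ (q n)).continuous.comp (h1.comp h2))
  have hQn : ∀ n, ∀ t ∈ Set.uIoc (0 : ℝ) 1, ‖Q n t‖ ≤ ‖q n‖ * K ^ n := by
    intro n t ht
    refine ((q n).norm_compContinuousLinearMap_le _).trans ?_
    rw [Finset.prod_const, Finset.card_univ, Fintype.card_fin]
    gcongr
    exact hAK t ht
  let R : FormalMultilinearSeries ℂ Z G := fun n => ∫ t in (0 : ℝ)..1, Q n t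
  have hR : ∀ n, ‖R n‖ ≤ ‖q n‖ * K ^ n := by
    intro n
    have := intervalIntegral.norm_integral_le_of_norm_le_const (hQn n)
    simpa using this
  have hρK : 0 < ρ / K.toNNReal := div_pos hρ0 (by simpa using hK)
  refine ⟨R, ((ρ / K.toNNReal : NNReal) : ENNReal), ?_, by exact_mod_cast hρK, ?_⟩
  · refine R.le_radius_of_bound (∑' n, ‖q n‖ * (ρ : ℝ) ^ n) fun n => ?_
    refine le_trans ?_ (hsum.le_tsum n fun m _ => by positivity)
    rw [NNReal.coe_div, Real.coe_toNNReal _ hK.le, div_pow]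
    calc ‖R n‖ * (ρ ^ n / K ^ n) ≤ ‖q n‖ * K ^ n * (ρ ^ n / K ^ n) := by gcongr; exact hR n
      _ = ‖q n‖ * ρ ^ n := by field_simp
  · intro y hy
    have hy' : K * ‖y‖ < ρ := by
      rw [Metric.mem_eball, edist_zero_right, enorm_eq_nnnorm] at hy
      have h1 : ‖y‖₊ < ρ / K.toNNReal := by exact_mod_cast hy
      have h2 : ‖y‖ < ρ / K := by
        have := NNReal.coe_lt_coe.2 h1
        rwa [NNReal.coe_div, Real.coe_toNNReal _ hK.le, coe_nnnorm] at this
      rw [lt_div_iff₀ hK] at h2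
      linarith
    have happ : ∀ n, R n (fun _ => y) = ∫ t in (0 : ℝ)..1, q n fun _ => A t y := by
      intro n
      exact ((ContinuousMultilinearMap.apply ℂ (fun _ : Fin n => Z) G
        (fun _ => y)).intervalIntegral_comp_comm ((hQ n).intervalIntegrable 0 1)).symm
    simp only [happ, add_sub_cancel_left]
    have hb : ∀ n, ∀ t ∈ Set.uIoc (0 : ℝ) 1, ‖q n fun _ => A t y‖ ≤ ‖q n‖ * ρ ^ n := by
      intro n t ht
      have := (q n).le_opNorm fun _ => A t y
      rw [Finset.prod_const, Finset.card_univ, Fintype.card_fin] at this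
      refine this.trans ?_
      gcongr
      exact ((A t).le_opNorm y).trans ((by gcongr; exact hAK t ht : _ ≤ K * ‖y‖).trans hy'.le)
    refine intervalIntegral.hasSum_integral_of_dominated_convergence
      (fun n _ => ‖q n‖ * ρ ^ n) (fun n => ?_) (fun n => ae_of_all _ (hb n))
      (ae_of_all _ fun t _ => hsum) intervalIntegrable_const (ae_of_all _ fun t ht => ?_)
    · exact ((q n).cont.comp (by fun_prop : Continuous fun t => fun _ : Fin n => A t y)
        ).aestronglyMeasurable
    · refine hq.hasSum ?_
      rw [Metric.mem_eball, edist_zero_right, enorm_eq_nnnorm]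
      refine lt_of_le_of_lt ?_ hρr
      have : ‖A t y‖ ≤ ρ :=
        ((A t).le_opNorm y).trans ((by gcongr; exact hAK t ht : _ ≤ K * ‖y‖).trans hy'.le)
      exact_mod_cast this

/-- Hadamard's lemma: an analytic function that vanishes where the coordinates `ℓ i` do is a
combination of these coordinates with analytic coefficients. They are averages of the derivative
over the segments that join a point to its projection to the common zero set. -/
theorem AnalyticAt.exists_eq_sum_mul {ι : Type*} [Fintype ι] [DecidableEq ι] (ℓ : ι → Z →L[ℂ] ℂ)
    (v : ι → Z) (hℓ : ∀ i j, ℓ i (v j) = if i = j then 1 else 0) {g : Z → ℂ} {z₀ : Z}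
    (hg : AnalyticAt ℂ g z₀) (hz₀ : ∀ i, ℓ i z₀ = 0)
    (hz : ∀ᶠ z in 𝓝 z₀, (∀ i, ℓ i z = 0) → g z = 0) :
    ∃ h : ι → Z → ℂ, (∀ i, AnalyticAt ℂ (h i) z₀) ∧
      ∀ᶠ z in 𝓝 z₀, g z = ∑ i, ℓ i z * h i z := by
  let P : Z →L[ℂ] Z := ∑ i, (ℓ i).smulRight (v i)
  have hP : ∀ z, P z = ∑ i, ℓ i z • v i := fun z => by simp [P]
  let A : ℝ → Z →L[ℂ] Z := fun t => (ContinuousLinearMap.id ℂ Z - P) + (t : ℂ) • P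
  have hA : Continuous A := by fun_prop
  have hAapp : ∀ t y, A t y = y - P y + (t : ℂ) • P y := fun t y => by simp [A]
  have hM := hg.fderiv.average A hA
  refine ⟨fun i z => (∫ t in (0 : ℝ)..1, fderiv ℂ g (z₀ + A t (z - z₀))) (v i), fun i =>
    ((ContinuousLinearMap.apply ℂ ℂ (v i)).analyticAt _).comp hM, ?_⟩
  -- the segments are short enough to stay where `g` is analytic
  have hgn := hg.eventually_analyticAt
  obtain ⟨ε, hε, hball⟩ := Metric.eventually_nhds_iff_ball.1 (hgn.and hz)
  obtain ⟨C, hC⟩ : ∃ C, ∀ t ∈ Set.Icc (0 : ℝ) 1, ‖A t‖ ≤ C :=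
    isCompact_Icc.exists_bound_of_continuousOn hA.continuousOn
  have hK : 0 < max C 1 := lt_of_lt_of_le one_pos (le_max_right _ _)
  filter_upwards [Metric.ball_mem_nhds z₀ (div_pos hε hK)] with z hzb
  have hseg : ∀ t ∈ Set.Icc (0 : ℝ) 1, z₀ + A t (z - z₀) ∈ Metric.ball z₀ ε := by
    intro t ht
    rw [Metric.mem_ball, dist_eq_norm, add_sub_cancel_left]
    rw [Metric.mem_ball, dist_eq_norm, lt_div_iff₀ hK] at hzb
    calc ‖A t (z - z₀)‖ ≤ ‖A t‖ * ‖z - z₀‖ := (A t).le_opNorm _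
      _ ≤ max C 1 * ‖z - z₀‖ := by gcongr; exact (hC t ht).trans (le_max_left _ _)
      _ < ε := by linarith
  have hPz : P (z - z₀) = P z := by
    rw [map_sub, hP z₀]
    simp [hz₀]
  have hcont : ContinuousOn (fun t : ℝ => fderiv ℂ g (z₀ + A t (z - z₀))) (Set.uIcc 0 1) := by
    rw [Set.uIcc_of_le zero_le_one]
    intro t ht
    have h1 : ContinuousAt (fderiv ℂ g) (z₀ + A t (z - z₀)) :=
      (hball _ (hseg t ht)).1.fderiv.continuousAt
    have h2 : Continuous fun t : ℝ => z₀ + A t (z - z₀) := by fun_prop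
    exact (ContinuousAt.comp (f := fun t : ℝ => z₀ + A t (z - z₀)) h1
      h2.continuousAt).continuousWithinAt
  have hint := hcont.intervalIntegrable (μ := volume)
  have hderiv : ∀ t ∈ Set.uIcc (0 : ℝ) 1, HasDerivAt (fun t : ℝ => g (z₀ + A t (z - z₀)))
      (fderiv ℂ g (z₀ + A t (z - z₀)) (P z)) t := by
    intro t ht
    rw [Set.uIcc_of_le zero_le_one] at ht
    have h1 := (hball _ (hseg t ht)).1.differentiableAt.hasFDerivAt.restrictScalars ℝ
    have h2 : HasDerivAt (fun t : ℝ => z₀ + A t (z - z₀)) (P z) t := by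
      simp only [hAapp, hPz]
      have h3 : HasDerivAt (fun t : ℝ => (t : ℂ)) 1 t := Complex.ofRealCLM.hasDerivAt
      simpa using ((h3.smul_const (P z)).const_add (z - z₀ - P z)).const_add z₀
    exact h1.comp_hasDerivAt t h2
  have hFTC := intervalIntegral.integral_eq_sub_of_hasDerivAt hderiv
    (hcont.clm_apply continuousOn_const).intervalIntegrable
  have hcomm := (ContinuousLinearMap.apply ℂ ℂ (P z)).intervalIntegral_comp_comm hint
  simp only [ContinuousLinearMap.apply_apply] at hcomm
  rw [hFTC] at hcomm
  have h1 : z₀ + A 1 (z - z₀) = z := by simp [hAapp]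
  have h0 : z₀ + A 0 (z - z₀) = z - P z := by
    rw [hAapp, hPz]
    simp only [Complex.ofReal_zero, zero_smul, add_zero]
    abel
  have hg0 : g (z₀ + A 0 (z - z₀)) = 0 := by
    refine (hball _ (hseg 0 (by simp))).2 fun i => ?_
    rw [h0, map_sub, hP, map_sum]
    simp [hℓ]
  rw [hg0, h1, sub_zero, hP, map_sum] at hcomm
  rw [hcomm]
  simp

end Hadamard

namespace Supergeometry

variable {X : Supergeometry.{u}} {U V W : Opens X.Base}

/-! ### Holomorphic functions -/

section Holomorphic

open Filter Topology

theorem isHolomorphicOn_iff {g : X.Base → ℂ} :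
    X.IsHolomorphicOn U g ↔ ∀ x ∈ U, ContMDiffAt 𝓘(ℂ, X.Model) 𝓘(ℂ, ℂ) ω g x :=
  ⟨fun h x hx => (h x hx).contMDiffAt (U.isOpen.mem_nhds hx), fun h x hx =>
    (h x hx).contMDiffWithinAt⟩

theorem IsHolomorphicOn.congr {g g' : X.Base → ℂ} (h : X.IsHolomorphicOn U g)
    (e : ∀ x ∈ U, g' x = g x) : X.IsHolomorphicOn U g' := ContMDiffOn.congr h e

theorem IsHolomorphicOn.mono {g : X.Base → ℂ} (h : X.IsHolomorphicOn U g) (hV : V ≤ U) :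
    X.IsHolomorphicOn V g := ContMDiffOn.mono h hV

theorem IsHolomorphicOn.const (c : ℂ) : X.IsHolomorphicOn U fun _ => c := contMDiffOn_const

theorem IsHolomorphicOn.add {g g' : X.Base → ℂ} (h : X.IsHolomorphicOn U g)
    (h' : X.IsHolomorphicOn U g') : X.IsHolomorphicOn U fun x => g x + g' x :=
  ContMDiffOn.add h h'

theorem IsHolomorphicOn.mul {g g' : X.Base → ℂ} (h : X.IsHolomorphicOn U g)
    (h' : X.IsHolomorphicOn U g') : X.IsHolomorphicOn U fun x => g x * g' x := by
  have h2 : ContDiff ℂ ω fun p : ℂ × ℂ => p.1 * p.2 := contDiff_mul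
  have h3 : ContMDiffOn 𝓘(ℂ, X.Model) 𝓘(ℂ, ℂ × ℂ) ω (fun x => (g x, g' x)) U :=
    ContMDiffOn.prodMk_space h h'
  exact h2.contMDiff.comp_contMDiffOn h3

theorem IsHolomorphicOn.sum {ι : Type*} (I : Finset ι) {g : ι → X.Base → ℂ}
    (h : ∀ i ∈ I, X.IsHolomorphicOn U (g i)) : X.IsHolomorphicOn U fun x => ∑ i ∈ I, g i x := by
  classical
  induction I using Finset.induction_on with
  | empty => simpa using IsHolomorphicOn.const 0
  | insert i I hi ih =>
    simp only [Finset.sum_insert hi]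
    exact (h i (by simp)).add (ih fun j hj => h j (by simp [hj]))

variable {φ : OpenPartialHomeomorph X.Base X.Model}

/-- Holomorphy at a point, read in a chart. -/
theorem contMDiffAt_iff_analyticAt (hφ : φ ∈ IsManifold.maximalAtlas 𝓘(ℂ, X.Model) ω X.Base)
    {g : X.Base → ℂ} {x : X.Base} (hx : x ∈ φ.source) :
    ContMDiffAt 𝓘(ℂ, X.Model) 𝓘(ℂ, ℂ) ω g x ↔ AnalyticAt ℂ (g ∘ φ.symm) (φ x) := by
  rw [← analyticWithinAt_univ, ← contDiffWithinAt_omega_iff_analyticWithinAt, contDiffWithinAt_univ,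
    ← contMDiffAt_iff_contDiffAt]
  constructor
  · intro h
    have h1 : ContMDiffAt 𝓘(ℂ, X.Model) 𝓘(ℂ, X.Model) ω φ.symm (φ x) :=
      (contMDiffOn_symm_of_mem_maximalAtlas hφ).contMDiffAt
        (φ.open_target.mem_nhds (φ.map_source hx))
    refine ContMDiffAt.comp (φ x) ?_ h1
    rwa [φ.left_inv hx]
  · intro h
    have h1 : ContMDiffAt 𝓘(ℂ, X.Model) 𝓘(ℂ, X.Model) ω φ x :=
      (contMDiffOn_of_mem_maximalAtlas hφ).contMDiffAt (φ.open_source.mem_nhds hx)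
    refine (h.comp x h1).congr_of_eventuallyEq ?_
    filter_upwards [φ.open_source.mem_nhds hx] with y hy
    simp [φ.left_inv hy]

/-- The derivative of a function in the direction of the constant vector field `v` of a chart. -/
def chartDeriv (φ : OpenPartialHomeomorph X.Base X.Model) (v : X.Model) (g : X.Base → ℂ)
    (x : X.Base) : ℂ := fderiv ℂ (g ∘ φ.symm) (φ x) v

theorem IsHolomorphicOn.chartDeriv (hφ : φ ∈ IsManifold.maximalAtlas 𝓘(ℂ, X.Model) ω X.Base)
    (hU : ∀ x ∈ U, x ∈ φ.source) (v : X.Model) {g : X.Base → ℂ} (hg : X.IsHolomorphicOn U g) :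
    X.IsHolomorphicOn U (chartDeriv φ v g) := by
  rw [isHolomorphicOn_iff] at *
  intro x hx
  rw [contMDiffAt_iff_analyticAt hφ (hU x hx)]
  have h1 := ((contMDiffAt_iff_analyticAt hφ (hU x hx)).1 (hg x hx)).fderiv
  have h2 : AnalyticAt ℂ (fun z => fderiv ℂ (g ∘ φ.symm) z v) (φ x) :=
    ((ContinuousLinearMap.apply ℂ ℂ v).analyticAt _).comp h1
  refine h2.congr ?_
  filter_upwards [φ.open_target.mem_nhds (φ.map_source (hU x hx))] with z hz
  simp [Supergeometry.chartDeriv, φ.right_inv hz]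

theorem IsHolomorphicOn.differentiableAt
    (hφ : φ ∈ IsManifold.maximalAtlas 𝓘(ℂ, X.Model) ω X.Base)
    {g : X.Base → ℂ} (hg : X.IsHolomorphicOn U g) {x : X.Base} (hx : x ∈ U) (hxφ : x ∈ φ.source) :
    DifferentiableAt ℂ (g ∘ φ.symm) (φ x) :=
  ((contMDiffAt_iff_analyticAt hφ hxφ).1 (isHolomorphicOn_iff.1 hg x hx)).differentiableAt

theorem chartDeriv_congr (v : X.Model) {g g' : X.Base → ℂ} {x : X.Base} (hx : x ∈ U)
    (hxφ : x ∈ φ.source) (h : ∀ y ∈ U, g y = g' y) :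
    Supergeometry.chartDeriv φ v g x = Supergeometry.chartDeriv φ v g' x := by
  have : g ∘ φ.symm =ᶠ[𝓝 (φ x)] g' ∘ φ.symm := by
    have hc : ContinuousAt φ.symm (φ x) := φ.continuousAt_symm (φ.map_source hxφ)
    filter_upwards [hc (U.isOpen.mem_nhds (by rwa [φ.left_inv hxφ]))] with z hz
    exact h _ hz
  rw [Supergeometry.chartDeriv, this.fderiv_eq, Supergeometry.chartDeriv]

end Holomorphic

/-! ### Local frames -/

section Frame

variable (x₀ : X.Base)

/-- The domain of the trivialization of the odd conormal bundle around `x₀`. -/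
def frameNbhd : Opens X.Base :=
  ⟨(trivializationAt X.Fiber X.Odd x₀).baseSet, (trivializationAt X.Fiber X.Odd x₀).open_baseSet⟩

theorem mem_frameNbhd : x₀ ∈ frameNbhd x₀ := FiberBundle.mem_baseSet_trivializationAt' x₀

/-- The exterior algebra of a fibre, read in the trivialization around `x₀`. -/
def toModel (x : X.Base) : ExteriorAlgebra ℂ (X.Odd x) →ₐ[ℂ] ExteriorAlgebra ℂ X.Fiber :=
  ExteriorAlgebra.map ((trivializationAt X.Fiber X.Odd x₀).linearMapAt ℂ x)

/-- The inverse of `toModel`. -/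
def ofModel (x : X.Base) : ExteriorAlgebra ℂ X.Fiber →ₐ[ℂ] ExteriorAlgebra ℂ (X.Odd x) :=
  ExteriorAlgebra.map ((trivializationAt X.Fiber X.Odd x₀).symmₗ ℂ x)

variable {x₀}

theorem toModel_ofModel {x : X.Base} (hx : x ∈ frameNbhd x₀) (w : ExteriorAlgebra ℂ X.Fiber) :
    toModel x₀ x (ofModel x₀ x w) = w := by
  have e : (trivializationAt X.Fiber X.Odd x₀).linearMapAt ℂ x ∘ₗ
      (trivializationAt X.Fiber X.Odd x₀).symmₗ ℂ x = LinearMap.id := LinearMap.ext fun v =>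
    Bundle.Trivialization.linearMapAt_symmₗ _ hx v
  rw [toModel, ofModel, ← AlgHom.comp_apply, ExteriorAlgebra.map_comp_map, e,
    ExteriorAlgebra.map_id, AlgHom.id_apply]

theorem ofModel_toModel {x : X.Base} (hx : x ∈ frameNbhd x₀) (w : ExteriorAlgebra ℂ (X.Odd x)) :
    ofModel x₀ x (toModel x₀ x w) = w := by
  have e : (trivializationAt X.Fiber X.Odd x₀).symmₗ ℂ x ∘ₗ
      (trivializationAt X.Fiber X.Odd x₀).linearMapAt ℂ x = LinearMap.id := LinearMap.ext fun v =>
    Bundle.Trivialization.symmₗ_linearMapAt _ hx v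
  rw [toModel, ofModel, ← AlgHom.comp_apply, ExteriorAlgebra.map_comp_map, e,
    ExteriorAlgebra.map_id, AlgHom.id_apply]

/-- The section over a subset of `frameNbhd x₀` that is constant in the trivialization. -/
def constSec (hV : V ≤ frameNbhd x₀) (w : ExteriorAlgebra ℂ X.Fiber) : X.sec V :=
  ⟨fun x => ofModel x₀ x w, by
    induction w using ExteriorAlgebra.induction with
    | algebraMap c =>
      convert (X.sec V).algebraMap_mem c using 1
      funext x
      simp
    | ι v =>
      have hσ : X.IsHolomorphicSectionOn V
          fun x => (trivializationAt X.Fiber X.Odd x₀).symmₗ ℂ x v := by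
        refine (Bundle.Trivialization.contMDiffOn_section_iff (trivializationAt X.Fiber X.Odd x₀)
          V.isOpen hV).2 ((contMDiffOn_const (c := v)).congr fun x hx => ?_)
        have := Bundle.Trivialization.linearMapAt_symmₗ
          (R := ℂ) (trivializationAt X.Fiber X.Odd x₀) (hV hx) v
        rwa [Bundle.Trivialization.coe_linearMapAt_of_mem _ (hV hx)] at this
      convert (ofOdd _ hσ).2 using 1
      funext x
      rw [ofModel, ExteriorAlgebra.map_apply_ι]
      rfl
    | mul a b ha hb =>
      convert (X.sec V).mul_mem ha hb using 1
      funext x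
      rw [map_mul]
      rfl
    | add a b ha hb =>
      convert (X.sec V).add_mem ha hb using 1
      funext x
      rw [map_add]
      rfl⟩

theorem constSec_apply (hV : V ≤ frameNbhd x₀) (w : ExteriorAlgebra ℂ X.Fiber) (x : V) :
    (constSec hV w).1 x = ofModel x₀ x w := rfl

theorem isHomogeneous_constSec (hV : V ≤ frameNbhd x₀) {n : ℕ} {w : ExteriorAlgebra ℂ X.Fiber}
    (hw : w ∈ ⋀[ℂ]^n X.Fiber) : IsHomogeneous n (constSec hV w) := fun x => by
  have := extProj_map ((trivializationAt X.Fiber X.Odd x₀).symmₗ ℂ x.1) n w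
  rw [extProj_same hw] at this
  rw [constSec_apply, ofModel, ← this]
  exact extProj_mem _ _

variable (x₀) in
open Classical in
/-- The value of a linear functional on a section, read in the trivialization around `x₀`; it is
extended by zero outside the domain of the section. -/
def coef (l : ExteriorAlgebra ℂ X.Fiber →ₗ[ℂ] ℂ) (s : X.sec V) (x : X.Base) : ℂ :=
  if h : x ∈ V then l (toModel x₀ x (s.1 ⟨x, h⟩)) else 0

theorem coef_of_mem (l : ExteriorAlgebra ℂ X.Fiber →ₗ[ℂ] ℂ) (s : X.sec V) {x : X.Base}
    (h : x ∈ V) : coef x₀ l s x = l (toModel x₀ x (s.1 ⟨x, h⟩)) := dif_pos h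

theorem coef_res (h : W ≤ V) (l : ExteriorAlgebra ℂ X.Fiber →ₗ[ℂ] ℂ) (s : X.sec V) {x : X.Base}
    (hx : x ∈ W) : coef x₀ l (res h s) x = coef x₀ l s x := by
  rw [coef_of_mem l _ hx, coef_of_mem l s (h hx)]
  rfl

theorem sec_eq_of_coef (hV : V ≤ frameNbhd x₀) {s t : X.sec V}
    (h : ∀ l, ∀ x ∈ V, coef x₀ l s x = coef x₀ l t x) : s = t := by
  refine sec_ext fun x => ?_
  rw [← ofModel_toModel (hV x.2) (s.1 x), ← ofModel_toModel (hV x.2) (t.1 x)]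
  congr 1
  refine (extBasis X.Fiber).ext_elem fun i => ?_
  have := h ((extBasis X.Fiber).coord i) x x.2
  rwa [coef_of_mem _ _ x.2, coef_of_mem _ _ x.2] at this

/-- Expansion of a product in the basis of the exterior algebra, in the first factor. -/
theorem apply_mul_eq_sum (l : ExteriorAlgebra ℂ X.Fiber →ₗ[ℂ] ℂ) (a b : ExteriorAlgebra ℂ X.Fiber) :
    l (a * b) = ∑ i, (extBasis X.Fiber).coord i a *
      (l ∘ₗ LinearMap.mulLeft ℂ (extBasis X.Fiber i)) b := by
  conv_lhs => rw [← (extBasis X.Fiber).sum_repr a]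
  rw [Finset.sum_mul, map_sum]
  refine Finset.sum_congr rfl fun i _ => ?_
  rw [smul_mul_assoc, map_smul]
  rfl

theorem coef_mul (l : ExteriorAlgebra ℂ X.Fiber →ₗ[ℂ] ℂ) (s t : X.sec V) (x : X.Base) :
    coef x₀ l (s * t) x = ∑ i, coef x₀ ((extBasis X.Fiber).coord i) s x *
      coef x₀ (l ∘ₗ LinearMap.mulLeft ℂ (extBasis X.Fiber i)) t x := by
  by_cases hx : x ∈ V
  · simp only [coef_of_mem _ _ hx]
    rw [← apply_mul_eq_sum, ← map_mul]
    rfl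
  · simp [coef, hx]

/-- The coefficients of sections in the frame are holomorphic. -/
theorem isHolomorphicOn_coef (hV : V ≤ frameNbhd x₀) (l : ExteriorAlgebra ℂ X.Fiber →ₗ[ℂ] ℂ)
    (s : X.sec V) : X.IsHolomorphicOn V (coef x₀ l s) := by
  let A : ∀ W : Opens X.Base, W ≤ V → Subalgebra ℂ (X.sec W) := fun W hW =>
    { carrier := {t | ∀ l, X.IsHolomorphicOn W (coef x₀ l t)}
      mul_mem' := fun {a b} ha hb l =>
        (IsHolomorphicOn.sum _ fun i _ => (ha _).mul (hb _)).congr fun x _ => coef_mul l a b x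
      add_mem' := fun {a b} ha hb l => ((ha l).add (hb l)).congr fun x hx => by
        simp only [coef_of_mem _ _ hx]
        rw [← map_add, ← map_add]
        rfl
      algebraMap_mem' := fun c l => (IsHolomorphicOn.const (l (algebraMap ℂ _ c))).congr
        fun x hx => by
          rw [coef_of_mem _ _ hx, ← (toModel x₀ x).commutes]
          rfl }
  rw [isHolomorphicOn_iff]
  intro x hx
  obtain ⟨W, hxW, hW, h⟩ := exists_nbhd_of_subalgebra s x hx A
    (fun W hW g hg l => (hg.mul (IsHolomorphicOn.const (l 1))).congr fun x hx => by
      rw [coef_of_mem _ _ hx, ofHol_apply, AlgHom.commutes, Algebra.algebraMap_eq_smul_one,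
        map_smul, smul_eq_mul])
    (fun W hW σ hσ l => by
      have h1 := (Bundle.Trivialization.contMDiffOn_section_iff
        (trivializationAt X.Fiber X.Odd x₀) W.isOpen (hW.trans hV)).1 hσ
      let L : X.Fiber →L[ℂ] ℂ := LinearMap.toContinuousLinearMap (l ∘ₗ ExteriorAlgebra.ι ℂ)
      refine (L.contMDiff.comp_contMDiffOn h1).congr fun x hx => ?_
      rw [coef_of_mem _ _ hx]
      change l (toModel x₀ x (ExteriorAlgebra.ι ℂ (σ x))) = _
      rw [toModel, ExteriorAlgebra.map_apply_ι,
        Bundle.Trivialization.coe_linearMapAt_of_mem _ (hV (hW hx))]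
      rfl)
  have h2 : X.IsHolomorphicOn W (coef x₀ l s) :=
    (h l).congr fun x hx => (coef_res hW l s hx).symm
  exact isHolomorphicOn_iff.1 h2 x hxW

/-- A coefficient of a section, as a section of degree zero. -/
def coefSec (hV : V ≤ frameNbhd x₀) (l : ExteriorAlgebra ℂ X.Fiber →ₗ[ℂ] ℂ) (s : X.sec V) :
    X.sec V := ofHol (coef x₀ l s) (isHolomorphicOn_coef hV l s)

theorem ofHol_mul_apply {g : X.Base → ℂ} (hg : X.IsHolomorphicOn V g) (t : X.sec V) (x : V) :
    (ofHol g hg * t).1 x = g x • t.1 x := by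
  change algebraMap ℂ _ (g x) * t.1 x = _
  rw [Algebra.smul_def]

/-- The expansion of a section in the frame. -/
theorem sum_coefSec_mul (hV : V ≤ frameNbhd x₀) (s : X.sec V) :
    ∑ i, coefSec hV ((extBasis X.Fiber).coord i) s * constSec hV (extBasis X.Fiber i) = s := by
  refine sec_ext fun x => ?_
  conv_rhs => rw [← ofModel_toModel (hV x.2) (s.1 x),
    ← (extBasis X.Fiber).sum_repr (toModel x₀ x (s.1 x)), map_sum]
  rw [coe_sum]
  refine Finset.sum_congr rfl fun i _ => ?_
  rw [coefSec, ofHol_mul_apply, coef_of_mem _ _ x.2, map_smul]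
  rfl

/-- A section in the top power of the fermionic ideal is a multiple of the section of top degree
of the frame. -/
theorem eq_coefSec_mul_of_mem_ferm_rank (hV : V ≤ frameNbhd x₀) {s : X.sec V}
    (hs : s ∈ X.ferm X.rank V) :
    s = coefSec hV ((extBasis X.Fiber).coord Finset.univ) s *
      constSec hV (extBasis X.Fiber Finset.univ) := by
  have hp : proj X.rank s = s := by
    conv_rhs => rw [← sum_proj s]
    rw [Finset.sum_eq_single X.rank]
    · intro j hj hne
      exact mem_ferm_iff.1 hs j (by have := Finset.mem_range.1 hj; omega)
    · simp
  refine sec_ext fun x => ?_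
  rw [coefSec, ofHol_mul_apply, coef_of_mem _ _ x.2, constSec_apply, ← map_smul,
    ← extProj_finrank_eq, toModel, extProj_map]
  change _ = ofModel x₀ x (toModel x₀ x ((proj X.rank s).1 x))
  rw [hp, ofModel_toModel (hV x.2)]

theorem ofModel_ne_zero {x : X.Base} (hx : x ∈ frameNbhd x₀) {w : ExteriorAlgebra ℂ X.Fiber}
    (hw : w ≠ 0) : ofModel x₀ x w ≠ 0 := by
  intro h
  apply hw
  rw [← toModel_ofModel hx w, h, map_zero]

/-! ### Derivations given by charts and frames -/

variable {φ : OpenPartialHomeomorph X.Base X.Model}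

theorem isHolomorphicOn_chartDeriv_coef
    (hφ : φ ∈ IsManifold.maximalAtlas 𝓘(ℂ, X.Model) ω X.Base) (hV : V ≤ frameNbhd x₀)
    (hVφ : ∀ x ∈ V, x ∈ φ.source) (v : X.Model) (l : ExteriorAlgebra ℂ X.Fiber →ₗ[ℂ] ℂ)
    (s : X.sec V) : X.IsHolomorphicOn V (chartDeriv φ v (coef x₀ l s)) :=
  (isHolomorphicOn_coef hV l s).chartDeriv hφ hVφ v

/-- The derivative of the coefficients of a section in the direction of a constant vector field of
a chart. -/
def frameDeriv (hφ : φ ∈ IsManifold.maximalAtlas 𝓘(ℂ, X.Model) ω X.Base) (hV : V ≤ frameNbhd x₀)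
    (hVφ : ∀ x ∈ V, x ∈ φ.source) (v : X.Model) (s : X.sec V) : X.sec V :=
  ∑ i, ofHol _ (isHolomorphicOn_chartDeriv_coef hφ hV hVφ v ((extBasis X.Fiber).coord i) s) *
    constSec hV (extBasis X.Fiber i)

theorem coef_frameDeriv (hφ : φ ∈ IsManifold.maximalAtlas 𝓘(ℂ, X.Model) ω X.Base)
    (hV : V ≤ frameNbhd x₀) (hVφ : ∀ x ∈ V, x ∈ φ.source) (v : X.Model)
    (l : ExteriorAlgebra ℂ X.Fiber →ₗ[ℂ] ℂ) (s : X.sec V) {x : X.Base} (hx : x ∈ V) :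
    coef x₀ l (frameDeriv hφ hV hVφ v s) x = chartDeriv φ v (coef x₀ l s) x := by
  have e1 : coef x₀ l s =
      fun x => ∑ i, coef x₀ ((extBasis X.Fiber).coord i) s x * l (extBasis X.Fiber i) := by
    funext y
    by_cases hy : y ∈ V
    · simp only [coef_of_mem _ _ hy]
      conv_lhs => rw [← (extBasis X.Fiber).sum_repr (toModel x₀ y (s.1 ⟨y, hy⟩)), map_sum]
      simp
    · simp [coef, hy]
  have e2 : chartDeriv φ v (coef x₀ l s) x = ∑ i,
      chartDeriv φ v (coef x₀ ((extBasis X.Fiber).coord i) s) x * l (extBasis X.Fiber i) := by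
    rw [e1, chartDeriv]
    have hd := fun i => (isHolomorphicOn_coef hV ((extBasis X.Fiber).coord i) s).differentiableAt
      hφ hx (hVφ x hx)
    change fderiv ℂ (fun z => ∑ i, (coef x₀ ((extBasis X.Fiber).coord i) s ∘ φ.symm) z *
      l (extBasis X.Fiber i)) (φ x) v = _
    rw [fderiv_fun_sum fun i _ => (hd i).mul_const _]
    simp only [sum_apply]
    refine Finset.sum_congr rfl fun i _ => ?_
    rw [fderiv_mul_const (hd i)]
    simp [chartDeriv, mul_comm]
  rw [e2, coef_of_mem _ _ hx, frameDeriv, coe_sum, map_sum, map_sum]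
  refine Finset.sum_congr rfl fun i _ => ?_
  rw [ofHol_mul_apply, map_smul, map_smul, constSec_apply, toModel_ofModel (hV hx), smul_eq_mul]

end Frame

end Supergeometry

namespace Supergeometry

variable {X Y : Supergeometry.{u}} {U V W : Opens X.Base}

section Derivation

variable {x₀ : X.Base} {φ : OpenPartialHomeomorph X.Base X.Model}

/-- The derivation of degree zero given by a constant vector field of a chart and a local frame: it
is the vector field on the coefficients and vanishes on the frame. -/
def frameDerivation (hφ : φ ∈ IsManifold.maximalAtlas 𝓘(ℂ, X.Model) ω X.Base)
    (hU : U ≤ frameNbhd x₀) (hUφ : ∀ x ∈ U, x ∈ φ.source) (v : X.Model) :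
    GradedDerivation X U 0 where
  app V hV :=
    { toFun := frameDeriv hφ (hV.trans hU) (fun x hx => hUφ x (hV hx)) v
      map_add' := fun s t => by
        refine sec_eq_of_coef (hV.trans hU) fun l x hx => ?_
        have hd := fun s : X.sec V => (isHolomorphicOn_coef (hV.trans hU) l s).differentiableAt
          hφ hx (hUφ x (hV hx))
        have e : coef x₀ l (s + t) = coef x₀ l s + coef x₀ l t := by
          funext y
          by_cases hy : y ∈ V
          · simp only [Pi.add_apply, coef_of_mem _ _ hy, ← map_add]
            rfl
          · simp [coef, hy]
        have e2 : coef x₀ l (frameDeriv hφ (hV.trans hU) (fun x hx => hUφ x (hV hx)) v s +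
            frameDeriv hφ (hV.trans hU) (fun x hx => hUφ x (hV hx)) v t) x =
            coef x₀ l (frameDeriv hφ (hV.trans hU) (fun x hx => hUφ x (hV hx)) v s) x +
            coef x₀ l (frameDeriv hφ (hV.trans hU) (fun x hx => hUφ x (hV hx)) v t) x := by
          simp only [coef_of_mem _ _ hx, ← map_add]
          rfl
        rw [e2, coef_frameDeriv _ _ _ _ _ _ hx, coef_frameDeriv _ _ _ _ _ _ hx,
          coef_frameDeriv _ _ _ _ _ _ hx, e, chartDeriv, chartDeriv, chartDeriv]
        change fderiv ℂ (coef x₀ l s ∘ φ.symm + coef x₀ l t ∘ φ.symm) (φ x) v = _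
        rw [fderiv_add (hd s) (hd t)]
        rfl
      map_smul' := fun c s => by
        refine sec_eq_of_coef (hV.trans hU) fun l x hx => ?_
        have hd := fun s : X.sec V => (isHolomorphicOn_coef (hV.trans hU) l s).differentiableAt
          hφ hx (hUφ x (hV hx))
        have e : coef x₀ l (c • s) = c • coef x₀ l s := by
          funext y
          by_cases hy : y ∈ V
          · simp only [Pi.smul_apply, coef_of_mem _ _ hy, ← map_smul]
            rfl
          · simp [coef, hy]
        have e2 : coef x₀ l (c • frameDeriv hφ (hV.trans hU) (fun x hx => hUφ x (hV hx)) v s) x =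
            c • coef x₀ l (frameDeriv hφ (hV.trans hU) (fun x hx => hUφ x (hV hx)) v s) x := by
          simp only [coef_of_mem _ _ hx, ← map_smul]
          rfl
        rw [RingHom.id_apply, e2, coef_frameDeriv _ _ _ _ _ _ hx, coef_frameDeriv _ _ _ _ _ _ hx,
          e, chartDeriv, chartDeriv]
        change fderiv ℂ (c • (coef x₀ l s ∘ φ.symm)) (φ x) v = _
        rw [fderiv_const_smul (hd s)]
        rfl }
  app_res V V' hV h s := by
    refine sec_eq_of_coef (h.trans (hV.trans hU)) fun l x hx => ?_
    change coef x₀ l (frameDeriv hφ (h.trans (hV.trans hU)) (fun x hx => hUφ x (hV (h hx))) v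
      (res h s)) x =
        coef x₀ l (res h (frameDeriv hφ (hV.trans hU) (fun x hx => hUφ x (hV hx)) v s)) x
    rw [coef_res h _ _ hx, coef_frameDeriv _ _ _ _ _ _ hx, coef_frameDeriv _ _ _ _ _ _ (h hx)]
    exact chartDeriv_congr v hx (hUφ x (hV (h hx))) fun y hy => coef_res h l s hy
  leibniz V hV s t := by
    refine sec_eq_of_coef (hV.trans hU) fun l x hx => ?_
    change coef x₀ l (frameDeriv hφ (hV.trans hU) (fun x hx => hUφ x (hV hx)) v (s * t)) x =
      coef x₀ l (s * frameDeriv hφ (hV.trans hU) (fun x hx => hUφ x (hV hx)) v t +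
        frameDeriv hφ (hV.trans hU) (fun x hx => hUφ x (hV hx)) v s * t) x
    have e2 : ∀ a b : X.sec V, coef x₀ l (a + b) x = coef x₀ l a x + coef x₀ l b x := by
      intro a b
      simp only [coef_of_mem _ _ hx, ← map_add]
      rfl
    rw [e2, coef_mul, coef_mul, coef_frameDeriv _ _ _ _ _ _ hx]
    simp only [coef_frameDeriv _ _ _ _ _ _ hx]
    rw [show coef x₀ l (s * t) = _ from funext fun y => coef_mul l s t y, chartDeriv]
    have hd := fun l (s : X.sec V) =>
      (isHolomorphicOn_coef (hV.trans hU) l s).differentiableAt hφ hx (hUφ x (hV hx))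
    change fderiv ℂ (fun z => ∑ i, (coef x₀ ((extBasis X.Fiber).coord i) s ∘ φ.symm) z *
      (coef x₀ (l ∘ₗ LinearMap.mulLeft ℂ (extBasis X.Fiber i)) t ∘ φ.symm) z) (φ x) v = _
    rw [fderiv_fun_sum fun i _ => (hd _ s).fun_mul (hd _ t), sum_apply, ← Finset.sum_add_distrib]
    refine Finset.sum_congr rfl fun i _ => ?_
    rw [fderiv_fun_mul (hd _ s) (hd _ t)]
    simp only [add_apply, smul_apply, smul_eq_mul, Function.comp_apply,
      φ.left_inv (hUφ x (hV hx)), chartDeriv]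
    ring
  homogeneous V hV n s hs := by
    have hne : ∀ i, i ≠ n → proj i (frameDeriv hφ (hV.trans hU) (fun x hx => hUφ x (hV hx)) v s) =
        0 := by
      intro i hi
      have hproj : ∀ l (t : X.sec V), ∀ y ∈ V, coef x₀ l (proj i t) y =
          coef x₀ (l ∘ₗ extProj i) t y := by
        intro l t y hy
        rw [coef_of_mem _ _ hy, coef_of_mem _ _ hy, LinearMap.comp_apply, toModel, extProj_map]
        rfl
      refine sec_eq_of_coef (hV.trans hU) fun l x hx => ?_
      rw [hproj l _ x hx, coef_frameDeriv _ _ _ _ _ _ hx,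
        chartDeriv_congr v hx (hUφ x (hV hx)) (g' := fun _ => 0), coef_of_mem _ _ hx, chartDeriv]
      · change fderiv ℂ (fun _ => (0 : ℂ)) (φ x) v = _
        rw [fderiv_const_apply]
        exact (map_zero (l ∘ₗ (toModel x₀ x).toLinearMap)).symm
      · intro y hy
        rw [← hproj l s y hy, hs.proj_eq, if_neg hi, coef_of_mem _ _ hy]
        exact map_zero (l ∘ₗ (toModel x₀ y).toLinearMap)
    change IsHomogeneous n (frameDeriv hφ (hV.trans hU) (fun x hx => hUφ x (hV hx)) v s)
    have : proj n (frameDeriv hφ (hV.trans hU) (fun x hx => hUφ x (hV hx)) v s) =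
        frameDeriv hφ (hV.trans hU) (fun x hx => hUφ x (hV hx)) v s := by
      refine sec_eq_of_proj fun j => ?_
      rw [proj_proj]
      split_ifs with h
      · rw [h]
      · exact (hne j h).symm
    rw [← this]
    exact isHomogeneous_proj _ _

theorem frameDerivation_ofHol (hφ : φ ∈ IsManifold.maximalAtlas 𝓘(ℂ, X.Model) ω X.Base)
    (hU : U ≤ frameNbhd x₀) (hUφ : ∀ x ∈ U, x ∈ φ.source) (v : X.Model) (hV : V ≤ U)
    {g : X.Base → ℂ} (hg : X.IsHolomorphicOn V g) :
    (frameDerivation hφ hU hUφ v).app V hV (ofHol g hg) =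
      ofHol _ (hg.chartDeriv hφ (fun x hx => hUφ x (hV hx)) v) := by
  refine sec_eq_of_coef (hV.trans hU) fun l x hx => ?_
  have e : ∀ g (hg : X.IsHolomorphicOn V g), ∀ y ∈ V, coef x₀ l (ofHol g hg) y = g y * l 1 := by
    intro g hg y hy
    rw [coef_of_mem _ _ hy, ofHol_apply, AlgHom.commutes, Algebra.algebraMap_eq_smul_one, map_smul,
      smul_eq_mul]
  have h1 := coef_frameDeriv hφ (hV.trans hU) (fun x hx => hUφ x (hV hx)) v l (ofHol g hg) hx
  refine h1.trans ?_
  rw [e _ _ x hx, chartDeriv_congr v hx (hUφ x (hV hx)) (e g hg), chartDeriv]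
  change fderiv ℂ (fun z => (g ∘ φ.symm) z * l 1) (φ x) v = _
  rw [fderiv_mul_const (hg.differentiableAt hφ hx (hUφ x (hV hx)))]
  simp [chartDeriv, mul_comm]

end Derivation

/-! ### The ideal sheaf of the embedding -/

namespace Embedding

variable {f : Embedding Y X}

/-- The ideal sheaf of an even embedding consists of the sections that vanish at the points of
`Y`. -/
theorem mem_splitIdeal_iff (hf : f.IsEven) {s : X.sec U} :
    s ∈ f.splitIdeal U ↔ ∀ y (hy : f.toFun y ∈ U), s.1 ⟨f.toFun y, hy⟩ = 0 := by
  have key : ∀ y : f.preim U, f.pull y s = 0 ↔ s.1 ⟨f.toFun y, y.2⟩ = 0 := fun y =>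
    map_eq_zero_iff (ExteriorAlgebra.map (f.odd y))
      (ExteriorAlgebra.map_injective_field (LinearMap.ker_eq_bot.2 (hf y).1))
  exact ⟨fun h y hy => (key ⟨y, hy⟩).1 (h ⟨y, hy⟩), fun h y => (key y).2 (h y y.2)⟩

theorem mul_mem_splitIdeal_left {s : X.sec U} (t : X.sec U) (hs : s ∈ f.splitIdeal U) :
    t * s ∈ f.splitIdeal U := Ideal.mul_mem_left _ t hs

theorem mul_mem_splitIdeal_right {s : X.sec U} (t : X.sec U) (hs : s ∈ f.splitIdeal U) :
    s * t ∈ f.splitIdeal U := fun y => by rw [map_mul, hs y, zero_mul]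

theorem mem_splitIdeal_local {s : X.sec U}
    (h : ∀ x ∈ U, ∃ (V : Opens X.Base) (_ : x ∈ V) (hV : V ≤ U), res hV s ∈ f.splitIdeal V) :
    s ∈ f.splitIdeal U := by
  intro y
  obtain ⟨V, hx, hV, e⟩ := h _ y.2
  exact e ⟨y, hx⟩

theorem proj_mem_splitIdeal (hf : f.IsEven) {s : X.sec U} (hs : s ∈ f.splitIdeal U) (j : ℕ) :
    proj j s ∈ f.splitIdeal U := by
  rw [mem_splitIdeal_iff hf] at *
  intro y hy
  change extProj j (s.1 _) = 0
  rw [hs y hy, map_zero]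

/-! ### Coordinates adapted to the submanifold -/

variable (f) in
/-- Functions on an open set that generate the ideal of the submanifold, with derivations of degree
zero that are dual to them. They come from the coordinates of a chart in which the submanifold is
linear, and from a local frame of the odd conormal bundle. -/
structure AdaptedCoordinates (U : Opens X.Base) where
  /-- The number of coordinates, the codimension of `Y`. -/
  codim : ℕ
  coord : Fin codim → X.sec U
  isHomogeneous_coord : ∀ i, IsHomogeneous 0 (coord i)
  coord_mem : ∀ i, coord i ∈ f.splitIdeal U
  deriv : Fin codim → GradedDerivation X U 0
  deriv_coord : ∀ i j V (hV : V ≤ U), (deriv i).app V hV (res hV (coord j)) = if i = j then 1 else 0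
  exists_eq_sum : ∀ V (hV : V ≤ U), ∀ s ∈ f.splitIdeal V, ∀ x ∈ V,
    ∃ (W : Opens X.Base) (_ : x ∈ W) (h : W ≤ V) (c : Fin codim → X.sec W),
      res h s = ∑ i, c i * res (h.trans hV) (coord i)

/-- An immersion has a chart of the target around each image point, in which a neighbourhood in
the image is the common zero set of linear forms that belong to a dual basis. -/
theorem exists_chart (f : Embedding Y X) (y₀ : Y.Base) :
    ∃ φ ∈ IsManifold.maximalAtlas 𝓘(ℂ, X.Model) ω X.Base, ∃ (U : Opens X.Base) (d : ℕ)
      (ℓ : Fin d → X.Model →L[ℂ] ℂ) (v : Fin d → X.Model),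
      f.toFun y₀ ∈ U ∧ (∀ x ∈ U, x ∈ φ.source) ∧
      (∀ i j, ℓ i (v j) = if i = j then 1 else 0) ∧
      ∀ x ∈ U, x ∈ Set.range f.toFun ↔ ∀ i, ℓ i (φ x) = 0 := by
  have h := f.isSmoothEmbedding.isImmersion.isImmersionAt y₀
  obtain ⟨O, hO, hOe⟩ := f.isSmoothEmbedding.isEmbedding.isInducing.isOpen_iff.1
    h.domChart.open_source
  have hwr : ∀ y ∈ h.domChart.source,
      h.codChart (f.toFun y) = h.equiv (h.domChart y, 0) := by
    intro y hy
    have hm : h.domChart y ∈ (h.domChart.extend 𝓘(ℂ, Y.Model)).target := by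
      rw [OpenPartialHomeomorph.extend_target]
      simpa using h.domChart.map_source hy
    have := h.writtenInCharts hm
    simp only [Function.comp_apply, OpenPartialHomeomorph.extend_coe,
      OpenPartialHomeomorph.extend_coe_symm, modelWithCornersSelf_coe,
      modelWithCornersSelf_coe_symm, id_eq, h.domChart.left_inv hy] at this
    exact this
  have hfin : FiniteDimensional ℂ h.complement :=
    FiniteDimensional.of_injective (h.equiv.toLinearMap ∘ₗ LinearMap.inr ℂ Y.Model h.complement)
      (h.equiv.injective.comp LinearMap.inr_injective)
  let b := Module.finBasis ℂ h.complement
  have hT : IsOpen (h.codChart.source ∩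
      h.codChart ⁻¹' {z | (h.equiv.symm z).1 ∈ h.domChart.target}) :=
    h.codChart.isOpen_inter_preimage (h.domChart.open_target.preimage (by fun_prop))
  refine ⟨h.codChart, h.codChart_mem_maximalAtlas,
    ⟨O ∩ _, hO.inter hT⟩, Module.finrank ℂ h.complement,
    fun i => (LinearMap.toContinuousLinearMap (b.coord i)) ∘L
      (ContinuousLinearMap.snd ℂ Y.Model h.complement) ∘L (h.equiv.symm : X.Model →L[ℂ] _),
    fun i => h.equiv (0, b i), ?_, fun x hx => hx.2.1, fun i j => ?_, fun x hx => ⟨?_, ?_⟩⟩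
  · refine ⟨?_, h.mem_codChart_source, ?_⟩
    · change y₀ ∈ f.toFun ⁻¹' O
      rw [hOe]
      exact h.mem_domChart_source
    · change (h.equiv.symm (h.codChart (f.toFun y₀))).1 ∈ h.domChart.target
      rw [hwr _ h.mem_domChart_source]
      simpa using h.domChart.map_source h.mem_domChart_source
  · simp [Finsupp.single_apply, eq_comm]
  · rintro ⟨y, rfl⟩ i
    have hy : y ∈ h.domChart.source := hOe ▸ (show y ∈ f.toFun ⁻¹' O from hx.1)
    simp [hwr y hy]
  · intro hz
    have h0 : (h.equiv.symm (h.codChart x)).2 = 0 :=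
      b.ext_elem fun i => by simpa using hz i
    have hu : (h.equiv.symm (h.codChart x)).1 ∈ h.domChart.target := hx.2.2
    refine ⟨h.domChart.symm (h.equiv.symm (h.codChart x)).1, ?_⟩
    have hs := h.domChart.map_target hu
    refine h.codChart.injOn (h.source_subset_preimage_source hs) hx.2.1 ?_
    rw [hwr _ hs, h.domChart.right_inv hu, ← h0]
    simp

end Embedding

end Supergeometry

namespace Supergeometry

variable {X Y : Supergeometry.{u}} {U V W : Opens X.Base}

namespace Embedding

variable {f : Embedding Y X}

open Filter Topology

theorem apply_eq_zero_of_mem_range (hf : f.IsEven) {s : X.sec V} (hs : s ∈ f.splitIdeal V)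
    {x : V} (hx : x.1 ∈ Set.range f.toFun) : s.1 x = 0 := by
  obtain ⟨x, hxV⟩ := x
  obtain ⟨y, rfl⟩ := hx
  exact (mem_splitIdeal_iff hf).1 hs y hxV

section

variable {φ : OpenPartialHomeomorph X.Base X.Model}

theorem comp_symm_eventuallyEq {x : X.Base} (hx : x ∈ φ.source) (ℓ : X.Model → ℂ) :
    (fun y => ℓ (φ y)) ∘ φ.symm =ᶠ[𝓝 (φ x)] ℓ := by
  filter_upwards [φ.open_target.mem_nhds (φ.map_source hx)] with z hz
  simp [φ.right_inv hz]

theorem isHolomorphicOn_comp_chart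
    (hφ : φ ∈ IsManifold.maximalAtlas 𝓘(ℂ, X.Model) ω X.Base) (hUφ : ∀ x ∈ U, x ∈ φ.source)
    {h : X.Model → ℂ} (hh : ∀ x ∈ U, AnalyticAt ℂ h (φ x)) :
    X.IsHolomorphicOn U fun x => h (φ x) := by
  rw [isHolomorphicOn_iff]
  intro x hx
  rw [contMDiffAt_iff_analyticAt hφ (hUφ x hx)]
  exact (hh x hx).congr (comp_symm_eventuallyEq (hUφ x hx) h).symm

/-- Hadamard's lemma for sections of the sheaf of exterior algebras. -/
theorem exists_eq_sum_coord (hf : f.IsEven) {x₀ : X.Base} {d : ℕ} {ℓ : Fin d → X.Model →L[ℂ] ℂ}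
    {v : Fin d → X.Model} (hφ : φ ∈ IsManifold.maximalAtlas 𝓘(ℂ, X.Model) ω X.Base)
    (hUφ : ∀ x ∈ U, x ∈ φ.source) (hU : U ≤ frameNbhd x₀)
    (hℓ : ∀ i j, ℓ i (v j) = if i = j then 1 else 0)
    (hY : ∀ x ∈ U, x ∈ Set.range f.toFun ↔ ∀ i, ℓ i (φ x) = 0)
    (hg : ∀ i, X.IsHolomorphicOn U fun x => ℓ i (φ x)) (hV : V ≤ U) {s : X.sec V}
    (hs : s ∈ f.splitIdeal V) {x : X.Base} (hx : x ∈ V) :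
    ∃ (W : Opens X.Base) (_ : x ∈ W) (h : W ≤ V) (c : Fin d → X.sec W),
      res h s = ∑ i, c i * res (h.trans hV) (ofHol _ (hg i)) := by
  classical
  by_cases hxY : x ∈ Set.range f.toFun
  · -- at a point of `Y`, the coefficients of the section vanish on `Y`
    have hz0 := (hY x (hV hx)).1 hxY
    have hc : ContinuousAt φ.symm (φ x) := φ.continuousAt_symm (φ.map_source (hUφ x (hV hx)))
    have key : ∀ J : Finset (Fin X.rank), ∃ h : Fin d → X.Model → ℂ,
        (∀ i, AnalyticAt ℂ (h i) (φ x)) ∧ ∀ᶠ z in 𝓝 (φ x),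
          (coef x₀ ((extBasis X.Fiber).coord J) s ∘ φ.symm) z = ∑ i, ℓ i z * h i z := by
      intro J
      refine AnalyticAt.exists_eq_sum_mul ℓ v hℓ ?_ hz0 ?_
      · exact (contMDiffAt_iff_analyticAt hφ (hUφ x (hV hx))).1
          (isHolomorphicOn_iff.1 (isHolomorphicOn_coef (hV.trans hU) _ s) x hx)
      · filter_upwards [φ.open_target.mem_nhds (φ.map_source (hUφ x (hV hx))),
          hc (V.isOpen.mem_nhds (by rwa [φ.left_inv (hUφ x (hV hx))]))] with z hz hzV hz'
        obtain ⟨y, hy⟩ := (hY (φ.symm z) (hV hzV)).2 fun i => by rw [φ.right_inv hz]; exact hz' i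
        have hzV' : φ.symm z ∈ V := hzV
        rw [Function.comp_apply, coef_of_mem _ _ hzV']
        rw [apply_eq_zero_of_mem_range hf hs ⟨y, hy⟩, map_zero, map_zero]
    choose h hh he using key
    have hev : ∀ᶠ y in 𝓝 x, y ∈ V ∧ ∀ J, (∀ i, AnalyticAt ℂ (h J i) (φ y)) ∧
        coef x₀ ((extBasis X.Fiber).coord J) s y = ∑ i, ℓ i (φ y) * h J i (φ y) := by
      have hφc : ContinuousAt φ x := φ.continuousAt (hUφ x (hV hx))
      have hVx : ∀ᶠ y in 𝓝 x, y ∈ V := V.isOpen.mem_nhds hx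
      refine hVx.and (eventually_all.2 fun J => ?_)
      refine (eventually_all.2 fun i => hφc.eventually (hh J i).eventually_analyticAt).and ?_
      filter_upwards [hφc.eventually (he J), φ.open_source.mem_nhds (hUφ x (hV hx))] with y hy hys
      rw [← hy, Function.comp_apply, φ.left_inv hys]
    obtain ⟨O, hO, hOo, hxO⟩ := eventually_nhds_iff.1 hev
    have hOV : (⟨O, hOo⟩ : Opens X.Base) ≤ V := fun y hy => (hO y hy).1
    have hhol : ∀ J i, X.IsHolomorphicOn ⟨O, hOo⟩ fun y => h J i (φ y) := fun J i =>
      isHolomorphicOn_comp_chart hφ (fun y hy => hUφ y (hV (hOV hy)))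
        fun y hy => ((hO y hy).2 J).1 i
    refine ⟨⟨O, hOo⟩, hxO, hOV, fun i => ∑ J, ofHol _ (hhol J i) *
      constSec ((hOV.trans hV).trans hU) (extBasis X.Fiber J), sec_ext fun y => ?_⟩
    rw [← sum_coefSec_mul (hV.trans hU) s, map_sum, coe_sum, coe_sum]
    have e1 : ∀ i, ((∑ J, ofHol _ (hhol J i) *
        constSec ((hOV.trans hV).trans hU) (extBasis X.Fiber J)) *
        res (hOV.trans hV) (ofHol _ (hg i)) : X.sec ⟨O, hOo⟩).1 y =
        ∑ J, (ℓ i (φ y) * h J i (φ y)) • ofModel x₀ y (extBasis X.Fiber J) := by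
      intro i
      rw [← ((isHomogeneous_ofHol _ (hg i)).res (hOV.trans hV)).commute Even.zero]
      change (ofHol _ ((hg i).mono (hOV.trans hV)) * _ : X.sec ⟨O, hOo⟩).1 y = _
      rw [ofHol_mul_apply, coe_sum, Finset.smul_sum]
      refine Finset.sum_congr rfl fun J _ => ?_
      rw [ofHol_mul_apply, smul_smul]
      rfl
    simp only [e1]
    rw [Finset.sum_comm]
    refine Finset.sum_congr rfl fun J _ => ?_
    rw [← Finset.sum_smul, ← ((hO y y.2).2 J).2, map_mul]
    exact ofHol_mul_apply ((isHolomorphicOn_coef (hV.trans hU) _ s).mono hOV) _ y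
  · -- away from `Y`, some coordinate is invertible
    obtain ⟨i, hi⟩ : ∃ i, ℓ i (φ x) ≠ 0 := by
      by_contra! h
      exact hxY ((hY x (hV hx)).2 h)
    have hcont : ContinuousAt (fun y => ℓ i (φ y)) x :=
      ((ℓ i).continuous.continuousAt).comp (φ.continuousAt (hUφ x (hV hx)))
    obtain ⟨O, hO, hOo, hxO⟩ := eventually_nhds_iff.1
      ((hcont.eventually_ne hi).and (V.isOpen.mem_nhds hx))
    have hOV : (⟨O, hOo⟩ : Opens X.Base) ≤ V := fun y hy => (hO y hy).2
    have hinv : X.IsHolomorphicOn ⟨O, hOo⟩ fun y => (ℓ i (φ y))⁻¹ :=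
      isHolomorphicOn_comp_chart (h := fun z => (ℓ i z)⁻¹) hφ (fun y hy => hUφ y (hV (hOV hy)))
        fun y hy => ((ℓ i).analyticAt _).inv (hO y hy).1
    refine ⟨⟨O, hOo⟩, hxO, hOV, fun j => if j = i then ofHol _ hinv * res hOV s else 0, ?_⟩
    rw [Finset.sum_eq_single i]
    · dsimp only
      rw [if_pos rfl, ← ((isHomogeneous_ofHol _ (hg i)).res (hOV.trans hV)).commute Even.zero]
      refine sec_ext fun y => ?_
      have h1 := ofHol_mul_apply ((hg i).mono (hOV.trans hV)) (ofHol _ hinv * res hOV s) y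
      refine Eq.trans ?_ h1.symm
      rw [ofHol_mul_apply, smul_smul, mul_inv_cancel₀ (hO y y.2).1, one_smul]
    · intro j _ hj
      dsimp only
      rw [if_neg hj, zero_mul]
    · simp

end

/-- The coordinates are the linear forms of a chart in which `Y` is linear; they generate the ideal
by Hadamard's lemma. -/
theorem exists_adaptedCoordinates (hf : f.IsEven) (y₀ : Y.Base) (O : Opens X.Base)
    (hO : f.toFun y₀ ∈ O) :
    ∃ U : Opens X.Base, f.toFun y₀ ∈ U ∧ U ≤ O ∧ U ≤ frameNbhd (f.toFun y₀) ∧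
      Nonempty (f.AdaptedCoordinates U) := by
  obtain ⟨φ, hφ, U, d, ℓ, v, hyU, hUφ, hℓ, hY⟩ := exists_chart f y₀
  let U' := U ⊓ (frameNbhd (f.toFun y₀) ⊓ O)
  have h1 : U' ≤ U := inf_le_left
  have h2 : U' ≤ frameNbhd (f.toFun y₀) := inf_le_right.trans inf_le_left
  have hU'φ : ∀ x ∈ U', x ∈ φ.source := fun x hx => hUφ x (h1 hx)
  have hg : ∀ i, X.IsHolomorphicOn U' fun x => ℓ i (φ x) := fun i =>
    isHolomorphicOn_comp_chart hφ hU'φ fun x _ => (ℓ i).analyticAt _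
  refine ⟨U', ⟨hyU, mem_frameNbhd _, hO⟩, inf_le_right.trans inf_le_right, h2,
    ⟨{ codim := d
       coord := fun i => ofHol _ (hg i)
       isHomogeneous_coord := fun i => isHomogeneous_ofHol _ _
       coord_mem := fun i => ?_
       deriv := fun i => frameDerivation hφ h2 hU'φ (v i)
       deriv_coord := fun i j V hV => ?_
       exists_eq_sum := fun V hV s hs x hx => exists_eq_sum_coord hf hφ hU'φ h2 hℓ
        (fun x hx => hY x (h1 hx)) hg hV hs hx }⟩⟩
  · rw [mem_splitIdeal_iff hf]
    intro y hy
    rw [ofHol_apply, (hY _ (h1 hy)).1 ⟨y, rfl⟩ i, map_zero]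
  · have e := frameDerivation_ofHol hφ h2 hU'φ (v i) hV ((hg j).mono hV)
    refine e.trans (sec_ext fun x => ?_)
    have h3 : chartDeriv φ (v i) (fun x => ℓ j (φ x)) x = if i = j then 1 else 0 := by
      rw [chartDeriv, (comp_symm_eventuallyEq (hU'φ x (hV x.2)) (ℓ j)).fderiv_eq,
        ContinuousLinearMap.fderiv, hℓ]
      simp [eq_comm]
    rw [ofHol_apply, h3]
    split_ifs <;> simp

end Embedding

end Supergeometry

/-! ### Epimorphisms onto the sheaf of exterior algebras of the submanifold -/

namespace Supergeometry

variable {X Y : Supergeometry.{u}} {U V W : Opens X.Base}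

/-- The part of a section in the degrees of parity `p`. -/
def parityPart (p : Fin 2) (s : X.sec U) : X.sec U :=
  ∑ j ∈ (Finset.range (X.rank + 1)).filter (fun j => j % 2 = p.val), proj j s

theorem hasParity_parityPart (p : Fin 2) (s : X.sec U) : HasParity p (parityPart p s) :=
  HasParity.sum fun j hj => (isHomogeneous_proj j s).hasParity (Finset.mem_filter.1 hj).2

theorem parityPart_add (s : X.sec U) : parityPart 0 s + parityPart 1 s = s := by
  conv_rhs => rw [← sum_proj s]
  rw [← Finset.sum_filter_add_sum_filter_not _ (fun j => j % 2 = (0 : Fin 2).val), parityPart,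
    parityPart]
  congr 2
  ext j
  rw [Finset.mem_filter, Finset.mem_filter]
  exact and_congr_right fun _ => Nat.mod_two_ne_zero.symm

theorem parityPart_mem_ferm {k : ℕ} (p : Fin 2) {s : X.sec U} (hs : s ∈ X.ferm k U) :
    parityPart p s ∈ X.ferm k U := by
  refine sum_mem fun j _ => ?_
  by_cases h : j < k
  · rw [mem_ferm_iff.1 hs j h]
    exact zero_mem _
  · exact ferm_anti (by omega) (isHomogeneous_proj j s).mem_ferm

/-- A section that is both even and odd is zero. -/
theorem eq_zero_of_hasParity {s : X.sec U} (h0 : HasParity 0 s) (h1 : HasParity 1 s) : s = 0 := by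
  refine sec_eq_of_proj fun j => ?_
  rw [proj_zero]
  rcases Nat.mod_two_eq_zero_or_one j with h | h
  · exact hasParity_iff.1 h1 j (by rw [h]; decide)
  · exact hasParity_iff.1 h0 j (by rw [h]; decide)

namespace Embedding

variable {f : Embedding Y X}

theorem rank_eq (hf : f.IsEven) (y : Y.Base) : Y.rank = X.rank := by
  rw [← finrank_odd y, ← finrank_odd (f.toFun y)]
  exact (LinearEquiv.ofBijective (f.odd y) (hf y)).finrank_eq.symm

/-- `Y` carries the topology induced from `X`. -/
theorem exists_preim_le (y : Y.Base) (V' : Opens Y.Base) (hy : y ∈ V') :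
    ∃ O : Opens X.Base, f.toFun y ∈ O ∧ f.preim O ≤ V' := by
  obtain ⟨O, hO, e⟩ := f.isSmoothEmbedding.isEmbedding.isInducing.isOpen_iff.1 V'.isOpen
  refine ⟨⟨O, hO⟩, ?_, fun z hz => ?_⟩
  · change y ∈ f.toFun ⁻¹' O
    rw [e]
    exact hy
  · have : z ∈ f.toFun ⁻¹' O := hz
    rwa [e] at this

variable (f) in
/-- An epimorphism over `U` of sheaves of superalgebras from `⋀^• T^*_{X,-}` to
`i_* ⋀^• T^*_{Y,-}`. -/
structure LocalEpi (U : Opens X.Base) where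
  app : ∀ V, V ≤ U → X.sec V →ₐ[ℂ] Y.sec (f.preim V)
  app_res : ∀ V V' (hV : V ≤ U) (h : V' ≤ V) (s : X.sec V),
    app V' (h.trans hV) (res h s) = res (f.preim_mono h) (app V hV s)
  parity : ∀ V hV p (s : X.sec V), HasParity p s → HasParity p (app V hV s)
  surjective : ∀ V (hV : V ≤ U) (t : Y.sec (f.preim V)), ∀ x ∈ V,
    ∃ (V' : Opens X.Base) (_ : x ∈ V') (h : V' ≤ V) (s : X.sec V'),
      app V' (h.trans hV) s = res (f.preim_mono h) t

namespace LocalEpi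

variable (ψ : f.LocalEpi U)

/-- Near the image of `y`, the section `u` has a preimage in `𝒥^m`. -/
def LiftsAt (y : Y.Base) (m : ℕ) {V' : Opens Y.Base} (u : Y.sec V') : Prop :=
  ∃ (W : Opens X.Base) (_ : f.toFun y ∈ W) (hW : W ≤ U) (h : f.preim W ≤ V') (t : X.sec W),
    t ∈ X.ferm m W ∧ ψ.app W hW t = res h u

variable {ψ} {y : Y.Base} {m : ℕ} {V' : Opens Y.Base}

theorem LiftsAt.shrink {u : Y.sec V'} (hu : ψ.LiftsAt y m u) {O : Opens X.Base}
    (hO : f.toFun y ∈ O) :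
    ∃ (W : Opens X.Base) (_ : f.toFun y ∈ W) (hW : W ≤ U) (_ : W ≤ O) (h : f.preim W ≤ V')
      (t : X.sec W), t ∈ X.ferm m W ∧ ψ.app W hW t = res h u := by
  obtain ⟨W, hyW, hW, h, t, ht, e⟩ := hu
  refine ⟨W ⊓ O, ⟨hyW, hO⟩, inf_le_left.trans hW, inf_le_right,
    (f.preim_mono inf_le_left).trans h, res inf_le_left t, res_ferm _ ht, ?_⟩
  rw [ψ.app_res W _ hW inf_le_left, e]
  rfl

theorem LiftsAt.mono {u : Y.sec V'} (hu : ψ.LiftsAt y m u) {n : ℕ} (hn : n ≤ m) :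
    ψ.LiftsAt y n u := by
  obtain ⟨W, hyW, hW, h, t, ht, e⟩ := hu
  exact ⟨W, hyW, hW, h, t, ferm_anti hn ht, e⟩

theorem LiftsAt.add {u v : Y.sec V'} (hu : ψ.LiftsAt y m u) (hv : ψ.LiftsAt y m v) :
    ψ.LiftsAt y m (u + v) := by
  obtain ⟨O, hyO, hO, h, t, ht, e⟩ := hu
  obtain ⟨W, hyW, hW, hWO, h', t', ht', e'⟩ := hv.shrink hyO
  refine ⟨W, hyW, hW, h', res hWO t + t', add_mem (res_ferm _ ht) ht', ?_⟩
  rw [map_add, map_add, e', ψ.app_res O _ hO hWO, e]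
  rfl

theorem LiftsAt.mul {u v : Y.sec V'} {n : ℕ} (hu : ψ.LiftsAt y m u) (hv : ψ.LiftsAt y n v) :
    ψ.LiftsAt y (m + n) (u * v) := by
  obtain ⟨O, hyO, hO, h, t, ht, e⟩ := hu
  obtain ⟨W, hyW, hW, hWO, h', t', ht', e'⟩ := hv.shrink hyO
  refine ⟨W, hyW, hW, h', res hWO t * t', ferm_mul_mem (res_ferm _ ht) ht', ?_⟩
  rw [map_mul, map_mul, e', ψ.app_res O _ hO hWO, e]
  rfl

theorem LiftsAt.of_algebraMap (hyU : f.toFun y ∈ U) (hy : y ∈ V') (c : ℂ) :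
    ψ.LiftsAt y 0 (algebraMap ℂ (Y.sec V') c) := by
  obtain ⟨O, hyO, hO⟩ := exists_preim_le (f := f) y V' hy
  refine ⟨O ⊓ U, ⟨hyO, hyU⟩, inf_le_right, (f.preim_mono inf_le_left).trans hO,
    algebraMap ℂ _ c, mem_ferm_zero _, ?_⟩
  rw [AlgHom.commutes, AlgHom.commutes]

theorem LiftsAt.zero (hyU : f.toFun y ∈ U) (hy : y ∈ V') : ψ.LiftsAt y m (0 : Y.sec V') := by
  obtain ⟨O, hyO, hO⟩ := exists_preim_le (f := f) y V' hy
  exact ⟨O ⊓ U, ⟨hyO, hyU⟩, inf_le_right, (f.preim_mono inf_le_left).trans hO, 0, zero_mem _,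
    by rw [map_zero, map_zero]⟩

theorem LiftsAt.sum {ι : Type*} {I : Finset ι} {u : ι → Y.sec V'} (hyU : f.toFun y ∈ U)
    (hy : y ∈ V') (h : ∀ i ∈ I, ψ.LiftsAt y m (u i)) : ψ.LiftsAt y m (∑ i ∈ I, u i) := by
  classical
  induction I using Finset.induction_on with
  | empty => exact LiftsAt.zero hyU hy
  | insert i I hi ih =>
    rw [Finset.sum_insert hi]
    exact (h i (by simp)).add (ih fun j hj => h j (by simp [hj]))

theorem LiftsAt.of_res {u : Y.sec V'} {V'' : Opens Y.Base} (h : V'' ≤ V')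
    (hu : ψ.LiftsAt y m (res h u)) : ψ.LiftsAt y m u := by
  obtain ⟨W, hyW, hW, h', t, ht, e⟩ := hu
  exact ⟨W, hyW, hW, h'.trans h, t, ht, e⟩

/-- An epimorphism of sheaves is locally surjective. -/
theorem liftsAt_zero (hyU : f.toFun y ∈ U) (hy : y ∈ V') (u : Y.sec V') : ψ.LiftsAt y 0 u := by
  obtain ⟨O, hyO, hO⟩ := exists_preim_le (f := f) y V' hy
  have hOV : f.preim (O ⊓ U) ≤ V' := (f.preim_mono inf_le_left).trans hO
  obtain ⟨W, hyW, hW, t, e⟩ := ψ.surjective (O ⊓ U) inf_le_right (res hOV u) _ ⟨hyO, hyU⟩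
  exact ⟨W, hyW, hW.trans inf_le_right, (f.preim_mono hW).trans hOV, t, mem_ferm_zero _, e⟩

/-- An even morphism takes the part of a preimage of wrong parity to zero. -/
theorem app_parityPart (hV : V ≤ U) {p : Fin 2} {s : X.sec V} (h : HasParity p (ψ.app V hV s)) :
    ψ.app V hV (parityPart p s) = ψ.app V hV s := by
  have h01 := congrArg (ψ.app V hV) (parityPart_add s)
  rw [map_add] at h01
  have q0 := ψ.parity V hV _ _ (hasParity_parityPart 0 s)
  have q1 := ψ.parity V hV _ _ (hasParity_parityPart 1 s)
  match p with
  | 0 =>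
    have e : ψ.app V hV (parityPart 1 s) = ψ.app V hV s - ψ.app V hV (parityPart 0 s) := by
      rw [← h01, add_sub_cancel_left]
    have := eq_zero_of_hasParity (by rw [e]; exact h.sub q0) q1
    rw [← h01, this, add_zero]
  | 1 =>
    have e : ψ.app V hV (parityPart 0 s) = ψ.app V hV s - ψ.app V hV (parityPart 1 s) := by
      rw [← h01, add_sub_cancel_right]
    have := eq_zero_of_hasParity q0 (by rw [e]; exact h.sub q1)
    rw [← h01, this, zero_add]

/-- An odd section has an odd preimage, which lies in `𝒥`. -/
theorem liftsAt_one (hyU : f.toFun y ∈ U) (hy : y ∈ V') {u : Y.sec V'} (hu : HasParity 1 u) :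
    ψ.LiftsAt y 1 u := by
  obtain ⟨W, hyW, hW, h, t, -, e⟩ := liftsAt_zero (ψ := ψ) hyU hy u
  refine ⟨W, hyW, hW, h, parityPart 1 t, ?_, ?_⟩
  · refine mem_ferm_iff.2 fun j hj => hasParity_iff.1 (hasParity_parityPart 1 t) j ?_
    have : j = 0 := by omega
    subst this
    decide
  · rw [app_parityPart hW (by rw [e]; exact hu.res h), e]

/-- An even epimorphism is strict for the filtrations by powers of the fermionic ideals: sections
of degree one have preimages of odd parity, and the algebra is generated in degrees zero and one. -/
theorem liftsAt_of_mem_ferm (hyU : f.toFun y ∈ U) (hy : y ∈ V') {u : Y.sec V'}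
    (hu : u ∈ Y.ferm m V') : ψ.LiftsAt y m u := by
  let A : ∀ V'' : Opens Y.Base, V'' ≤ V' ⊓ f.preim U → Subalgebra ℂ (Y.sec V'') := fun V'' hV =>
    { carrier := {t | ∀ j, ∀ z ∈ V'', ψ.LiftsAt z j (proj j t)}
      mul_mem' := by
        intro a b ha hb n z hz
        rw [proj_mul]
        refine LiftsAt.sum (hV hz).2 hz fun p hp => ?_
        rw [← Finset.HasAntidiagonal.mem_antidiagonal.1 hp]
        exact (ha p.1 z hz).mul (hb p.2 z hz)
      add_mem' := by
        intro a b ha hb j z hz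
        rw [proj_add]
        exact (ha j z hz).add (hb j z hz)
      algebraMap_mem' := by
        intro c j z hz
        have hc : IsHomogeneous 0 (algebraMap ℂ (Y.sec V'') c) := fun x =>
          algebraMap_mem_degree_zero c
        rw [hc.proj_eq]
        split_ifs with h
        · rw [h]
          exact LiftsAt.of_algebraMap (hV hz).2 hz c
        · exact LiftsAt.zero (hV hz).2 hz }
  obtain ⟨V'', hyV, hV, h⟩ := exists_nbhd_of_subalgebra (res (inf_le_left : V' ⊓ f.preim U ≤ V') u)
    y ⟨hy, hyU⟩ A
    (fun W hW g hg j z hz => by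
      rw [(isHomogeneous_ofHol g hg).proj_eq]
      split_ifs with h
      · rw [h]
        exact liftsAt_zero (hW hz).2 hz _
      · exact LiftsAt.zero (hW hz).2 hz)
    (fun W hW σ hσ j z hz => by
      rw [(isHomogeneous_ofOdd σ hσ).proj_eq]
      split_ifs with h
      · rw [h]
        exact liftsAt_one (hW hz).2 hz ((isHomogeneous_ofOdd σ hσ).hasParity rfl)
      · exact LiftsAt.zero (hW hz).2 hz)
  refine LiftsAt.of_res (hV.trans inf_le_left) ?_
  rw [← sum_proj (res _ u)]
  refine LiftsAt.sum (hV hyV).2 hyV fun j _ => ?_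
  by_cases hj : j < m
  · rw [mem_ferm_iff.1 (res_ferm _ hu) j hj]
    exact LiftsAt.zero (hV hyV).2 hyV
  · exact (h j y hyV).mono (by omega)

/-- A function `c` whose multiple `c θ` of the section `θ` of top degree lies in the kernel vanishes
on `Y`. The section of top degree of `Y` has a preimage in top degree, a multiple of `θ`, so it is
annihilated by the image of `c`. Hence this image is an even section without component of degree
zero, so it lies in `𝒥²` and is also the image of a section in `𝒥²`, and the difference of `c` and
the latter lies in the kernel. -/
theorem mem_splitIdeal_of_app_mul_constSec_eq_zero (hf : f.IsEven) {x₀ : X.Base}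
    (hU : U ≤ frameNbhd x₀)
    (hred : ∀ V hV s, ψ.app V hV s = 0 → HasParity 0 s → proj 0 s ∈ f.splitIdeal V)
    (hV : V ≤ U) {c : X.sec V} (hc : IsHomogeneous 0 c)
    (h : ψ.app V hV (c * constSec (hV.trans hU) (extBasis X.Fiber Finset.univ)) = 0) :
    c ∈ f.splitIdeal V := by
  rw [mem_splitIdeal_iff hf]
  intro y hy
  let V₀ : Opens Y.Base := f.preim V ⊓ frameNbhd y
  have hV₀ : V₀ ≤ frameNbhd y := inf_le_right
  have hyV₀ : y ∈ V₀ := ⟨hy, mem_frameNbhd y⟩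
  let τ : Y.sec V₀ := constSec hV₀ (extBasis Y.Fiber Finset.univ)
  have hτ : IsHomogeneous X.rank τ := by
    refine isHomogeneous_constSec hV₀ ?_
    have := extBasis_mem (M := Y.Fiber) Finset.univ
    have e : (Finset.univ : Finset (Fin (Module.finrank ℂ Y.Fiber))).card = X.rank := by
      rw [Finset.card_univ, Fintype.card_fin]
      exact rank_eq hf y
    rwa [e] at this
  obtain ⟨W, hyW, hWU, hWV, hW₀, t, ht, et⟩ :=
    (liftsAt_of_mem_ferm (ψ := ψ) (hV hy) hyV₀ hτ.mem_ferm).shrink hy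
  -- the image of `c`; it annihilates the section `τ` of top degree
  let u : Y.sec (f.preim W) := ψ.app W hWU (res hWV c)
  have hτu : res hW₀ τ * u = 0 := by
    have e : t * res hWV c =
        coefSec (hWU.trans hU) ((extBasis X.Fiber).coord Finset.univ) t *
          res hWV (c * constSec (hV.trans hU) (extBasis X.Fiber Finset.univ)) := by
      conv_lhs => rw [eq_coefSec_mul_of_mem_ferm_rank (hWU.trans hU) ht]
      rw [mul_assoc, map_mul, (hc.res hWV).commute (by decide)]
      rfl
    rw [← et, ← map_mul, e, map_mul, ψ.app_res V W hV hWV, h, map_zero, mul_zero]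
  have hu0 : proj 0 u = 0 := by
    have e := (hτ.res hW₀).proj_mul u 0
    rw [hτu, proj_zero] at e
    refine sec_ext fun z => ?_
    have ez : (res hW₀ τ).1 z * extProj 0 (u.1 z) = 0 :=
      congrFun (congrArg Subtype.val e.symm) z
    obtain ⟨a, ha⟩ : ∃ a : ℂ, extProj 0 (u.1 z) = algebraMap ℂ _ a := by
      have := extProj_mem 0 (u.1 z)
      have h1 : (⋀[ℂ]^0 (Y.Odd z.1)) = 1 := pow_zero (LinearMap.range (ExteriorAlgebra.ι ℂ))
      rw [h1] at this
      obtain ⟨a, ha⟩ := Submodule.mem_one.1 this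
      exact ⟨a, ha.symm⟩
    change extProj 0 (u.1 z) = 0
    rw [ha, ← Algebra.commutes, ← Algebra.smul_def] at ez
    rcases smul_eq_zero.1 ez with h0 | h0
    · rw [ha, h0, map_zero]
    · exact absurd h0 (ofModel_ne_zero (hV₀ (hW₀ z.2)) ((extBasis Y.Fiber).ne_zero _))
  -- the image of `c` is even, hence has no component of degree one
  have hup : HasParity 0 u := ψ.parity W hWU 0 _ ((hc.res hWV).hasParity rfl)
  have hu2 : u ∈ Y.ferm 2 _ := by
    refine hup.mem_ferm_succ (mem_ferm_iff.2 fun j hj => ?_) (by decide)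
    obtain rfl : j = 0 := by omega
    exact hu0
  obtain ⟨W', hyW', hWU', hWW', h', t', ht', et'⟩ :=
    (liftsAt_of_mem_ferm (ψ := ψ) (hV hy) hyW hu2).shrink hyW
  have e1 : ψ.app W' hWU' (parityPart 0 t') = ψ.app W' hWU' t' :=
    app_parityPart hWU' (by rw [et']; exact hup.res h')
  have e2 : ψ.app W' hWU' (res hWW' (res hWV c)) = res h' u :=
    ψ.app_res W W' hWU hWW' _
  have hc' : IsHomogeneous 0 (res hWW' (res hWV c)) := (hc.res hWV).res hWW'
  have key := hred W' hWU' (res hWW' (res hWV c) - parityPart 0 t')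
    (by rw [map_sub, e1, e2, et', sub_self])
    ((hc'.hasParity rfl).sub (hasParity_parityPart 0 t'))
  rw [proj_sub, hc'.proj_same, mem_ferm_iff.1 (parityPart_mem_ferm 0 ht') 0 (by omega), sub_zero,
    mem_splitIdeal_iff hf] at key
  exact key y hyW'

/-- An epimorphism onto `i_* ⋀^• T^*_{Y,-}` whose kernel contains the ideal of the split embedding
and has the same reduction has no larger kernel. A section `s` in the kernel whose component of
lowest degree does not vanish on `Y` has a multiple in top degree with this property. -/
theorem mem_splitIdeal_of_app_eq_zero (hf : f.IsEven) {x₀ : X.Base} (hU : U ≤ frameNbhd x₀)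
    (hker : ∀ V hV s, s ∈ f.splitIdeal V → ψ.app V hV s = 0)
    (hred : ∀ V hV s, ψ.app V hV s = 0 → HasParity 0 s → proj 0 s ∈ f.splitIdeal V)
    (hV : V ≤ U) {s : X.sec V} (hs : ψ.app V hV s = 0) : s ∈ f.splitIdeal V := by
  have key : ∀ j, proj j s ∈ f.splitIdeal V := by
    intro j
    induction j using Nat.strong_induction_on with
    | _ j ih =>
    rw [mem_splitIdeal_iff hf]
    intro y hy
    by_contra hne
    obtain ⟨i, v, hv, hij, hmul⟩ := exists_mul_top_ne_zero hne
    rw [finrank_odd] at hij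
    -- remove the components of lower degree, which lie in the kernel
    let s' := s - ∑ i ∈ Finset.range j, proj i s
    have hs' : ψ.app V hV s' = 0 := by
      rw [map_sub, hs, zero_sub, neg_eq_zero, map_sum]
      exact Finset.sum_eq_zero fun i hi => hker V hV _ (ih i (Finset.mem_range.1 hi))
    have hproj : ∀ n ≤ j, proj n s' = if n = j then proj j s else 0 := by
      intro n hn
      rw [proj_sub, proj_sum]
      simp only [proj_proj]
      rw [Finset.sum_ite_eq]
      split_ifs with h1 h2 h2
      · simp [h2] at h1
      · rw [sub_self]
      · rw [sub_zero, h2]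
      · exact absurd (Finset.mem_range.2 (lt_of_le_of_ne hn h2)) h1
    have hferm : s' ∈ X.ferm j V := mem_ferm_iff.2 fun n hn => by
      rw [hproj n hn.le, if_neg hn.ne]
    have hVF := hV.trans hU
    have hw : toModel x₀ (f.toFun y) v ∈ ⋀[ℂ]^i X.Fiber := by
      have := extProj_map ((trivializationAt X.Fiber X.Odd x₀).linearMapAt ℂ (f.toFun y)) i v
      rw [extProj_same hv] at this
      rw [toModel, ← this]
      exact extProj_mem _ _
    -- a multiple in top degree that does not vanish at the image of `y`
    let T : X.sec V := s' * constSec hVF (toModel x₀ (f.toFun y) v)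
    have hvhom := isHomogeneous_constSec hVF hw
    have hT : T ∈ X.ferm X.rank V := by
      rw [← hij, add_comm]
      exact ferm_mul_mem hferm hvhom.mem_ferm
    have eT := eq_coefSec_mul_of_mem_ferm_rank hVF hT
    have hψT : ψ.app V hV T = 0 := by rw [map_mul, hs', zero_mul]
    rw [eT] at hψT
    have hc := mem_splitIdeal_of_app_mul_constSec_eq_zero hf hU hred hV
      (isHomogeneous_ofHol _ _) hψT
    have hTs : T ∈ f.splitIdeal V := by
      rw [eT]
      exact mul_mem_splitIdeal_right _ hc
    have h1 := (mem_splitIdeal_iff hf).1 (proj_mem_splitIdeal hf hTs (j + i)) y hy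
    rw [hvhom.proj_mul_right, hproj j le_rfl, if_pos rfl] at h1
    apply hmul
    have h2 : (proj j s).1 ⟨f.toFun y, hy⟩ *
        ofModel x₀ (f.toFun y) (toModel x₀ (f.toFun y) v) = 0 := h1
    rw [ofModel_toModel (hVF hy)] at h2
    exact h2
  rw [← sum_proj s]
  exact Ideal.sum_mem _ fun j _ => key j

end LocalEpi

end Embedding

end Supergeometry

/-! ### Sections of quotient sheaves -/

namespace Cech

variable {X : Type u} [TopologicalSpace X]

theorem eq_of_locally_eq (A : AbSheaf X) {U : Opens X} (s t : A.obj.obj (op U))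
    (h : ∀ x ∈ U, ∃ (V : Opens X) (_ : x ∈ V) (hV : V ≤ U), sres A hV s = sres A hV t) : s = t := by
  choose V hx hV e using h
  exact TopCat.Sheaf.eq_of_locally_eq' (X := TopCat.of X) A (fun x : U => V x.1 x.2) U
    (fun x => homOfLE (hV x.1 x.2))
    (fun x hxU => Opens.mem_iSup.2 ⟨⟨x, hxU⟩, hx x hxU⟩) s t fun x => e x.1 x.2

theorem exists_gluing (A : AbSheaf X) (U : X → Opens X) (hU : ∀ x, x ∈ U x)
    (s : ∀ x, A.obj.obj (op (U x)))
    (h : ∀ x y, sres A inf_le_left (s x) = sres A (inf_le_right : U x ⊓ U y ≤ U y) (s y)) :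
    ∃ r : A.obj.obj (op ⊤), ∀ x, sres A le_top r = s x := by
  obtain ⟨r, hr, -⟩ := TopCat.Sheaf.existsUnique_gluing' (X := TopCat.of X) A U ⊤
    (fun x => homOfLE le_top) (fun x _ => Opens.mem_iSup.2 ⟨x, hU x⟩) s h
  exact ⟨r, hr⟩

theorem sres_sres (A : AbSheaf X) {U V W : Opens X} (h : V ≤ U) (h' : W ≤ V)
    (s : A.obj.obj (op U)) : sres A h' (sres A h s) = sres A (h'.trans h) s := by
  simp only [sres, ← ConcreteCategory.comp_apply, ← Functor.map_comp]
  rfl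

theorem sres_app {A B : AbSheaf X} (φ : A ⟶ B) {U V : Opens X} (h : V ≤ U)
    (s : A.obj.obj (op U)) :
    sres B h (φ.hom.app (op U) s) = φ.hom.app (op V) (sres A h s) :=
  (ConcreteCategory.congr_hom (φ.hom.naturality (homOfLE h).op) s).symm

end Cech

namespace SubPresheaf

variable {X : Type u} [TopologicalSpace X] {P : (Opens X)ᵒᵖ ⥤ GrpCat.{u}}
variable {A B A' B' : SubPresheaf P}

theorem toQuotSheaf_mul (h : CommLE A B) (U : Opens X) (a b : A.carrier (op U)) :
    toQuotSheaf h U (a * b) = toQuotSheaf h U a + toQuotSheaf h U b :=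
  map_add ((toSheafify (Opens.grothendieckTopology X) (quotPresheaf h)).app (op U)).hom
    (quotMk h (op U) a) (quotMk h (op U) b)

theorem toQuotSheaf_inv (h : CommLE A B) (U : Opens X) (a : A.carrier (op U)) :
    toQuotSheaf h U a⁻¹ = -toQuotSheaf h U a :=
  map_neg ((toSheafify (Opens.grothendieckTopology X) (quotPresheaf h)).app (op U)).hom
    (quotMk h (op U) a)

theorem toQuotSheaf_eq_zero (h : CommLE A B) (U : Opens X) (a : A.carrier (op U))
    (ha : a.1 ∈ B.carrier (op U)) : toQuotSheaf h U a = 0 := by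
  have e : quotMk h (op U) a = 0 :=
    (quotMk_eq_iff h (op U) a 1).2 (by simpa using inv_mem ha)
  rw [toQuotSheaf, e]
  exact map_zero ((toSheafify (Opens.grothendieckTopology X) (quotPresheaf h)).app (op U)).hom

theorem map_toQuotSheaf (h : CommLE A B) {U V : Opens X} (i : V ⟶ U) (a : A.carrier (op U)) :
    (quotSheaf h).obj.map i.op (toQuotSheaf h U a) = toQuotSheaf h V (A.resHom i.op a) :=
  (ConcreteCategory.congr_hom
    ((toSheafify (Opens.grothendieckTopology X) (quotPresheaf h)).naturality i.op)
    (quotMk h (op U) a)).symm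

theorem quotSheafHom_toQuotSheaf (h : CommLE A B) (h' : CommLE A' B')
    (hA : ∀ U, A.carrier U ≤ A'.carrier U) (hB : ∀ U, B.carrier U ≤ B'.carrier U) (U : Opens X)
    (a : A.carrier (op U)) :
    (quotSheafHom h h' hA hB).hom.app (op U) (toQuotSheaf h U a) =
      toQuotSheaf h' U (Subgroup.inclusion (hA (op U)) a) := by
  have e := toSheafify_naturality (Opens.grothendieckTopology X) (quotPresheafHom h h' hA hB)
  exact (ConcreteCategory.congr_hom (congrArg (fun η => η.app (op U)) e)
    (quotMk h (op U) a)).symm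

/-- Every section of a quotient sheaf is locally represented by a section of the presheaf. -/
theorem exists_local_toQuotSheaf (h : CommLE A B) {U : Opens X} (r : (quotSheaf h).obj.obj (op U))
    {x : X} (hx : x ∈ U) : ∃ (V : Opens X) (_ : x ∈ V) (hV : V ≤ U) (a : A.carrier (op V)),
      toQuotSheaf h V a = Cech.sres (quotSheaf h) hV r := by
  have hs : Presheaf.IsLocallySurjective (Opens.grothendieckTopology X)
      (toSheafify (Opens.grothendieckTopology X) (quotPresheaf h)) := inferInstance
  obtain ⟨V, i, ⟨q, hq⟩, hxV⟩ := Presheaf.imageSieve_mem (Opens.grothendieckTopology X)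
    (toSheafify (Opens.grothendieckTopology X) (quotPresheaf h)) (U := op U) r x hx
  obtain ⟨a, rfl⟩ := quotMk_surjective h (op V) q
  exact ⟨V, hxV, i.le, a, hq⟩

end SubPresheaf

namespace Supergeometry

namespace Embedding

variable {X Y : Supergeometry.{u}} {f : Embedding Y X} {U V : Opens X.Base} {k : ℕ} (hk : 2 ≤ k)

theorem toNormalSheaf_mul (a b : X.greenSubgroup k U) :
    f.toNormalSheaf hk U (a * b) = f.toNormalSheaf hk U a + f.toNormalSheaf hk U b :=
  (congrArg ((cokernel.π (f.obstructionIncl hk)).hom.app (op U))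
    (SubPresheaf.toQuotSheaf_mul (Supergeometry.green_commLE hk) U a b)).trans
    (map_add ((cokernel.π (f.obstructionIncl hk)).hom.app (op U)).hom _ _)

theorem toNormalSheaf_eq_zero_of_mem_succ (a : X.greenSubgroup k U)
    (ha : a.1 ∈ X.greenSubgroup (k + 1) U) : f.toNormalSheaf hk U a = 0 :=
  (congrArg ((cokernel.π (f.obstructionIncl hk)).hom.app (op U))
    (SubPresheaf.toQuotSheaf_eq_zero (Supergeometry.green_commLE hk) U a ha)).trans
    (map_zero ((cokernel.π (f.obstructionIncl hk)).hom.app (op U)).hom)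

theorem obstructionIncl_toQuotSheaf (a : (f.green k).carrier (op U)) :
    (f.obstructionIncl hk).hom.app (op U) (SubPresheaf.toQuotSheaf (f.green_commLE hk) U a) =
      SubPresheaf.toQuotSheaf (Supergeometry.green_commLE (X := X) hk) U ⟨a.1, a.2.1⟩ :=
  SubPresheaf.quotSheafHom_toQuotSheaf _ _ _ _ U a

/-- Automorphisms that preserve the ideal of the split embedding come from the obstruction sheaf of
the embedding, so they represent zero in the cokernel. -/
theorem toNormalSheaf_eq_zero_of_mem_aut (a : X.greenSubgroup k U)
    (ha : a.1 ∈ f.autSubgroup U) : f.toNormalSheaf hk U a = 0 := by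
  have e := Cech.π_comp_ι (f.obstructionIncl hk) U
    (SubPresheaf.toQuotSheaf (f.green_commLE hk) U ⟨a.1, a.2, ha⟩)
  rw [obstructionIncl_toQuotSheaf] at e
  exact e

theorem sres_toNormalSheaf (h : V ≤ U) (a : X.greenSubgroup k U) :
    Cech.sres (f.normalSheaf hk) h (f.toNormalSheaf hk U a) =
      f.toNormalSheaf hk V ⟨SuperAut.restrict h a.1, fun W hW s => a.2 W (hW.trans h) s⟩ :=
  (Cech.sres_app (cokernel.π (f.obstructionIncl hk)) h _).trans
    (congrArg ((cokernel.π (f.obstructionIncl hk)).hom.app (op V))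
      (SubPresheaf.map_toQuotSheaf (Supergeometry.green_commLE (X := X) hk) (homOfLE h) a))

theorem exists_local_toNormalSheaf (r : (f.normalSheaf hk).obj.obj (op ⊤)) (x : X.Base) :
    ∃ (V : Opens X.Base) (_ : x ∈ V) (a : X.greenSubgroup k V),
      Cech.sres (f.normalSheaf hk) le_top r = f.toNormalSheaf hk V a := by
  obtain ⟨U, hxU, b, hb⟩ := Cech.exists_local_lift (f.obstructionIncl hk) r x
  obtain ⟨V, hxV, hVU, a, ha⟩ :=
    SubPresheaf.exists_local_toQuotSheaf (Supergeometry.green_commLE (X := X) hk) b hxU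
  refine ⟨V, hxV, a, ?_⟩
  have e := Cech.sres_app (cokernel.π (f.obstructionIncl hk)) hVU b
  rw [← ha, hb] at e
  exact (Cech.sres_sres (f.normalSheaf hk) le_top hVU r).symm.trans e

end Embedding

end Supergeometry

namespace Supergeometry

variable {X Y : Supergeometry.{u}} {U V W : Opens X.Base} {e k : ℕ}

/-! ### Leading derivations that preserve the submanifold -/

theorem evenPart_le (k : ℕ) : evenPart k ≤ k := by rw [evenPart]; omega

theorem evenPart_of_even {k : ℕ} (hk : Even k) : evenPart k = k := by
  obtain ⟨m, rfl⟩ := hk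
  rw [evenPart]
  omega

theorem sub_mem_of_forall_isHomogeneous {m : ℕ} (L : X.sec V →ₗ[ℂ] X.sec V)
    (h : ∀ n (s : X.sec V), IsHomogeneous n s → L s - s ∈ X.ferm m V) (s : X.sec V) :
    L s - s ∈ X.ferm m V := by
  have e : L s - s = ∑ j ∈ Finset.range (X.rank + 1), (L (proj j s) - proj j s) := by
    rw [Finset.sum_sub_distrib, ← map_sum, sum_proj]
  rw [e]
  exact sum_mem fun j _ => h j _ (isHomogeneous_proj j s)

/-- The automorphisms in `𝒢^{(k)}` act trivially on the quotients `𝒥^j / 𝒥^{j+1}`. -/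
theorem greenSubgroup_sub_mem {a : SuperAut X U} (ha : a ∈ X.greenSubgroup k U) (hk : 2 ≤ k)
    (hV : V ≤ U) {j : ℕ} {s : X.sec V} (hs : s ∈ X.ferm j V) :
    a.app V hV s - s ∈ X.ferm (j + 1) V :=
  ferm_anti (by have := evenPart_pos hk; omega) (greenSubgroup_raisesDegree ha V hV j s hs)

theorem greenSubgroup_proj {a : SuperAut X U} (ha : a ∈ X.greenSubgroup k U) (hk : 2 ≤ k)
    (hV : V ≤ U) {j : ℕ} {s : X.sec V} (hs : s ∈ X.ferm j V) :
    proj j (a.app V hV s) = proj j s := by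
  have := mem_ferm_iff.1 (greenSubgroup_sub_mem ha hk hV hs) j (Nat.lt_succ_self j)
  rwa [proj_sub, sub_eq_zero] at this

/-- For odd `k`, the leading derivation of an automorphism in `𝒢^{(k)}` is linear over functions. -/
theorem lead_app_zero_of_odd (hk : 2 ≤ k) (hodd : _root_.Odd k) {a : SuperAut X U}
    (ha : a ∈ X.greenSubgroup k U) (hV : V ≤ U) {s : X.sec V} (hs : IsHomogeneous 0 s) :
    (a.lead (evenPart_pos hk) (greenSubgroup_raisesDegree ha)).app V hV s = 0 := by
  have h := evenPart_pos hk
  have hle := evenPart_le k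
  rw [SuperAut.lead_app a _ _ hV hs, zero_add]
  have h1 := mem_ferm_iff.1 (greenSubgroup_sub_mem_of_odd hodd ha hV hs) (evenPart k) (by omega)
  rw [proj_sub, hs.proj_eq, if_neg h.ne', sub_zero] at h1
  exact h1

/-- The exponential of the leading derivation of an automorphism in `𝒢^{(k)}` agrees with it modulo
`𝒢^{(k+1)}`. -/
theorem exp_lead_inv_mul_mem (hk : 2 ≤ k) {a : SuperAut X U} (ha : a ∈ X.greenSubgroup k U) :
    ((a.lead (evenPart_pos hk) (greenSubgroup_raisesDegree ha)).exp (evenPart_pos hk)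
      (even_evenPart k))⁻¹ * a ∈ X.greenSubgroup (k + 1) U := by
  have hpos := evenPart_pos hk
  have heven := even_evenPart k
  have hle := evenPart_le k
  have hge : k ≤ evenPart k + 1 := by rw [evenPart]; omega
  let D := a.lead hpos (greenSubgroup_raisesDegree ha)
  intro V hV s
  refine sub_mem_of_forall_isHomogeneous (((D.exp hpos heven)⁻¹ * a).app V hV).toLinearMap
    (fun n s hs => ?_) s
  change (-D).expLin V hV (a.app V hV s) - s ∈ X.ferm (k + 1) V
  -- both sides of the difference agree with `s + D s` modulo `𝒥^{k+1}`; on functions and for odd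
  -- `k`, where `D` only has degree `k - 1`, this holds because `D s = 0`
  have hmem : a.app V hV s - D.expLin V hV s ∈ X.ferm (k + 1) V := by
    have h2 := D.expLin_sub_sub_mem hV hs.mem_ferm
    have e1 : a.app V hV s - D.expLin V hV s =
        a.app V hV s - s - D.app V hV s - (D.expLin V hV s - s - D.app V hV s) := by abel
    rw [e1]
    refine sub_mem ?_ (ferm_anti ?_ h2)
    · by_cases h0 : _root_.Odd k ∧ n = 0
      · obtain ⟨hodd, rfl⟩ := h0
        have e2 : D.app V hV s = 0 := lead_app_zero_of_odd hk hodd ha hV hs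
        rw [e2, sub_zero]
        exact greenSubgroup_sub_mem_of_odd hodd ha hV hs
      · have hn : k + 1 ≤ n + evenPart k + 1 := by
          rcases Nat.even_or_odd k with h | h
          · rw [evenPart_of_even h]
            omega
          · have : n ≠ 0 := fun hn => h0 ⟨h, hn⟩
            omega
        refine ferm_anti hn (mem_ferm_iff.2 fun j hj => ?_)
        have e2 : D.app V hV s = proj (n + evenPart k) (a.app V hV s) :=
          SuperAut.lead_app a _ _ hV hs
        have h3 := greenSubgroup_raisesDegree ha V hV n s hs.mem_ferm
        rw [proj_sub, e2, proj_proj]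
        split_ifs with hj'
        · rw [hj', proj_sub, hs.proj_eq, if_neg (by omega), sub_zero, sub_self]
        · rw [mem_ferm_iff.1 h3 j (by omega), sub_zero]
    · rcases Nat.even_or_odd k with h | h
      · have := evenPart_of_even h
        omega
      · obtain ⟨m, rfl⟩ := h
        omega
  have e3 : (-D).expLin V hV (a.app V hV s) - s =
      (-D).expLin V hV (a.app V hV s - D.expLin V hV s) := by
    rw [map_sub, D.expLin_neg_apply hpos hV]
  rw [e3]
  have := add_mem (ferm_anti (Nat.le_add_right _ _) ((-D).expLin_sub_mem hV hmem)) hmem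
  rwa [sub_add_cancel] at this

namespace Embedding

variable {f : Embedding Y X}

/-- A derivation over a set with a frame of the odd conormal bundle preserves the ideal of the split
embedding if it does so on functions. -/
theorem derivation_app_mem_splitIdeal (hf : f.IsEven) (D : GradedDerivation X U e)
    (h : ∀ V hV (s : X.sec V), IsHomogeneous 0 s → s ∈ f.splitIdeal V →
      D.app V hV s ∈ f.splitIdeal V)
    (hV : V ≤ U) {s : X.sec V} (hs : s ∈ f.splitIdeal V) : D.app V hV s ∈ f.splitIdeal V := by
  refine mem_splitIdeal_local fun x hx => ?_
  refine ⟨V ⊓ frameNbhd x, ⟨hx, mem_frameNbhd x⟩, inf_le_left, ?_⟩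
  have hW : V ⊓ frameNbhd x ≤ frameNbhd x := inf_le_right
  rw [← D.app_res V _ hV inf_le_left, ← sum_coefSec_mul hW (res inf_le_left s), map_sum]
  refine Ideal.sum_mem _ fun i _ => ?_
  have hc : coefSec hW ((extBasis X.Fiber).coord i) (res inf_le_left s) ∈
      f.splitIdeal (V ⊓ frameNbhd x) := by
    rw [mem_splitIdeal_iff hf]
    intro y hy
    have e := (mem_splitIdeal_iff hf).1
      (f.res_splitIdeal (V := V ⊓ frameNbhd x) inf_le_left hs) y hy
    change algebraMap ℂ _ (coef _ _ _ _) = 0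
    rw [coef_of_mem _ _ hy, e, map_zero, map_zero, map_zero]
  rw [D.leibniz]
  exact Ideal.add_mem _ (mul_mem_splitIdeal_right _ hc)
    (mul_mem_splitIdeal_right _ (h _ _ _ (isHomogeneous_ofHol _ _) hc))

theorem exp_mem_autSubgroup (D : GradedDerivation X U e) (he : 0 < e) (he2 : Even e)
    (h : ∀ V hV (s : X.sec V), s ∈ f.splitIdeal V → D.app V hV s ∈ f.splitIdeal V) :
    D.exp he he2 ∈ f.autSubgroup U := by
  intro V hV s
  constructor
  · intro hs
    have := (-D).expLin_mem hV ((f.splitIdeal V).restrictScalars ℂ)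
      (fun t ht => neg_mem (h V hV t ht)) hs
    rwa [GradedDerivation.exp_app, D.expLin_neg_apply he hV] at this
  · exact D.expLin_mem hV ((f.splitIdeal V).restrictScalars ℂ) (h V hV)

/-- An automorphism whose leading component takes functions vanishing on `Y` to sections vanishing
on `Y` represents zero in the normal sheaf. This is no condition for odd `k`, since the leading
component is then zero on functions. -/
theorem toNormalSheaf_eq_zero (hf : f.IsEven) (hk : 2 ≤ k) (a : X.greenSubgroup k U)
    (h : Even k → ∀ V (hV : V ≤ U) (n : X.sec V), IsHomogeneous 0 n → n ∈ f.splitIdeal V →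
      proj k (a.1.app V hV n) ∈ f.splitIdeal V) : f.toNormalSheaf hk U a = 0 := by
  have hpos := evenPart_pos hk
  let D := a.1.lead hpos (greenSubgroup_raisesDegree a.2)
  let b := D.exp hpos (even_evenPart k)
  have hb : b⁻¹ * a.1 ∈ X.greenSubgroup (k + 1) U := exp_lead_inv_mul_mem hk a.2
  have hb' : b⁻¹ * a.1 ∈ X.greenSubgroup k U := green_anti (Nat.le_succ k) hb
  have hbk : b ∈ X.greenSubgroup k U := by
    have := mul_mem a.2 (inv_mem hb')
    rwa [mul_inv_rev, inv_inv, mul_inv_cancel_left] at this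
  have haut : b ∈ f.autSubgroup U := by
    refine exp_mem_autSubgroup _ _ _ fun V hV s hs =>
      derivation_app_mem_splitIdeal hf D (fun V hV s hs hsI => ?_) hV hs
    rcases Nat.even_or_odd k with hev | hodd
    · have e1 : D.app V hV s = proj (0 + evenPart k) (a.1.app V hV s) :=
        SuperAut.lead_app a.1 _ _ hV hs
      rw [e1, zero_add, evenPart_of_even hev]
      exact h hev V hV s hs hsI
    · have e1 : D.app V hV s = 0 := lead_app_zero_of_odd hk hodd a.2 hV hs
      rw [e1]
      exact Ideal.zero_mem _
  have e : a = ⟨b, hbk⟩ * ⟨b⁻¹ * a.1, hb'⟩ := Subtype.ext (mul_inv_cancel_left b a.1).symm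
  rw [e, toNormalSheaf_mul, toNormalSheaf_eq_zero_of_mem_aut hk ⟨b, hbk⟩ haut,
    toNormalSheaf_eq_zero_of_mem_succ hk ⟨b⁻¹ * a.1, hb'⟩ hb]
  exact add_zero _

/-- Automorphisms whose leading components agree on `Y` on the functions vanishing on `Y` represent
the same section of the normal sheaf. -/
theorem toNormalSheaf_eq (hf : f.IsEven) (hk : 2 ≤ k) (a b : X.greenSubgroup k U)
    (h : Even k → ∀ V (hV : V ≤ U) (n : X.sec V), IsHomogeneous 0 n → n ∈ f.splitIdeal V →
      proj k (a.1.app V hV n) - proj k (b.1.app V hV n) ∈ f.splitIdeal V) :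
    f.toNormalSheaf hk U a = f.toNormalSheaf hk U b := by
  have h0 : f.toNormalSheaf hk U (b⁻¹ * a) = 0 := by
    refine toNormalSheaf_eq_zero hf hk _ fun hev V hV n hn hnI => ?_
    have hbi : (b⁻¹).1 ∈ X.greenSubgroup k U := (b⁻¹).2
    have hd : a.1.app V hV n - b.1.app V hV n ∈ X.ferm k V := by
      have := sub_mem (a.2 V hV n) (b.2 V hV n)
      rwa [sub_sub_sub_cancel_right] at this
    have e1 : (b⁻¹ * a).1.app V hV n =
        (b⁻¹).1.app V hV (a.1.app V hV n - b.1.app V hV n) + n := by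
      rw [map_sub]
      have : (b⁻¹).1.app V hV (b.1.app V hV n) = n := (b.1.app V hV).symm_apply_apply n
      rw [this, sub_add_cancel]
      rfl
    rw [e1, proj_add, greenSubgroup_proj hbi hk hV hd, hn.proj_eq, if_neg (by omega), add_zero,
      proj_sub]
    exact h hev V hV n hn hnI
  have e : a = b * (b⁻¹ * a) := (mul_inv_cancel_left b a).symm
  rw [e, toNormalSheaf_mul, h0]
  exact add_zero _

end Embedding

end Supergeometry

namespace Supergeometry

variable {X Y : Supergeometry.{u}} {U V W : Opens X.Base} {e k : ℕ}

/-! ### Vector fields normal to the submanifold -/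

/-- The combination of derivations of degree zero with coefficients of even degree `e`. -/
def GradedDerivation.combination {ι : Type*} [Fintype ι] (D : ι → GradedDerivation X U 0)
    (he : Even e) (c : ι → X.sec U) (hc : ∀ i, IsHomogeneous e (c i)) :
    GradedDerivation X U e where
  app V hV := ∑ i, LinearMap.mulLeft ℂ (res hV (c i)) ∘ₗ (D i).app V hV
  app_res V V' hV h s := by
    simp only [LinearMap.sum_apply, LinearMap.comp_apply, LinearMap.mulLeft_apply, map_sum,
      map_mul, (D _).app_res V V' hV h]
    rfl
  leibniz V hV s t := by
    simp only [LinearMap.sum_apply, LinearMap.comp_apply, LinearMap.mulLeft_apply,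
      Finset.mul_sum, Finset.sum_mul, ← Finset.sum_add_distrib]
    refine Finset.sum_congr rfl fun i _ => ?_
    rw [(D i).leibniz, mul_add, ← mul_assoc, ← mul_assoc, ← mul_assoc,
      ((hc i).res hV).commute he s]
  homogeneous V hV j s hs := by
    simp only [LinearMap.sum_apply, LinearMap.comp_apply, LinearMap.mulLeft_apply]
    refine IsHomogeneous.sum fun i _ => ?_
    have := ((hc i).res hV).mul ((D i).homogeneous V hV j s hs)
    rwa [add_zero, add_comm] at this

theorem GradedDerivation.combination_app {ι : Type*} [Fintype ι] (D : ι → GradedDerivation X U 0)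
    (he : Even e) (c : ι → X.sec U) (hc : ∀ i, IsHomogeneous e (c i)) (hV : V ≤ U) (s : X.sec V) :
    (combination D he c hc).app V hV s = ∑ i, res hV (c i) * (D i).app V hV s := by
  simp only [combination, LinearMap.sum_apply, LinearMap.comp_apply, LinearMap.mulLeft_apply]

theorem GradedDerivation.exp_mem_greenSubgroup (D : GradedDerivation X U e) (he : 0 < e)
    (he2 : Even e) : D.exp he he2 ∈ X.greenSubgroup e U := fun V hV s => by
  have := D.expLin_sub_mem hV (mem_ferm_zero s)
  rwa [zero_add] at this

namespace Embedding

variable {f : Embedding Y X}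

theorem AdaptedCoordinates.combination_coord (A : f.AdaptedCoordinates U) (he : Even e)
    (c : Fin A.codim → X.sec U) (hc : ∀ i, IsHomogeneous e (c i)) (hV : V ≤ U) (i : Fin A.codim) :
    (GradedDerivation.combination A.deriv he c hc).app V hV (res hV (A.coord i)) =
      res hV (c i) := by
  rw [GradedDerivation.combination_app, Finset.sum_eq_single i]
  · rw [A.deriv_coord, if_pos rfl, mul_one]
  · intro j _ hj
    rw [A.deriv_coord, if_neg hj, mul_zero]
  · intro h
    exact absurd (Finset.mem_univ i) h

/-- A function vanishing on `Y` is locally a combination of the coordinates whose coefficients are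
functions. -/
theorem AdaptedCoordinates.exists_eq_sum_of_isHomogeneous (A : f.AdaptedCoordinates U) (hV : V ≤ U)
    {n : X.sec V} (hn : IsHomogeneous 0 n) (hnI : n ∈ f.splitIdeal V) {x : X.Base} (hx : x ∈ V) :
    ∃ (W : Opens X.Base) (_ : x ∈ W) (h : W ≤ V) (c : Fin A.codim → X.sec W),
      (∀ i, IsHomogeneous 0 (c i)) ∧ res h n = ∑ i, c i * res (h.trans hV) (A.coord i) := by
  obtain ⟨W, hxW, h, c, e⟩ := A.exists_eq_sum V hV n hnI x hx
  refine ⟨W, hxW, h, fun i => proj 0 (c i), fun i => isHomogeneous_proj 0 _, ?_⟩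
  rw [← (hn.res h).proj_same, e, proj_sum]
  exact Finset.sum_congr rfl fun i _ =>
    ((A.isHomogeneous_coord i).res (h.trans hV)).proj_mul_right (c i) 0

/-- Away from `Y`, the ideal of the split embedding is everything. -/
theorem mem_splitIdeal_of_disjoint (hV : ∀ y, f.toFun y ∉ V) (s : X.sec V) :
    s ∈ f.splitIdeal V := fun y => absurd y.2 (hV y.1)

theorem exists_nbhd_of_notMem_range {x : X.Base} (hx : x ∉ Set.range f.toFun) :
    ∃ U : Opens X.Base, x ∈ U ∧ ∀ V ≤ U, ∀ y, f.toFun y ∉ V :=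
  ⟨⟨(Set.range f.toFun)ᶜ, f.isClosed_range.isOpen_compl⟩, hx, fun _ hV y hy => hV hy ⟨y, rfl⟩⟩

theorem par_val (k : ℕ) : (par k).val = k % 2 := rfl

theorem isHomogeneous_of_even (hev : Even k) (n : f.conormal (par k) V) : IsHomogeneous 0 n.1 := by
  have := n.2.1
  rwa [par_val, Nat.even_iff.1 hev] at this

/-! ### Sections of the normal sheaf induced by homomorphisms -/

variable (f) in
/-- The automorphism `a` has the leading component `h` along `Y`. -/
def HasLeading (h : f.LeadingHom k) (U : Opens X.Base) (a : X.greenSubgroup k U) : Prop :=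
  ∀ V (hV : V ≤ U) (n : f.conormal (par k) V),
    proj k (a.1.app V hV n.1) - h.1.app V n ∈ f.splitIdeal V

theorem HasLeading.restrict {h : f.LeadingHom k} {a : X.greenSubgroup k U}
    (ha : f.HasLeading h U a) (hVU : V ≤ U) :
    f.HasLeading h V ⟨SuperAut.restrict hVU a.1, fun W hW s => a.2 W (hW.trans hVU) s⟩ :=
  fun W hW n => ha W (hW.trans hVU) n

/-- The leading component along `Y` determines the section of the normal sheaf. -/
theorem HasLeading.toNormalSheaf_eq (hf : f.IsEven) (hk : 2 ≤ k) {h : f.LeadingHom k}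
    {a b : X.greenSubgroup k U} (ha : f.HasLeading h U a) (hb : f.HasLeading h U b) :
    f.toNormalSheaf hk U a = f.toNormalSheaf hk U b := by
  refine Embedding.toNormalSheaf_eq hf hk a b fun hev V hV n hn hnI => ?_
  have hn' : IsHomogeneous (par k).val n := by
    rwa [par_val, Nat.even_iff.1 hev]
  have := sub_mem (ha V hV ⟨n, hn', hnI⟩) (hb V hV ⟨n, hn', hnI⟩)
  rwa [sub_sub_sub_cancel_right] at this

/-- A homomorphism induces at most one section of the normal sheaf. -/
theorem Induces.eq (hf : f.IsEven) {hk : 2 ≤ k} {h : f.LeadingHom k}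
    {r r' : (f.normalSheaf hk).obj.obj (op ⊤)} (hr : f.Induces hk h r) (hr' : f.Induces hk h r') :
    r = r' := by
  refine Cech.eq_of_locally_eq _ r r' fun x _ => ?_
  obtain ⟨U, hxU, a, ea, ha⟩ := hr x
  obtain ⟨U', hxU', a', ea', ha'⟩ := hr' x
  refine ⟨U ⊓ U', ⟨hxU, hxU'⟩, le_top, ?_⟩
  rw [← Cech.sres_sres _ (le_top (a := U)) inf_le_left r,
    ← Cech.sres_sres _ (le_top (a := U')) inf_le_right r', ea, ea', sres_toNormalSheaf,
    sres_toNormalSheaf]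
  exact HasLeading.toNormalSheaf_eq hf hk (HasLeading.restrict ha inf_le_left)
    (HasLeading.restrict ha' inf_le_right)

/-- The section of the normal sheaf given by automorphisms with the leading component `h`. -/
theorem exists_induces (hf : f.IsEven) (hk : 2 ≤ k) (h : f.LeadingHom k)
    (hloc : ∀ x, ∃ (U : Opens X.Base) (_ : x ∈ U) (a : X.greenSubgroup k U), f.HasLeading h U a) :
    ∃ r, f.Induces hk h r := by
  choose U hxU a ha using hloc
  obtain ⟨r, hr⟩ := Cech.exists_gluing (f.normalSheaf hk) U hxU
    (fun x => f.toNormalSheaf hk (U x) (a x)) fun x y => by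
      rw [sres_toNormalSheaf, sres_toNormalSheaf]
      exact HasLeading.toNormalSheaf_eq hf hk ((ha x).restrict inf_le_left)
        ((ha y).restrict inf_le_right)
  exact ⟨r, fun x => ⟨U x, hxU x, a x, hr x, ha x⟩⟩

/-- For even `k`, the exponential of the vector field `∑ h(y_i) ∂_i` normal to `Y` has the leading
component `h` along `Y`. -/
theorem exists_hasLeading (hf : f.IsEven) (hk : 2 ≤ k) (hev : Even k) (h : f.LeadingHom k)
    (x : X.Base) :
    ∃ (U : Opens X.Base) (_ : x ∈ U) (a : X.greenSubgroup k U), f.HasLeading h U a := by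
  by_cases hx : x ∈ Set.range f.toFun
  · obtain ⟨y, rfl⟩ := hx
    obtain ⟨U, hyU, -, -, ⟨A⟩⟩ := exists_adaptedCoordinates hf y ⊤ trivial
    have hcon : ∀ {V : Opens X.Base} {s : X.sec V},
        IsHomogeneous 0 s → IsHomogeneous (par k).val s := by
      intro V s hs
      rwa [par_val, Nat.even_iff.1 hev]
    let N : Fin A.codim → f.conormal (par k) U := fun i =>
      ⟨A.coord i, hcon (A.isHomogeneous_coord i), A.coord_mem i⟩
    let D := GradedDerivation.combination A.deriv hev (fun i => h.1.app U (N i))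
      fun i => h.2 U (N i)
    refine ⟨U, hyU, ⟨D.exp (by omega) hev, D.exp_mem_greenSubgroup _ _⟩, fun V hV n => ?_⟩
    have hn := isHomogeneous_of_even hev n
    have hDn : IsHomogeneous k (D.app V hV n.1) := by
      have := D.homogeneous V hV 0 n.1 hn
      rwa [zero_add] at this
    have e1 : proj k ((D.exp (by omega) hev).app V hV n.1) = D.app V hV n.1 := by
      have := mem_ferm_iff.1 (D.expLin_sub_sub_mem hV hn.mem_ferm) k (by omega)
      rw [proj_sub, proj_sub, hDn.proj_same, hn.proj_eq, if_neg (by omega), sub_zero,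
        sub_eq_zero] at this
      exact this
    change proj k ((D.exp (by omega) hev).app V hV n.1) - _ ∈ _
    rw [e1]
    refine mem_splitIdeal_local fun x hx => ?_
    obtain ⟨W, hxW, hWV, c, hc, e2⟩ := A.exists_eq_sum_of_isHomogeneous hV hn n.2.2 hx
    refine ⟨W, hxW, hWV, ?_⟩
    have hWU := hWV.trans hV
    let M : Fin A.codim → f.conormal (par k) W := fun i =>
      f.conormalMul (par k) (c i) (hc i) (f.conormalRes (par k) hWU (N i))
    have e3 : f.conormalRes (par k) hWV n = ∑ i, M i := by
      refine Subtype.ext ?_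
      rw [AddSubmonoidClass.coe_finsetSum]
      exact e2
    have e4 : res hWV (h.1.app V n) = ∑ i, c i * res hWU (h.1.app U (N i)) := by
      rw [← h.1.app_res, e3, map_sum]
      refine Finset.sum_congr rfl fun i _ => ?_
      rw [h.1.app_mul, h.1.app_res]
    have e5 : D.app W hWU (∑ i, c i * res hWU (A.coord i)) =
        ∑ i, c i * res hWU (h.1.app U (N i)) +
          ∑ i, D.app W hWU (c i) * res hWU (A.coord i) := by
      rw [map_sum, ← Finset.sum_add_distrib]
      refine Finset.sum_congr rfl fun i _ => ?_
      rw [D.leibniz]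
      congr 2
      exact A.combination_coord hev _ _ hWU i
    have e6 : res hWV (D.app V hV n.1) = D.app W hWU (∑ i, c i * res hWU (A.coord i)) :=
      (D.app_res V W hV hWV n.1).symm.trans (congrArg (D.app W hWU) e2)
    have e7 : res hWV (D.app V hV n.1 - h.1.app V n) =
        ∑ i, D.app W hWU (c i) * res hWU (A.coord i) :=
      (map_sub (res hWV) _ _).trans
        ((congrArg₂ (· - ·) (e6.trans e5) e4).trans (add_sub_cancel_left _ _))
    rw [e7]
    exact Ideal.sum_mem _ fun i _ =>
      mul_mem_splitIdeal_left _ (f.res_splitIdeal hWU (A.coord_mem i))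
  · obtain ⟨U, hxU, hU⟩ := exists_nbhd_of_notMem_range hx
    exact ⟨U, hxU, 1, fun V hV n => mem_splitIdeal_of_disjoint (hU V hV) _⟩

/-! ### Straightening of ideal sheaves -/

/-- The maximal splitting degree bounds the degrees in which generators move the conormal sheaf. -/
theorem GeneratedIdeal.hom_sub_mem (S : f.GeneratedIdeal k) (p : Fin 2) (n : f.conormal p V) :
    (S.gens.hom p).app V n - n.1 ∈ X.ferm k V := by
  refine mem_ferm_iff.2 fun j hj => ?_
  by_cases h2 : j < 2
  · exact mem_ferm_iff.1 (S.gens.sub_mem p V n) j h2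
  · have hlt : (j : ℕ∞) < (S.gens.hom p).maxSplittingDegree := by
      refine lt_of_lt_of_le (by exact_mod_cast hj) (S.le_maxSplittingDegree.trans ?_)
      rw [Generators.maxSplittingDegree]
      fin_cases p
      · exact min_le_left _ _
      · exact min_le_right _ _
    obtain ⟨m, hm, hjm⟩ := lt_sSup_iff.1 hlt
    rw [proj_sub, hm j (by omega) hjm V n, n.2.1.proj_eq, if_neg, sub_zero]
    have := p.isLt
    omega

/-- There is an automorphism with prescribed values on the coordinates. It is a product of
exponentials of vector fields normal to `Y`, which correct the values degree by degree. -/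
theorem exists_app_coord_eq (hk : 2 ≤ k) (A : f.AdaptedCoordinates U) (G : Fin A.codim → X.sec U)
    (hG : ∀ i, G i - A.coord i ∈ X.ferm k U) (hGp : ∀ i, HasParity 0 (G i)) :
    ∃ b ∈ X.greenSubgroup k U, ∀ i, b.app U le_rfl (A.coord i) = G i := by
  have key : ∀ N, k ≤ N → ∃ b ∈ X.greenSubgroup k U,
      ∀ i, G i - b.app U le_rfl (A.coord i) ∈ X.ferm N U := by
    intro N hN
    induction N, hN using Nat.le_induction with
    | base => exact ⟨1, one_mem _, hG⟩
    | succ N hN ih =>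
      obtain ⟨b, hb, hbG⟩ := ih
      have hpar : ∀ i, HasParity 0 (G i - b.app U le_rfl (A.coord i)) := fun i =>
        (hGp i).sub ((b.parity U le_rfl 0 _).2 ((A.isHomogeneous_coord i).hasParity rfl))
      rcases Nat.even_or_odd N with hev | hodd
      · -- the exponential of `∑ c_i ∂_i` moves the `i`-th coordinate by `c_i` in degree `N`
        have hN0 : 0 < N := by omega
        let c : Fin A.codim → X.sec U := fun i => proj N (G i - b.app U le_rfl (A.coord i))
        let D := GradedDerivation.combination A.deriv hev c fun i => isHomogeneous_proj N _
        refine ⟨D.exp hN0 hev * b,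
          mul_mem (green_anti hN (D.exp_mem_greenSubgroup hN0 hev)) hb, fun i => ?_⟩
        have h1 := D.expLin_sub_sub_mem le_rfl (mem_ferm_zero (b.app U le_rfl (A.coord i)))
        have h2 : D.app U le_rfl (A.coord i) = c i := A.combination_coord hev c _ le_rfl i
        have h3 := D.app_mem_ferm le_rfl (hb U le_rfl (A.coord i))
        rw [map_sub, h2] at h3
        have h4 : G i - b.app U le_rfl (A.coord i) - c i ∈ X.ferm (N + 1) U := by
          refine mem_ferm_iff.2 fun j hj => ?_
          rw [proj_sub, proj_proj]
          split_ifs with hjN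
          · rw [hjN]
            exact sub_self _
          · rw [mem_ferm_iff.1 (hbG i) j (by omega), sub_zero]
        have e1 : G i - (D.exp hN0 hev * b).app U le_rfl (A.coord i) =
            G i - b.app U le_rfl (A.coord i) - c i -
              (D.expLin U le_rfl (b.app U le_rfl (A.coord i)) - b.app U le_rfl (A.coord i) -
                D.app U le_rfl (b.app U le_rfl (A.coord i))) -
              (D.app U le_rfl (b.app U le_rfl (A.coord i)) - c i) := by
          rw [SuperAut.mul_app, GradedDerivation.exp_app]
          abel
        rw [e1]
        exact sub_mem (sub_mem h4 (ferm_anti (by omega) h1)) (ferm_anti (by omega) h3)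
      · -- the values are even, so there is nothing to correct in odd degrees
        exact ⟨b, hb, fun i => (hpar i).mem_ferm_succ (hbG i)
          (by rw [Nat.odd_iff.1 hodd]; decide)⟩
  obtain ⟨b, hb, h⟩ := key (max k (X.rank + 1)) (le_max_left _ _)
  exact ⟨b, hb, fun i =>
    (sub_eq_zero.1 (eq_zero_of_mem_ferm (by omega) (h i))).symm⟩

/-- An ideal sheaf with generators in `𝒮^{≥ k}` is locally taken to the ideal of the split
embedding by an automorphism in `𝒢^{(k)}`. Its inverse `b` takes the coordinates to their images
under the generators; so it takes the ideal of the split embedding into the given ideal sheaf, and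
the two agree because they have the same reduction and isomorphic quotients. -/
theorem GeneratedIdeal.exists_straightening (hf : f.IsEven) (hk : 2 ≤ k) (S : f.GeneratedIdeal k)
    (x : X.Base) :
    ∃ (U : Opens X.Base) (_ : x ∈ U) (a : X.greenSubgroup k U),
      ∀ V (hV : V ≤ U) (s : X.sec V), a.1.app V hV s ∈ f.splitIdeal V ↔ s ∈ S.ideal.ideal V := by
  obtain ⟨O, hxO, ψ, hψres, hψpar, hψker, hψsurj⟩ := S.ideal.locally_iso x
  by_cases hx : x ∈ Set.range f.toFun
  · obtain ⟨y, rfl⟩ := hx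
    obtain ⟨U, hyU, hUO, hUF, ⟨A⟩⟩ := exists_adaptedCoordinates hf y O hxO
    let N : Fin A.codim → f.conormal 0 U := fun i =>
      ⟨A.coord i, A.isHomogeneous_coord i, A.coord_mem i⟩
    obtain ⟨b, hb, hbF⟩ := exists_app_coord_eq hk A (fun i => (S.gens.hom 0).app U (N i))
      (fun i => S.hom_sub_mem 0 (N i)) fun i => S.gens.parity 0 U (N i)
    -- an epimorphism whose kernel is the preimage of the ideal sheaf under `b`
    let ψ' : f.LocalEpi U :=
      { app := fun V hV => (ψ V (hV.trans hUO)).comp (b.app V hV).toAlgHom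
        app_res := fun V V' hV h s => by
          change ψ V' _ (b.app V' _ (res h s)) = res _ (ψ V _ (b.app V hV s))
          rw [b.app_res V V' hV h]
          exact hψres V V' (hV.trans hUO) h _
        parity := fun V hV p s hs => hψpar V (hV.trans hUO) p _ ((b.parity V hV p s).2 hs)
        surjective := fun V hV t x hx => by
          obtain ⟨V', hxV', h, s, e⟩ := hψsurj V (hV.trans hUO) t x hx
          refine ⟨V', hxV', h, (b.app V' (h.trans hV)).symm s, ?_⟩
          change ψ V' _ (b.app V' _ ((b.app V' (h.trans hV)).symm s)) = _
          rw [AlgEquiv.apply_symm_apply]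
          exact e }
    have hψ' : ∀ V (hV : V ≤ U) (s : X.sec V),
        ψ'.app V hV s = 0 ↔ b.app V hV s ∈ S.ideal.ideal V :=
      fun V hV s => hψker V (hV.trans hUO) _
    have hker : ∀ V (hV : V ≤ U) (s : X.sec V), s ∈ f.splitIdeal V → ψ'.app V hV s = 0 := by
      intro V hV s hs
      rw [hψ']
      refine S.ideal.local_mem _ fun x hx => ?_
      obtain ⟨W, hxW, hWV, c, e⟩ := A.exists_eq_sum V hV s hs x hx
      refine ⟨W, hxW, hWV, ?_⟩
      rw [← b.app_res V W hV hWV, e, map_sum]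
      refine Ideal.sum_mem _ fun i _ => ?_
      rw [map_mul, b.app_res U W le_rfl (hWV.trans hV), hbF]
      exact Ideal.mul_mem_left _ _ (S.ideal.res_mem _ (S.gens.mem 0 U (N i)))
    have hred : ∀ V (hV : V ≤ U) (s : X.sec V), ψ'.app V hV s = 0 → HasParity 0 s →
        proj 0 s ∈ f.splitIdeal V := by
      intro V hV s hs hp
      have := (S.ideal.reduction_mem 0 ((hψ' V hV s).1 hs) ((b.parity V hV 0 s).2 hp)).2
      have e : proj 0 (b.app V hV s) = proj 0 s := greenSubgroup_proj hb hk hV (mem_ferm_zero s)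
      change proj 0 (b.app V hV s) ∈ _ at this
      rwa [e] at this
    refine ⟨U, hyU, ⟨b⁻¹, inv_mem hb⟩, fun V hV s => ?_⟩
    have e : b.app V hV ((b⁻¹).app V hV s) = s := (b.app V hV).apply_symm_apply s
    have h1 := hψ' V hV ((b⁻¹).app V hV s)
    rw [e] at h1
    rw [← h1]
    exact ⟨hker V hV _, fun h => ψ'.mem_splitIdeal_of_app_eq_zero hf hUF hker hred hV h⟩
  · -- away from `Y`, both ideals are everything, since the target of the epimorphism vanishes
    obtain ⟨U, hxU, hU⟩ := exists_nbhd_of_notMem_range hx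
    refine ⟨U ⊓ O, ⟨hxU, hxO⟩, 1, fun V hV s => ?_⟩
    have hd := hU V (hV.trans inf_le_left)
    refine iff_of_true (mem_splitIdeal_of_disjoint hd _)
      ((hψker V (hV.trans inf_le_right) s).1 (sec_ext fun z => absurd z.2 (hd z.1)))

/-- The inverse of a straightening automorphism and the generators agree modulo the ideal, so their
leading components agree on `Y`. -/
theorem GeneratedIdeal.hasLeading_inv (hk : 2 ≤ k) (hf : f.IsEven) (S : f.GeneratedIdeal k)
    {a : X.greenSubgroup k U}
    (ha : ∀ V (hV : V ≤ U) (s : X.sec V), a.1.app V hV s ∈ f.splitIdeal V ↔ s ∈ S.ideal.ideal V) :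
    f.HasLeading S.leading U a⁻¹ := by
  intro V hV n
  have e : a.1.app V hV ((a⁻¹).1.app V hV n.1) = n.1 := (a.1.app V hV).apply_symm_apply n.1
  let d := (a⁻¹).1.app V hV n.1 - (S.gens.hom (par k)).app V n
  have hd : d ∈ S.ideal.ideal V := by
    refine sub_mem ((ha V hV _).1 ?_) (S.gens.mem _ V n)
    rw [e]
    exact n.2.2
  have hdk : d ∈ X.ferm k V := by
    have := sub_mem ((a⁻¹).2 V hV n.1) (S.hom_sub_mem (par k) n)
    rwa [sub_sub_sub_cancel_right] at this
  have h := proj_mem_splitIdeal hf ((ha V hV d).2 hd) k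
  rw [greenSubgroup_proj a.2 hk hV hdk, proj_sub] at h
  exact h

end Embedding

end Supergeometry

namespace Supergeometry

namespace Embedding

variable {X Y : Supergeometry.{u}} {f : Embedding Y X} {U V W : Opens X.Base} {k : ℕ}

/-! ### The classes of generated ideal sheaves -/

/-- The automorphisms in `𝒢^{(k)}` for odd `k` do not move functions in degree `k`, hence represent
zero. -/
theorem normalSheaf_eq_zero_of_odd (hf : f.IsEven) (hk : 2 ≤ k) (hodd : _root_.Odd k)
    (r : (f.normalSheaf hk).obj.obj (op ⊤)) : r = 0 := by
  refine Cech.eq_of_locally_eq _ r 0 fun x _ => ?_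
  obtain ⟨V, hxV, a, e⟩ := exists_local_toNormalSheaf hk r x
  refine ⟨V, hxV, le_top, ?_⟩
  rw [e, toNormalSheaf_eq_zero hf hk a fun hev => absurd hodd (Nat.not_odd_iff_even.2 hev)]
  exact (map_zero ((f.normalSheaf hk).obj.map (homOfLE (le_top (a := V))).op).hom).symm

variable (f) in
open Classical in
/-- The section of the normal sheaf induced by `h`, or zero if there is none. -/
def inducedSection (hk : 2 ≤ k) (h : f.LeadingHom k) : (f.normalSheaf hk).obj.obj (op ⊤) :=
  if H : ∃ r, f.Induces hk h r then H.choose else 0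

theorem induces_inducedSection {hk : 2 ≤ k} {h : f.LeadingHom k} (H : ∃ r, f.Induces hk h r) :
    f.Induces hk h (f.inducedSection hk h) := by
  rw [inducedSection, dif_pos H]
  exact H.choose_spec

theorem exists_induces_leading (hf : f.IsEven) (hk : 2 ≤ k) (S : f.GeneratedIdeal k) :
    ∃ r, f.Induces hk S.leading r := by
  refine exists_induces hf hk _ fun x => ?_
  obtain ⟨U, hxU, a, ha⟩ := S.exists_straightening hf hk x
  exact ⟨U, hxU, a⁻¹, S.hasLeading_inv hk hf ha⟩

/-- Two automorphisms that straighten the same ideal sheaf differ by one that preserves the ideal of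
the split embedding. -/
theorem GeneratedIdeal.mul_inv_mem (S : f.GeneratedIdeal k) {a b : SuperAut X U}
    (ha : a ∈ X.greenSubgroup k U) (hb : b ∈ X.greenSubgroup k U)
    (ha' : ∀ V (hV : V ≤ U) (s : X.sec V), a.app V hV s ∈ f.splitIdeal V ↔ s ∈ S.ideal.ideal V)
    (hb' : ∀ V (hV : V ≤ U) (s : X.sec V), b.app V hV s ∈ f.splitIdeal V ↔ s ∈ S.ideal.ideal V) :
    a * b⁻¹ ∈ X.greenSubgroup k U ⊓ f.autSubgroup U := by
  refine ⟨(X.greenSubgroup k U).mul_mem ha ((X.greenSubgroup k U).inv_mem hb), fun V hV s => ?_⟩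
  have e : b.app V hV ((b.app V hV).symm s) = s := AlgEquiv.apply_symm_apply _ s
  have h1 := hb' V hV ((b.app V hV).symm s)
  rw [e] at h1
  exact (ha' V hV _).trans h1.symm

/-- The local straightening automorphisms form the cocycle `α_x α_y⁻¹`. -/
theorem exists_isAssociated (hf : f.IsEven) (hk : 2 ≤ k) (S : f.GeneratedIdeal k) :
    ∃ z, f.IsAssociated S z := by
  choose U hxU a ha using S.exists_straightening hf hk
  have hmem : ∀ x y (T : Opens X.Base) (h : T ⟶ U x) (h' : T ⟶ U y),
      SuperAut.restrict h.le (a x).1 * (SuperAut.restrict h'.le (a y).1)⁻¹ ∈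
        X.greenSubgroup k T ⊓ f.autSubgroup T := fun x y T h h' =>
    S.mul_inv_mem (fun V hV s => (a x).2 V (hV.trans h.le) s)
      (fun V hV s => (a y).2 V (hV.trans h'.le) s) (fun V hV s => ha x V (hV.trans h.le) s)
      fun V hV s => ha y V (hV.trans h'.le) s
  let c : Cech.Cocycle (f.green k).presheaf :=
    { cover := U
      mem_cover := hxU
      cocycle :=
        { ev := fun x y T h h' => ⟨_, hmem x y T h h'⟩
          ev_precomp := fun x y T T' φ h h' => rfl
          ev_trans := fun x y z T h h' h'' => by
            refine Subtype.ext ?_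
            change SuperAut.restrict h.le (a x).1 * (SuperAut.restrict h'.le (a y).1)⁻¹ *
              (SuperAut.restrict h'.le (a y).1 * (SuperAut.restrict h''.le (a z).1)⁻¹) =
              SuperAut.restrict h.le (a x).1 * (SuperAut.restrict h''.le (a z).1)⁻¹
            group } }
  exact ⟨Quotient.mk _ c, c, a, ha, fun _ _ _ _ _ => rfl, rfl⟩

/-- Two choices of straightening automorphisms `α_x`, `α'_x` differ by the cochain `α'_x α_x⁻¹`. -/
theorem IsAssociated.eq {S : f.GeneratedIdeal k} {z z' : Cech.H1 (f.green k).presheaf}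
    (hz : f.IsAssociated S z) (hz' : f.IsAssociated S z') : z = z' := by
  obtain ⟨c, a, ha, hc, rfl⟩ := hz
  obtain ⟨c', a', ha', hc', rfl⟩ := hz'
  have hmem : ∀ x, SuperAut.restrict (inf_le_right : c.cover x ⊓ c'.cover x ≤ _) (a' x).1 *
      (SuperAut.restrict (inf_le_left : c.cover x ⊓ c'.cover x ≤ _) (a x).1)⁻¹ ∈
        X.greenSubgroup k (c.cover x ⊓ c'.cover x) ⊓ f.autSubgroup (c.cover x ⊓ c'.cover x) :=
    fun x => S.mul_inv_mem (fun V hV s => (a' x).2 V (hV.trans inf_le_right) s)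
      (fun V hV s => (a x).2 V (hV.trans inf_le_left) s)
      (fun V hV s => ha' x V (hV.trans inf_le_right) s)
      fun V hV s => ha x V (hV.trans inf_le_left) s
  refine Quotient.sound ⟨fun x => c.cover x ⊓ c'.cover x, fun x => ⟨c.mem_cover x, c'.mem_cover x⟩,
    fun x => inf_le_left, fun x => inf_le_right, fun x => ⟨_, hmem x⟩, fun x y T h h' => ?_⟩
  refine Subtype.ext ?_
  let C : SuperAut X T :=
    (c.cocycle.ev x y (h ≫ homOfLE inf_le_left) (h' ≫ homOfLE inf_le_left)).1
  let C' : SuperAut X T :=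
    (c'.cocycle.ev x y (h ≫ homOfLE inf_le_right) (h' ≫ homOfLE inf_le_right)).1
  have e1 : C = SuperAut.restrict (h.le.trans inf_le_left) (a x).1 *
      (SuperAut.restrict (h'.le.trans inf_le_left) (a y).1)⁻¹ := hc x y T _ _
  have e2 : C' = SuperAut.restrict (h.le.trans inf_le_right) (a' x).1 *
      (SuperAut.restrict (h'.le.trans inf_le_right) (a' y).1)⁻¹ := hc' x y T _ _
  change (SuperAut.restrict (h.le.trans inf_le_right) (a' x).1 *
      (SuperAut.restrict (h.le.trans inf_le_left) (a x).1)⁻¹) * C =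
    C' * (SuperAut.restrict (h'.le.trans inf_le_right) (a' y).1 *
      (SuperAut.restrict (h'.le.trans inf_le_left) (a y).1)⁻¹)
  rw [e1, e2]
  group

/-- The inverses of the straightening automorphisms lift the section induced by the leading
component, and their differences form the primary obstruction cocycle. -/
theorem connecting_eq_primaryObstruction (hf : f.IsEven) (hk : 2 ≤ k) {S : f.GeneratedIdeal k}
    {r : (f.normalSheaf hk).obj.obj (op ⊤)} (hr : f.Induces hk S.leading r)
    {z : Cech.H1 (f.green k).presheaf} (hz : f.IsAssociated S z) :
    Cech.connecting (f.obstructionIncl hk) r = f.primaryObstruction hk z := by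
  obtain ⟨c, a, ha, hc, rfl⟩ := hz
  refine Cech.connecting_eq (f.obstructionIncl hk)
    (c := c.map (SubPresheaf.projQuotSheaf (f.green_commLE hk))) ⟨fun x =>
      SubPresheaf.toQuotSheaf (Supergeometry.green_commLE (X := X) hk) (c.cover x) (a x)⁻¹,
      fun x => ?_, fun x y T h h' => ?_⟩
  · refine Cech.eq_of_locally_eq (f.normalSheaf hk) (f.toNormalSheaf hk (c.cover x) (a x)⁻¹)
      (Cech.sres (f.normalSheaf hk) le_top r) fun x' hx' => ?_
    obtain ⟨U, hxU, b, eb, hb⟩ := hr x'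
    refine ⟨c.cover x ⊓ U, ⟨hx', hxU⟩, inf_le_left, ?_⟩
    have hlead := HasLeading.toNormalSheaf_eq hf hk
      ((S.hasLeading_inv hk hf (ha x)).restrict (inf_le_left : c.cover x ⊓ U ≤ _))
      (HasLeading.restrict hb (inf_le_right : c.cover x ⊓ U ≤ _))
    rw [← sres_toNormalSheaf, ← sres_toNormalSheaf hk _ b, ← eb] at hlead
    exact hlead.trans ((Cech.sres_sres (f.normalSheaf hk) le_top inf_le_right r).trans
      (Cech.sres_sres (f.normalSheaf hk) le_top inf_le_left r).symm)
  · let Q := SubPresheaf.toQuotSheaf (Supergeometry.green_commLE (X := X) hk)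
    let ax : X.greenSubgroup k T := (X.green k).resHom h.op (a x)
    let ay : X.greenSubgroup k T := (X.green k).resHom h'.op (a y)
    let C : (f.green k).carrier (op T) := c.cocycle.ev x y h h'
    have e0 : (⟨C.1, C.2.1⟩ : X.greenSubgroup k T) = ax * ay⁻¹ := Subtype.ext (hc x y T h h')
    have e1 : (f.obstructionIncl hk).hom.app (op T)
        (SubPresheaf.toQuotSheaf (f.green_commLE hk) T C) = Q T (ax * ay⁻¹) :=
      (obstructionIncl_toQuotSheaf hk C).trans (congrArg (Q T) e0)
    have e2 : Q T (ax * ay⁻¹) = Q T ax + Q T ay⁻¹ :=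
      SubPresheaf.toQuotSheaf_mul (Supergeometry.green_commLE (X := X) hk) T ax ay⁻¹
    have einv : ∀ b : X.greenSubgroup k T, Q T b⁻¹ = -Q T b :=
      SubPresheaf.toQuotSheaf_inv (Supergeometry.green_commLE (X := X) hk) T
    have e3 : (SubPresheaf.quotSheaf (Supergeometry.green_commLE (X := X) hk)).obj.map h'.op
        (Q (c.cover y) (a y)⁻¹) = -Q T ay :=
      (SubPresheaf.map_toQuotSheaf (Supergeometry.green_commLE (X := X) hk) h' (a y)⁻¹).trans
        (einv ay)
    have e4 : (SubPresheaf.quotSheaf (Supergeometry.green_commLE (X := X) hk)).obj.map h.op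
        (Q (c.cover x) (a x)⁻¹) = -Q T ax :=
      (SubPresheaf.map_toQuotSheaf (Supergeometry.green_commLE (X := X) hk) h (a x)⁻¹).trans
        (einv ax)
    rw [einv] at e2
    refine (e1.trans e2).trans ?_
    refine Eq.trans ?_ (congrArg₂ (· - ·) e3 e4).symm
    rw [sub_neg_eq_add]
    exact add_comm _ _

end Embedding

end Supergeometry

theorem mainTheorem5 (X Y : Supergeometry.{u}) (f : Supergeometry.Embedding Y X)
    (hf : f.IsEven) (k : ℕ) (hk : 2 ≤ k) :
    ∃ (ρ : f.LeadingHom k → (f.normalSheaf hk).obj.obj (op ⊤))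
      (Φ : f.GeneratedIdeal k → Cech.H1 (f.green k).presheaf),
      ((∀ h r, f.Induces hk h r → r = ρ h) ∧
        (Even k → ∀ h, f.Induces hk h (ρ h)) ∧
        (∀ S : f.GeneratedIdeal k, f.Induces hk S.leading (ρ S.leading)) ∧
        (Odd k → ∀ r : (f.normalSheaf hk).obj.obj (op ⊤), r = 0)) ∧
      (∀ S z, f.IsAssociated S z ↔ z = Φ S) ∧
      ∀ S : f.GeneratedIdeal k,
        Cech.connecting (f.obstructionIncl hk) (ρ S.leading) = f.primaryObstruction hk (Φ S) := by
  choose Φ hΦ using Supergeometry.Embedding.exists_isAssociated hf hk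
  have hρ := fun S => Supergeometry.Embedding.induces_inducedSection
    (Supergeometry.Embedding.exists_induces_leading hf hk S)
  refine ⟨f.inducedSection hk, Φ, ⟨fun h r hr => ?_, fun hev h => ?_, hρ, fun hodd =>
    Supergeometry.Embedding.normalSheaf_eq_zero_of_odd hf hk hodd⟩, fun S z => ⟨fun hz => ?_, ?_⟩,
    fun S => ?_⟩
  · exact hr.eq hf (Supergeometry.Embedding.induces_inducedSection ⟨r, hr⟩)
  · exact Supergeometry.Embedding.induces_inducedSection
      (Supergeometry.Embedding.exists_induces hf hk h
        (Supergeometry.Embedding.exists_hasLeading hf hk hev h))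
  · exact hz.eq (hΦ S)
  · rintro rfl
    exact hΦ S
  · exact Supergeometry.Embedding.connecting_eq_primaryObstruction hf hk (hρ S) (hΦ S)

end
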